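/- Let $M$ and $N$ be smooth Hausdorff manifolds modelled on Banach spaces which are $C^\infty$-paracompact (paracompact, and every open cover admits a subordinate smooth partition of unity). Let $p\colon M\to N$ be a smooth surjective submersion, i.e. around every point there are charts in which $p$ is the projection of the model space of $M$ onto a complemented subspace. Write $\pi_M\colon TM\to M$ for the bundle projection. For a subbundle $W$ of a tangent bundle, with projection $\pi\colon W\to M$ and total space regarded as a submanifold, a *spray* on $W$ is a smooth vector field $S\colon W\to TW$ such that $T\pi\circ S$ is the inclusion of $W$ and $S\circ h_\lambda=Th_\lambda(\lambda S)$ for all $\lambda\in\mathbb R$, where $h_\lambda$ is fibrewise multiplication by $\lambda$; its *exponential* is $\exp_S=\pi\circ\mathrm{Fl}^S_1$, defined on the vectors for which the flow $\mathrm{Fl}^S$ exists up to time $1$. A *local addition* on a manifold $M$ is a pair $(U,\Sigma)$ with $U\subseteq TM$ an open neighbourhood of the zero section and $\Sigma\colon U\to M$ with $\Sigma(0_m)=m$ for all $m\in M$, such that $(\pi_M,\Sigma)$ is a diffeomorphism of $U$ onto an open subset of $M\times M$. A *linear connection* on $W$ is a bundle map $K\colon TW\to W$ over $\pi$ which in local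 trivialisations has the form $(u,\xi,X,\eta)\mapsto(u,\eta+B(u)(X,\xi))$ with $B$ a smooth map into the continuous bilinear maps; *parallel transport* $P^{c}_{0,1}(v)$ along $c\colon[0,1]\to M$ is the value at time $1$ of the curve $\eta$ in $W$ over $c$ with $\eta(0)=v$ and $K\circ\dot\eta=0$. Fix the following data. 1. An Ehresmann connection for $p$: a smooth subbundle $\mathcal H\subseteq TM$ with $TM=\mathcal V\oplus\mathcal H$, where $\mathcal V=\ker Tp$. 2. A spray $S_N$ on $TN$ and a set $\Omega_N\subseteq TN$, contained in the domain of $\exp_{S_N}$, such that $\Sigma_N:=\exp_{S_N}|_{\Omega_N}$ is a local addition on $N$ with domain $\Omega_N$. 3. The lift $S_{\mathcal H}$ of $S_N$, i.e. the spray on $\mathcal H$ with $T(Tp|_{\mathcal H})\circ S_{\mathcal H}=S_N\circ Tp|_{\mathcal H}$. 4. A spray $S_{\mathcal V}$ on $\mathcal V$ and an open neighbourhood $O\subseteq\mathcal V$ of the zero section, contained in the domain of $\exp_{S_{\mathcal V}}$, such that $(\pi_M,\exp_{S_{\mathcal V}})$ is a diffeomorphism of $O$ onto an open subset of $M\times_pM$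 with $\exp_{S_{\mathcal V}}(0_m)=m$ for all $m\in M$ (a local addition on $p$). 5. A linear connection on $\mathcal V$, with parallel transport $P$. Then there is an open neighbourhood $\Omega_M\subseteq TM$ of the zero section such that, splitting elements of $\Omega_M$ as $(v,h)\in\mathcal V\oplus\mathcal H$, the map $$\Sigma_M\colon\Omega_M\to M,\qquad \Sigma_M(v,h):=\exp_{S_{\mathcal V}}\bigl(P^{c_h}_{0,1}(v)\bigr),\qquad c_h(t)=\exp_{S_{\mathcal H}}(th),$$ is well defined (for all $(v,h)\in\Omega_M$, $th$ lies in the domain of $\exp_{S_{\mathcal H}}$ for every $t\in[0,1]$, the parallel transport exists, and $P^{c_h}_{0,1}(v)\in O$), $(\Omega_M,\Sigma_M)$ is a local addition on $M$, and for all $(v,h)\in\Omega_M$ one has $Tp(h)\in\Omega_N$ and $p(\Sigma_M(v,h))=\Sigma_N(Tp(h))$; that is, $p\circ\Sigma_M=\Sigma_N\circ(0\oplus Tp|_{\mathcal H})$ on $\Omega_M$. -/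

import Mathlib

open Set Filter Topology Bundle Manifold
open scoped ContDiff

noncomputable section

namespace SubmersionAddition

universe u

/-! ### Smooth paracompactness -/

/-- A manifold is `C^∞`-paracompact if it is paracompact and every open cover admits a
subordinate smooth partition of unity. -/
structure IsSmoothlyParacompact (E : Type*) [NormedAddCommGroup E] [NormedSpace ℝ E]
    (M : Type*) [TopologicalSpace M] [ChartedSpace E M] : Prop where
  paracompact : ParacompactSpace M
  exists_partition : ∀ 𝒰 : Set (Set M), (∀ U ∈ 𝒰, IsOpen U) → ⋃₀ 𝒰 = univ →
    ∃ f : SmoothPartitionOfUnity 𝒰 𝓘(ℝ, E) M univ, f.IsSubordinate (fun U => (U : Set M))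

/-! ### Maps on (split) submanifolds -/

section Submanifolds

variable {E₁ H₁ E₂ H₂ : Type*} [NormedAddCommGroup E₁] [NormedSpace ℝ E₁] [TopologicalSpace H₁]
  [NormedAddCommGroup E₂] [NormedSpace ℝ E₂] [TopologicalSpace H₂]
  (I₁ : ModelWithCorners ℝ E₁ H₁) (I₂ : ModelWithCorners ℝ E₂ H₂)
  {X : Type*} [TopologicalSpace X] [ChartedSpace H₁ X]
  {Y : Type*} [TopologicalSpace Y] [ChartedSpace H₂ Y]

/-- `θ` restricts to a smooth diffeomorphism of `A` onto the subset `θ '' A`. It is used for open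
subsets `A`, `θ '' A` of split submanifolds, where `ContMDiffOn` is smoothness with respect to
the submanifold structure. -/
def IsDiffeoOntoImage (θ : X → Y) (A : Set X) : Prop :=
  ContMDiffOn I₁ I₂ ∞ θ A ∧
    ∃ g : Y → X, ContMDiffOn I₂ I₁ ∞ g (θ '' A) ∧ LeftInvOn g θ A

/-- `A` is a relatively open subset of `B`. -/
def IsRelOpen (A B : Set X) : Prop := ∃ O : Set X, IsOpen O ∧ A = B ∩ O

/-- The tangent bundle `TA ⊆ TX` of a split submanifold `A ⊆ X`: the velocities of curves
in `A`. -/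
def tangentSet (A : Set X) : Set (TangentBundle I₁ X) :=
  {w | ∃ γ : ℝ → X, (∀ᶠ t in 𝓝 (0 : ℝ), γ t ∈ A) ∧ MDifferentiableAt 𝓘(ℝ, ℝ) I₁ γ 0 ∧
    (⟨γ 0, mfderiv 𝓘(ℝ, ℝ) I₁ γ 0 (1 : ℝ)⟩ : TangentBundle I₁ X) = w}

end Submanifolds

section Bundles

variable {E : Type u} [NormedAddCommGroup E] [NormedSpace ℝ E]
  {M : Type*} [TopologicalSpace M] [ChartedSpace E M] [IsManifold 𝓘(ℝ, E) ∞ M]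

/-! ### Subbundles of the tangent bundle -/

/-- The total space of a family of subspaces of the tangent spaces, as a subset of `TM`. -/
def totalSet (W : ∀ x : M, Submodule ℝ (TangentSpace 𝓘(ℝ, E) x)) :
    Set (TangentBundle 𝓘(ℝ, E) M) :=
  {v | v.2 ∈ W v.1}

/-- `W ⊆ TM` is a smooth (split) vector subbundle: locally there is a smooth trivialisation
`U × (F × G) ≅ TM|_U` which identifies `U × (F × 0)` with `W|_U`. -/
def IsSmoothSubbundle (W : ∀ x : M, Submodule ℝ (TangentSpace 𝓘(ℝ, E) x)) : Prop :=
  ∀ x₀ : M, ∃ U : Set M, IsOpen U ∧ x₀ ∈ U ∧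
    ∃ (F : Type u) (_ : NormedAddCommGroup F) (_ : NormedSpace ℝ F)
      (G : Type u) (_ : NormedAddCommGroup G) (_ : NormedSpace ℝ G)
      (Θ : ∀ x : M, (F × G) ≃L[ℝ] TangentSpace 𝓘(ℝ, E) x),
      ContMDiffOn (𝓘(ℝ, E).prod 𝓘(ℝ, F × G)) 𝓘(ℝ, E).tangent ∞
        (fun z : M × (F × G) => (⟨z.1, Θ z.1 z.2⟩ : TangentBundle 𝓘(ℝ, E) M)) (U ×ˢ univ) ∧
      ∀ x ∈ U, ∀ (a : F) (b : G), Θ x (a, b) ∈ W x ↔ b = 0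

/-- Fibrewise multiplication by `c` on `TM`. -/
def fibreScale (c : ℝ) (v : TangentBundle 𝓘(ℝ, E) M) : TangentBundle 𝓘(ℝ, E) M :=
  ⟨v.1, c • v.2⟩

/-- The zero vector at `x`. -/
def zeroVec (x : M) : TangentBundle 𝓘(ℝ, E) M := ⟨x, 0⟩

/-! ### Sprays and their exponential maps -/

/-- `S` is a spray on the subbundle `W ⊆ TM`, anchored by the inclusion. Only the values of `S` on
the total space of `W` matter. For `W = TM` this is a spray on `M`. -/
structure IsSpray (W : ∀ x : M, Submodule ℝ (TangentSpace 𝓘(ℝ, E) x))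
    (S : ∀ v : TangentBundle 𝓘(ℝ, E) M, TangentSpace 𝓘(ℝ, E).tangent v) : Prop where
  /-- `S` is a vector field on the submanifold `W` of `TM`. -/
  mem_tangentSet : ∀ v ∈ totalSet W,
    (⟨v, S v⟩ : TangentBundle 𝓘(ℝ, E).tangent (TangentBundle 𝓘(ℝ, E) M)) ∈
      tangentSet 𝓘(ℝ, E).tangent (totalSet W)
  /-- `S` is smooth. -/
  smooth : ContMDiffOn 𝓘(ℝ, E).tangent 𝓘(ℝ, E).tangent.tangent ∞
    (fun v => (⟨v, S v⟩ : TangentBundle 𝓘(ℝ, E).tangent (TangentBundle 𝓘(ℝ, E) M)))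
    (totalSet W)
  /-- `S` lifts the anchor: `Tπ ∘ S` is the inclusion. -/
  anchor : ∀ v ∈ totalSet W,
    mfderiv 𝓘(ℝ, E).tangent 𝓘(ℝ, E) (TotalSpace.proj : TangentBundle 𝓘(ℝ, E) M → M) v (S v) = v.2
  /-- `S ∘ h_c = T h_c (c S)`, with `h_c` the fibrewise multiplication by `c`. -/
  homogeneous : ∀ (c : ℝ), ∀ v ∈ totalSet W,
    S (fibreScale c v) =
      mfderiv 𝓘(ℝ, E).tangent 𝓘(ℝ, E).tangent
        (fibreScale c : TangentBundle 𝓘(ℝ, E) M → TangentBundle 𝓘(ℝ, E) M) v (c • S v)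

/-- `γ` is an integral curve in `W` of the vector field `S`, on the time interval `[0, 1]`. -/
def IsFlowLine (W : ∀ x : M, Submodule ℝ (TangentSpace 𝓘(ℝ, E) x))
    (S : ∀ v : TangentBundle 𝓘(ℝ, E) M, TangentSpace 𝓘(ℝ, E).tangent v)
    (γ : ℝ → TangentBundle 𝓘(ℝ, E) M) : Prop :=
  (∀ t ∈ Icc (0 : ℝ) 1, γ t ∈ totalSet W) ∧
    IsMIntegralCurveOn (I := 𝓘(ℝ, E).tangent) γ S (Icc (0 : ℝ) 1)

/-- The vectors in `W` for which the flow of `S` is defined up to time `1`. -/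
def expDomain (W : ∀ x : M, Submodule ℝ (TangentSpace 𝓘(ℝ, E) x))
    (S : ∀ v : TangentBundle 𝓘(ℝ, E) M, TangentSpace 𝓘(ℝ, E).tangent v) :
    Set (TangentBundle 𝓘(ℝ, E) M) :=
  {v | ∃ γ : ℝ → TangentBundle 𝓘(ℝ, E) M, IsFlowLine W S γ ∧ γ 0 = v}

open Classical in
/-- The spray exponential map `exp_S = π ∘ Fl^S_1` (with a junk value off `expDomain W S`). -/
def sprayExp (W : ∀ x : M, Submodule ℝ (TangentSpace 𝓘(ℝ, E) x))
    (S : ∀ v : TangentBundle 𝓘(ℝ, E) M, TangentSpace 𝓘(ℝ, E).tangent v)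
    (v : TangentBundle 𝓘(ℝ, E) M) : M :=
  if h : ∃ γ : ℝ → TangentBundle 𝓘(ℝ, E) M, IsFlowLine W S γ ∧ γ 0 = v
  then (h.choose 1).proj else v.proj

/-! ### Linear connections and parallel transport -/

/-- `K : TW → W` is (the connector of) a linear connection on the subbundle `W ⊆ TM`: near every
point there are a smooth trivialisation `Θ : U × F ≅ W|_U`, with `U` a chart domain, and a smooth
map `B` from `U` to the continuous bilinear maps with
`K (TΘ (x, ξ, X, η)) = Θ (x, η + B x (X, ξ))`. Only the values of `K` on `TW` matter. -/
def IsLinearConnection (W : ∀ x : M, Submodule ℝ (TangentSpace 𝓘(ℝ, E) x))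
    (K : ∀ v : TangentBundle 𝓘(ℝ, E) M,
      TangentSpace 𝓘(ℝ, E).tangent v → TangentSpace 𝓘(ℝ, E) v.proj) : Prop :=
  ∀ x₀ : M, ∃ U : Set M, IsOpen U ∧ x₀ ∈ U ∧ U ⊆ (chartAt E x₀).source ∧
    ∃ (F : Type u) (_ : NormedAddCommGroup F) (_ : NormedSpace ℝ F) (_ : CompleteSpace F)
      (Θ : ∀ x : M, F →L[ℝ] TangentSpace 𝓘(ℝ, E) x) (B : M → E →L[ℝ] F →L[ℝ] F),
      ContMDiffOn (𝓘(ℝ, E).prod 𝓘(ℝ, F)) 𝓘(ℝ, E).tangent ∞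
        (fun z : M × F => (⟨z.1, Θ z.1 z.2⟩ : TangentBundle 𝓘(ℝ, E) M)) (U ×ˢ univ) ∧
      (∀ x ∈ U, Function.Injective (Θ x) ∧ (Θ x).range = W x) ∧
      ContMDiffOn 𝓘(ℝ, E) 𝓘(ℝ, E →L[ℝ] F →L[ℝ] F) ∞ B U ∧
      ∀ x ∈ U, ∀ (ξ : F) (X : TangentSpace 𝓘(ℝ, E) x) (η : F),
        K ⟨x, Θ x ξ⟩
          (mfderiv (𝓘(ℝ, E).prod 𝓘(ℝ, F)) 𝓘(ℝ, E).tangent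
            (fun z : M × F => (⟨z.1, Θ z.1 z.2⟩ : TangentBundle 𝓘(ℝ, E) M)) (x, ξ) (X, η)) =
        Θ x (η + B x (trivializationAt E (TangentSpace 𝓘(ℝ, E)) x₀ ⟨x, X⟩).2 ξ)

/-- `η` is a parallel section of `W` along the curve `c : [0, 1] → M`, that is, `K ∘ η' = 0`.
In a trivialisation this is the equation `η' + B (c) (c', η) = 0`. -/
def IsParallelAlong (W : ∀ x : M, Submodule ℝ (TangentSpace 𝓘(ℝ, E) x))
    (K : ∀ v : TangentBundle 𝓘(ℝ, E) M,
      TangentSpace 𝓘(ℝ, E).tangent v → TangentSpace 𝓘(ℝ, E) v.proj)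
    (c : ℝ → M) (η : ℝ → TangentBundle 𝓘(ℝ, E) M) : Prop :=
  ∀ t ∈ Icc (0 : ℝ) 1, (η t).proj = c t ∧ η t ∈ totalSet W ∧
    ∃ w : TangentSpace 𝓘(ℝ, E).tangent (η t),
      HasMFDerivWithinAt 𝓘(ℝ, ℝ) 𝓘(ℝ, E).tangent η (Icc (0 : ℝ) 1) t
        ((1 : ℝ →L[ℝ] ℝ).smulRight w) ∧ K (η t) w = 0

open Classical in
/-- The parallel transport `P_{0,1}^c (v)` (with a junk value if `v` has no parallel extension
along `c`). -/
def parallelTransport (W : ∀ x : M, Submodule ℝ (TangentSpace 𝓘(ℝ, E) x))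
    (K : ∀ v : TangentBundle 𝓘(ℝ, E) M,
      TangentSpace 𝓘(ℝ, E).tangent v → TangentSpace 𝓘(ℝ, E) v.proj)
    (c : ℝ → M) (v : TangentBundle 𝓘(ℝ, E) M) : TangentBundle 𝓘(ℝ, E) M :=
  if h : ∃ η : ℝ → TangentBundle 𝓘(ℝ, E) M, IsParallelAlong W K c η ∧ η 0 = v
  then h.choose 1 else v

/-! ### Local additions on a manifold -/

/-- `(U, σ)` is a local addition on `M`. -/
structure IsLocalAddition (U : Set (TangentBundle 𝓘(ℝ, E) M))
    (σ : TangentBundle 𝓘(ℝ, E) M → M) : Prop where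
  isOpen : IsOpen U
  zero_mem : ∀ x : M, zeroVec x ∈ U
  map_zero : ∀ x : M, σ (zeroVec x) = x
  isOpen_image : IsOpen ((fun v => (v.proj, σ v)) '' U)
  diffeo : IsDiffeoOntoImage 𝓘(ℝ, E).tangent (𝓘(ℝ, E).prod 𝓘(ℝ, E))
    (fun v : TangentBundle 𝓘(ℝ, E) M => (v.proj, σ v)) U

end Bundles

/-! ### Submersions -/

section Submersions

variable {E : Type u} [NormedAddCommGroup E] [NormedSpace ℝ E]
  {M : Type*} [TopologicalSpace M] [ChartedSpace E M] [IsManifold 𝓘(ℝ, E) ∞ M]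
  {E' : Type*} [NormedAddCommGroup E'] [NormedSpace ℝ E']
  {N : Type*} [TopologicalSpace N] [ChartedSpace E' N]

/-- The vertical bundle `ker Tp`. -/
def vertical (E : Type u) [NormedAddCommGroup E] [NormedSpace ℝ E]
    {M : Type*} [TopologicalSpace M] [ChartedSpace E M]
    (E' : Type*) [NormedAddCommGroup E'] [NormedSpace ℝ E']
    {N : Type*} [TopologicalSpace N] [ChartedSpace E' N] (p : M → N) (x : M) :
    Submodule ℝ (TangentSpace 𝓘(ℝ, E) x) :=
  (mfderiv 𝓘(ℝ, E) 𝓘(ℝ, E') p x).ker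

/-- The fibre product `M ×_p M ⊆ M × M`. -/
def fibreProduct (p : M → N) : Set (M × M) := {z | p z.1 = p z.2}

/-- `(O, Ψ)` with `Ψ = (π, σ)` is a local addition on the submersion `p`. -/
structure IsLocalAdditionOn (E' : Type*) [NormedAddCommGroup E'] [NormedSpace ℝ E']
    {N : Type*} [TopologicalSpace N] [ChartedSpace E' N] (p : M → N)
    (O : Set (TangentBundle 𝓘(ℝ, E) M)) (σ : TangentBundle 𝓘(ℝ, E) M → M) : Prop where
  isRelOpen : IsRelOpen O (totalSet (vertical E E' p))
  zero_mem : ∀ x : M, zeroVec x ∈ O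
  map_zero : ∀ x : M, σ (zeroVec x) = x
  isRelOpen_image : IsRelOpen ((fun v => (v.proj, σ v)) '' O) (fibreProduct p)
  diffeo : IsDiffeoOntoImage 𝓘(ℝ, E).tangent (𝓘(ℝ, E).prod 𝓘(ℝ, E))
    (fun v : TangentBundle 𝓘(ℝ, E) M => (v.proj, σ v)) O

/-- An Ehresmann connection for `p`: a smooth subbundle of `TM` complementing the vertical
bundle. -/
structure EhresmannConnection (E : Type u) [NormedAddCommGroup E] [NormedSpace ℝ E]
    {M : Type*} [TopologicalSpace M] [ChartedSpace E M] [IsManifold 𝓘(ℝ, E) ∞ M]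
    (E' : Type*) [NormedAddCommGroup E'] [NormedSpace ℝ E']
    {N : Type*} [TopologicalSpace N] [ChartedSpace E' N] (p : M → N) where
  /-- The horizontal bundle. -/
  horizontal : ∀ x : M, Submodule ℝ (TangentSpace 𝓘(ℝ, E) x)
  smooth : IsSmoothSubbundle horizontal
  isCompl : ∀ x, IsCompl (vertical E E' p x) (horizontal x)

/-- The vertical component of a tangent vector. -/
def EhresmannConnection.verPart {p : M → N} (A : EhresmannConnection E E' p)
    (u : TangentBundle 𝓘(ℝ, E) M) : TangentBundle 𝓘(ℝ, E) M :=
  ⟨u.1, Submodule.projection _ _ (A.isCompl u.1) u.2⟩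

/-- The horizontal component of a tangent vector. -/
def EhresmannConnection.horPart {p : M → N} (A : EhresmannConnection E E' p)
    (u : TangentBundle 𝓘(ℝ, E) M) : TangentBundle 𝓘(ℝ, E) M :=
  ⟨u.1, Submodule.projection _ _ (A.isCompl u.1).symm u.2⟩

/-- `S_H` is the lift to the horizontal bundle of the spray `S_N` on `N`, that is, the spray on the
horizontal bundle which is related to `S_N` by the restriction of `Tp`. -/
structure IsSprayLift [IsManifold 𝓘(ℝ, E') ∞ N] {p : M → N} (A : EhresmannConnection E E' p)
    (S_N : ∀ v : TangentBundle 𝓘(ℝ, E') N, TangentSpace 𝓘(ℝ, E').tangent v)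
    (S_H : ∀ v : TangentBundle 𝓘(ℝ, E) M, TangentSpace 𝓘(ℝ, E).tangent v) : Prop where
  isSpray : IsSpray A.horizontal S_H
  related : ∀ h ∈ totalSet A.horizontal,
    mfderiv 𝓘(ℝ, E).tangent 𝓘(ℝ, E').tangent (tangentMap 𝓘(ℝ, E) 𝓘(ℝ, E') p) h (S_H h) =
      S_N (tangentMap 𝓘(ℝ, E) 𝓘(ℝ, E') p h)

/-- The curve `c_h (t) = exp_{S_H} (t h)`. -/
def horCurve {p : M → N} (A : EhresmannConnection E E' p)
    (S_H : ∀ v : TangentBundle 𝓘(ℝ, E) M, TangentSpace 𝓘(ℝ, E).tangent v)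
    (h : TangentBundle 𝓘(ℝ, E) M) (t : ℝ) : M :=
  sprayExp A.horizontal S_H (fibreScale t h)

/-- The map `(v, h) ↦ P_{0,1}^{c_h} (v)`. -/
def transported {p : M → N} (A : EhresmannConnection E E' p)
    (S_H : ∀ v : TangentBundle 𝓘(ℝ, E) M, TangentSpace 𝓘(ℝ, E).tangent v)
    (K : ∀ v : TangentBundle 𝓘(ℝ, E) M,
      TangentSpace 𝓘(ℝ, E).tangent v → TangentSpace 𝓘(ℝ, E) v.proj)
    (u : TangentBundle 𝓘(ℝ, E) M) : TangentBundle 𝓘(ℝ, E) M :=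
  parallelTransport (vertical E E' p) K (horCurve A S_H (A.horPart u)) (A.verPart u)

/-- The map `Σ_M (v, h) = exp_{S_V} (P_{0,1}^{c_h} (v))`. -/
def sigmaMap {p : M → N} (A : EhresmannConnection E E' p)
    (S_H S_V : ∀ v : TangentBundle 𝓘(ℝ, E) M, TangentSpace 𝓘(ℝ, E).tangent v)
    (K : ∀ v : TangentBundle 𝓘(ℝ, E) M,
      TangentSpace 𝓘(ℝ, E).tangent v → TangentSpace 𝓘(ℝ, E) v.proj)
    (u : TangentBundle 𝓘(ℝ, E) M) : M :=
  sprayExp (vertical E E' p) S_V (transported A S_H K u)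

end Submersions

end SubmersionAddition

end

/-! The map `Σ_M` moves a point in two stages. The horizontal exponential carries `x` to `e =
exp_H(h)`. Since `Tp` sends flow lines of the lifted spray to flow lines of `S_N`, the point `e`
lies over `Σ_N(Tp h)` (`IsSprayLift.map_sprayExp`). The vertical exponential of the transported
vector then moves `e` inside its fibre, because `(π, exp_V)` maps `O` into `M ×_p M`. Hence `p ∘ Σ_M
= Σ_N ∘ Tp` on the horizontal part.

The same two stages can be undone. Given `(x, y)` near the diagonal, let `n` be the vector in `Ω_N`
with `(π, Σ_N)(n) = (p x, p y)`, let `h` be its horizontal lift at `x`, and let `e = exp_H(h)`. Now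
`e` and `y` lie in one fibre, so the local addition on `p` gives a vertical `w` at `e` with
`exp_V(w) = y`, and transporting `w` back along `c_h` gives `v`. Every operation is smooth, so this
formula is a smooth right inverse of `(π, Σ_M)` (`exists_local_rightInverse`); no derivative of
`Σ_M` has to be computed. Reading the same steps as cancellations shows that `(π, Σ_M)` is injective
on all admissible vectors, not only near one point (`IsAdmissible.eq_of_sigmaMap_eq`). The local
inverses therefore agree where they overlap and glue (`exists_isLocalAddition`).

The analytic input is that `exp_H` and the parallel transport exist near zero vectors and depend
smoothly on `h`. In a frame adapted to `V ⊕ H` the horizontal flow and the transport matrix solve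
one autonomous equation in a Banach space. `exists_contDiffOn_flow` solves it by the inverse
function theorem in a space of continuous curves, and homogeneity of the spray turns short time into
time one (`AdaptedFrame.exists_localTransport`). The exponential and the transport are defined by a
choice of solution, so uniqueness (`eqOn_of_isMIntegralCurveOn`,
`IsLocalTransport.eq_of_isParallelAlong`) is needed to identify them with these smooth solutions;
`exists_transportChart` records the outcome. -/

noncomputable section

namespace SubmersionAddition

universe u

set_option linter.unusedSectionVars false

/-! ### Superposition operators on spaces of continuous maps -/

section Superposition

variable {K : Type*} [TopologicalSpace K] [CompactSpace K]
  {Z W : Type*} [NormedAddCommGroup Z] [NormedSpace ℝ Z] [NormedAddCommGroup W] [NormedSpace ℝ W]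

open Classical in
/-- The superposition operator `γ ↦ f ∘ γ` (with a junk value if `f ∘ γ` is not continuous). -/
def superposition (f : Z → W) (γ : C(K, Z)) : C(K, W) :=
  if h : Continuous (f ∘ γ) then ⟨f ∘ γ, h⟩ else 0

lemma superposition_apply {f : Z → W} {U : Set Z} (hf : ContinuousOn f U) {γ : C(K, Z)}
    (hγ : ∀ t, γ t ∈ U) (t : K) : superposition f γ t = f (γ t) := by
  have h : Continuous (f ∘ γ) := hf.comp_continuous γ.continuous hγ
  simp [superposition, h]

set_option synthInstance.maxHeartbeats 200000 in
/-- Pointwise application of a continuous family of operators to a continuous curve. -/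
def pointwiseApply (K : Type*) [TopologicalSpace K] [CompactSpace K]
    (Z W : Type*) [NormedAddCommGroup Z] [NormedSpace ℝ Z] [NormedAddCommGroup W]
    [NormedSpace ℝ W] : C(K, Z →L[ℝ] W) →L[ℝ] C(K, Z) →L[ℝ] C(K, W) :=
  LinearMap.mkContinuous₂
    (LinearMap.mk₂ ℝ (fun (A : C(K, Z →L[ℝ] W)) (δ : C(K, Z)) =>
        (⟨fun t => A t (δ t), A.continuous.clm_apply δ.continuous⟩ : C(K, W)))
      (fun _ _ _ => by ext; simp) (fun _ _ _ => by ext; simp) (fun _ _ _ => by ext; simp)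
      (fun _ _ _ => by ext; simp)) 1
    (fun A δ => by
      rw [one_mul, ContinuousMap.norm_le _ (by positivity)]
      intro t
      exact ((A t).le_opNorm _).trans (mul_le_mul (A.norm_coe_le_norm t) (δ.norm_coe_le_norm t)
        (norm_nonneg _) (norm_nonneg A)))

set_option synthInstance.maxHeartbeats 200000 in
@[simp] lemma pointwiseApply_apply (A : C(K, Z →L[ℝ] W)) (δ : C(K, Z)) (t : K) :
    pointwiseApply K Z W A δ t = A t (δ t) := rfl

set_option synthInstance.maxHeartbeats 200000 in
-- At each parameter the remainder is controlled by the mean value inequality and the oscillation of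
-- `fderiv ℝ f` near `γ t`. Compactness of `K` gives one radius that serves all `t`, so the estimate
-- holds in the sup norm.
lemma hasFDerivAt_superposition {f : Z → W} {U : Set Z} (hU : IsOpen U)
    (hf : ContDiffOn ℝ 1 f U) {γ : C(K, Z)} (hγ : ∀ t, γ t ∈ U) :
    HasFDerivAt (superposition f : C(K, Z) → C(K, W))
      (pointwiseApply K Z W (superposition (fderiv ℝ f) γ)) γ := by
  have hdf : ContinuousOn (fderiv ℝ f) U := hf.continuousOn_fderiv_of_isOpen hU le_rfl
  rw [hasFDerivAt_iff_isLittleO_nhds_zero, Asymptotics.isLittleO_iff]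
  intro c hc
  have key : ∀ᶠ z : Z in 𝓝 0, ∀ t ∈ (univ : Set K),
      γ t + z ∈ U ∧ ‖fderiv ℝ f (γ t + z) - fderiv ℝ f (γ t)‖ < c := by
    refine isCompact_univ.eventually_forall_of_forall_eventually fun t₀ _ => ?_
    have hc1 : ContinuousAt (fun q : Z × K => γ q.2 + q.1) (0, t₀) := by fun_prop
    have hU1 : U ∈ 𝓝 (γ t₀ + 0) := by simpa using hU.mem_nhds (hγ t₀)
    have hA : ContinuousAt (fderiv ℝ f) (γ t₀) := hdf.continuousAt (hU.mem_nhds (hγ t₀))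
    have hc2 : ContinuousAt (fun q : Z × K =>
        ‖fderiv ℝ f (γ q.2 + q.1) - fderiv ℝ f (γ q.2)‖) (0, t₀) := by
      refine ContinuousAt.norm (ContinuousAt.sub ?_ ?_)
      · exact ContinuousAt.comp (g := fderiv ℝ f) (f := fun q : Z × K => γ q.2 + q.1)
          (by simpa using hA) hc1
      · exact ContinuousAt.comp (g := fderiv ℝ f) (f := fun q : Z × K => γ q.2) hA (by fun_prop)
    have h1 := hc1.eventually_mem hU1
    have h2 := hc2.eventually (gt_mem_nhds (by simpa using hc : _ < c))
    filter_upwards [h1, h2] with q hq1 hq2 using ⟨hq1, hq2⟩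
  obtain ⟨r, hr, hball⟩ := Metric.eventually_nhds_iff.1 key
  filter_upwards [Metric.ball_mem_nhds (0 : C(K, Z)) hr] with δ hδ
  have hδr : ∀ t, ‖δ t‖ < r := fun t => (δ.norm_coe_le_norm t).trans_lt (by simpa using hδ)
  have hmem : ∀ t, ∀ z ∈ Metric.ball (γ t) r,
      z ∈ U ∧ ‖fderiv ℝ f z - fderiv ℝ f (γ t)‖ < c := by
    intro t z hz
    have := hball (y := z - γ t) (by simpa [dist_eq_norm] using hz) t (mem_univ t)
    simpa using this
  rw [ContinuousMap.norm_le _ (by positivity)]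
  intro t
  have hin : ∀ t, (γ + δ) t ∈ U := fun t =>
    (hmem t _ (by simpa using hδr t)).1
  rw [ContinuousMap.sub_apply, ContinuousMap.sub_apply, superposition_apply hf.continuousOn hin,
    superposition_apply hf.continuousOn hγ, pointwiseApply_apply, superposition_apply hdf hγ]
  have := (convex_ball (γ t) r).norm_image_sub_le_of_norm_hasFDerivWithin_le' (f := f)
    (f' := fderiv ℝ f) (φ := fderiv ℝ f (γ t)) (C := c)
    (fun z hz => (((hf.differentiableOn one_ne_zero).differentiableAt
      (hU.mem_nhds (hmem t z hz).1)).hasFDerivAt).hasFDerivWithinAt)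
    (fun z hz => (hmem t z hz).2.le) (Metric.mem_ball_self hr)
    (y := γ t + δ t) (by simpa using hδr t)
  refine (by simpa using this : _ ≤ c * ‖δ t‖).trans ?_
  gcongr
  exact δ.norm_coe_le_norm t

lemma isOpen_setOf_forall_mem {U : Set Z} (hU : IsOpen U) : IsOpen {γ : C(K, Z) | ∀ t, γ t ∈ U} := by
  simpa [MapsTo] using ContinuousMap.isOpen_setOfPred_mapsTo (X := K) (Y := Z) isCompact_univ hU

end Superposition

section SuperpositionSmooth

variable {K : Type*} [TopologicalSpace K] [CompactSpace K]
  {Z : Type u} [NormedAddCommGroup Z] [NormedSpace ℝ Z]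

set_option synthInstance.maxHeartbeats 200000 in
-- The derivative is again a superposition operator, for `fderiv ℝ f`, followed by a fixed
-- continuous linear map, so the order can be raised by induction. The target `W` varies inside the
-- induction because the step passes to `Z →L[ℝ] W`; having `Z` and `W` in one universe keeps this
-- space in range.
lemma contDiffOn_nat_superposition {U : Set Z} (hU : IsOpen U) (n : ℕ) :
    ∀ {W : Type u} [NormedAddCommGroup W] [NormedSpace ℝ W] {f : Z → W},
      ContDiffOn ℝ ∞ f U →
      ContDiffOn ℝ n (superposition f : C(K, Z) → C(K, W)) {γ | ∀ t, γ t ∈ U} := by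
  have hO := isOpen_setOf_forall_mem (K := K) hU
  have hder : ∀ {W : Type u} [NormedAddCommGroup W] [NormedSpace ℝ W] {f : Z → W},
      ContDiffOn ℝ ∞ f U → ∀ γ ∈ {γ : C(K, Z) | ∀ t, γ t ∈ U},
      HasFDerivAt (superposition f : C(K, Z) → C(K, W))
        (pointwiseApply K Z W (superposition (fderiv ℝ f) γ)) γ := fun hf γ hγ =>
    hasFDerivAt_superposition hU (hf.of_le (by norm_cast)) hγ
  induction n with
  | zero =>
    intro W _ _ f hf
    rw [Nat.cast_zero, contDiffOn_zero]
    exact fun γ hγ => (hder hf γ hγ).continuousAt.continuousWithinAt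
  | succ n ih =>
    intro W _ _ f hf
    rw [Nat.cast_succ, contDiffOn_succ_iff_fderiv_of_isOpen hO]
    refine ⟨fun γ hγ => (hder hf γ hγ).differentiableAt.differentiableWithinAt,
      fun h => by simp at h, ?_⟩
    have h1 := (pointwiseApply K Z W).contDiff.comp_contDiffOn
      (ih (hf.fderiv_of_isOpen hU (m := ∞) (by norm_cast)))
    exact h1.congr fun γ hγ => (hder hf γ hγ).fderiv

lemma contDiffOn_superposition {U : Set Z} (hU : IsOpen U)
    {W : Type u} [NormedAddCommGroup W] [NormedSpace ℝ W] {f : Z → W} (hf : ContDiffOn ℝ ∞ f U) :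
    ContDiffOn ℝ ∞ (superposition f : C(K, Z) → C(K, W)) {γ | ∀ t, γ t ∈ U} :=
  contDiffOn_infty.2 fun n => contDiffOn_nat_superposition hU n hf

end SuperpositionSmooth

/-! ### The primitive of a continuous curve -/

section Primitive

variable {Z : Type*} [NormedAddCommGroup Z] [NormedSpace ℝ Z] [CompleteSpace Z]

/-- The primitive vanishing at `0` of a continuous curve on the unit interval. -/
def primitive (Z : Type*) [NormedAddCommGroup Z] [NormedSpace ℝ Z] [CompleteSpace Z] :
    C(Icc (0 : ℝ) 1, Z) →L[ℝ] C(Icc (0 : ℝ) 1, Z) :=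
  LinearMap.mkContinuous
    { toFun := fun γ => ⟨fun t => ∫ s in (0 : ℝ)..t, IccExtend zero_le_one γ s,
        (intervalIntegral.continuous_primitive
          (fun _ _ => (γ.continuous.Icc_extend').intervalIntegrable _ _) 0).comp
          continuous_subtype_val⟩
      map_add' := fun γ δ => by
        ext t
        simp only [ContinuousMap.coe_mk, ContinuousMap.add_apply]
        rw [← intervalIntegral.integral_add (γ.continuous.Icc_extend'.intervalIntegrable _ _)
          (δ.continuous.Icc_extend'.intervalIntegrable _ _)]
        rfl
      map_smul' := fun c γ => by
        ext t
        simp only [ContinuousMap.coe_mk, ContinuousMap.smul_apply, RingHom.id_apply]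
        rw [← intervalIntegral.integral_smul]
        rfl } 1
    (fun γ => by
      rw [one_mul, ContinuousMap.norm_le _ (norm_nonneg _)]
      intro t
      refine (intervalIntegral.norm_integral_le_of_norm_le_const (C := ‖γ‖)
        (fun s _ => γ.norm_coe_le_norm _)).trans ?_
      have := t.2.1
      have := t.2.2
      rw [sub_zero, abs_of_nonneg t.2.1]
      nlinarith [norm_nonneg γ])

lemma hasDerivWithinAt_integral_IccExtend (γ : C(Icc (0 : ℝ) 1, Z)) {t : ℝ} (s : Set ℝ) :
    HasDerivWithinAt (fun t => ∫ s in (0 : ℝ)..t, IccExtend zero_le_one γ s)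
      (IccExtend zero_le_one γ t) s t :=
  (γ.continuous.Icc_extend'.integral_hasStrictDerivAt 0 t).hasDerivAt.hasDerivWithinAt

end Primitive

/-! ### Smooth dependence of solutions on the initial value -/

/-- The inverse function theorem for `C^∞` maps, with a smooth local right inverse. -/
lemma exists_contDiffOn_local_rightInverse {X Y : Type*} [NormedAddCommGroup X] [NormedSpace ℝ X]
    [CompleteSpace X] [NormedAddCommGroup Y] [NormedSpace ℝ Y] {Φ : X → Y}
    {S : Set X} (hS : IsOpen S) (hΦ : ContDiffOn ℝ ∞ Φ S) {a : X} (ha : a ∈ S)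
    {L : X ≃L[ℝ] Y} (hL : HasFDerivAt Φ (L : X →L[ℝ] Y) a) :
    ∃ V : Set Y, IsOpen V ∧ Φ a ∈ V ∧ ∃ g : Y → X, ContDiffOn ℝ ∞ g V ∧
      ∀ q ∈ V, g q ∈ S ∧ Φ (g q) = q := by
  have hΦa : ContDiffAt ℝ ∞ Φ a := hΦ.contDiffAt (hS.mem_nhds ha)
  set e := hΦa.toOpenPartialHomeomorph Φ hL (by simp) with he
  have hea : a ∈ e.source := hΦa.mem_toOpenPartialHomeomorph_source hL (by simp)
  have heΦ : (e : X → Y) = Φ := hΦa.toOpenPartialHomeomorph_coe hL (by simp)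
  have hdf : ContinuousOn (fderiv ℝ Φ) S :=
    hΦ.continuousOn_fderiv_of_isOpen hS (by norm_cast)
  -- Smoothness of the inverse at a point needs an invertible derivative at its preimage. Invertible
  -- operators form an open set, so cutting down to `T` secures this on a whole neighbourhood.
  set T : Set X := S ∩ fderiv ℝ Φ ⁻¹' range ((↑) : (X ≃L[ℝ] Y) → X →L[ℝ] Y) with hT
  have hTo : IsOpen T := hdf.isOpen_inter_preimage hS ContinuousLinearEquiv.isOpen
  have haT : a ∈ T := ⟨ha, L, hL.fderiv.symm⟩
  refine ⟨e.target ∩ e.symm ⁻¹' T, e.symm.isOpen_inter_preimage hTo, ⟨?_, ?_⟩, e.symm, ?_, ?_⟩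
  · rw [← heΦ]; exact e.map_source hea
  · rw [mem_preimage, ← heΦ, e.left_inv hea]; exact haT
  · rintro q ⟨hq, hqS, L', hL'⟩
    refine (e.contDiffAt_symm hq (f₀' := L') ?_ ?_).contDiffWithinAt
    · rw [heΦ, hL']
      exact ((hΦ.contDiffAt (hS.mem_nhds hqS)).differentiableAt (by simp)).hasFDerivAt
    · rw [heΦ]; exact hΦ.contDiffAt (hS.mem_nhds hqS)
  · rintro q ⟨hq, hqS, -⟩
    refine ⟨hqS, ?_⟩
    rw [← heΦ]; exact e.right_inv hq

/-- For small `ε`, the time-one flow of `ε • f` is defined and smooth near a given point. -/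
theorem exists_contDiffOn_flow {Z : Type u} [NormedAddCommGroup Z] [NormedSpace ℝ Z]
    [CompleteSpace Z] {U : Set Z} (hU : IsOpen U) {f : Z → Z} (hf : ContDiffOn ℝ ∞ f U)
    {z₀ : Z} (hz₀ : z₀ ∈ U) :
    ∃ ε : ℝ, 0 < ε ∧ ∃ D : Set Z, IsOpen D ∧ z₀ ∈ D ∧ ∃ Γ : Z → ℝ → Z,
      (∀ z ∈ D, Γ z 0 = z ∧ ∀ t ∈ Icc (0 : ℝ) 1, Γ z t ∈ U ∧
        HasDerivWithinAt (Γ z) (ε • f (Γ z t)) (Icc (0 : ℝ) 1) t) ∧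
      ContDiffOn ℝ ∞ (fun z => Γ z 1) D := by
  let C := C(Icc (0 : ℝ) 1, Z)
  let cst : Z →L[ℝ] C := ContinuousLinearMap.const ℝ (Icc (0 : ℝ) 1)
  have hcst : ∀ z t, cst z t = z := fun z t => rfl
  set S : Set (C × (Z × ℝ)) := {γ : C | ∀ t, γ t ∈ U} ×ˢ univ with hSdef
  have hS : IsOpen S := (isOpen_setOf_forall_mem hU).prod isOpen_univ
  -- Picard's equation `γ = z + ε ∫ f ∘ γ` is `Φ (γ, z, ε) = (0, z, ε)`. Carrying `(z, ε)` along
  -- makes a local inverse of `Φ` a solution operator depending smoothly on the initial value. At `ε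
  -- = 0` the constant curve solves it.
  let Φ : C × (Z × ℝ) → C × (Z × ℝ) := fun q =>
    (q.1 - cst q.2.1 - q.2.2 • primitive Z (superposition f q.1), q.2)
  have hsup : ContDiffOn ℝ ∞ (fun q : C × (Z × ℝ) => primitive Z (superposition f q.1)) S :=
    (primitive Z).contDiff.comp_contDiffOn
      ((contDiffOn_superposition hU hf).comp contDiff_fst.contDiffOn fun q hq => hq.1)
  have hΦ : ContDiffOn ℝ ∞ Φ S := by
    refine ContDiffOn.prodMk (ContDiffOn.sub (ContDiffOn.sub contDiff_fst.contDiffOn ?_)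
      (ContDiffOn.fun_smul ?_ hsup)) contDiff_snd.contDiffOn
    · exact (cst.contDiff.comp (contDiff_fst.comp contDiff_snd)).contDiffOn
    · exact (contDiff_snd.comp contDiff_snd).contDiffOn
  let a : C × (Z × ℝ) := (cst z₀, z₀, 0)
  have ha : a ∈ S := ⟨fun t => hz₀, mem_univ _⟩
  let b : C := primitive Z (superposition f (cst z₀))
  -- The derivative of `Φ` at the constant curve is `1 - N` with `N ∘ N = 0`, so `1 + N` inverts it.
  let N : C × (Z × ℝ) →L[ℝ] C × (Z × ℝ) :=
    (ContinuousLinearMap.inl ℝ C (Z × ℝ)).comp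
      ((cst.comp (ContinuousLinearMap.fst ℝ Z ℝ) +
        (ContinuousLinearMap.snd ℝ Z ℝ).smulRight b).comp (ContinuousLinearMap.snd ℝ C (Z × ℝ)))
  have hN : ∀ q, N q = (cst q.2.1 + q.2.2 • b, 0) := fun q => rfl
  let L : (C × (Z × ℝ)) ≃L[ℝ] (C × (Z × ℝ)) :=
    ContinuousLinearEquiv.equivOfInverse (ContinuousLinearMap.id ℝ _ - N)
      (ContinuousLinearMap.id ℝ _ + N)
      (fun q => by ext <;> simp [hN]) (fun q => by ext <;> simp [hN])
  have hL : HasFDerivAt Φ (L : (C × (Z × ℝ)) →L[ℝ] (C × (Z × ℝ))) a := by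
    have h0 : HasFDerivAt (fun q : C × (Z × ℝ) => primitive Z (superposition f q.1))
        (fderiv ℝ (fun q : C × (Z × ℝ) => primitive Z (superposition f q.1)) a) a :=
      ((hsup.contDiffAt (hS.mem_nhds ha)).differentiableAt (by simp)).hasFDerivAt
    have h1 : HasFDerivAt (fun q : C × (Z × ℝ) => q.2.2)
        ((ContinuousLinearMap.snd ℝ Z ℝ).comp (ContinuousLinearMap.snd ℝ C (Z × ℝ))) a :=
      ((ContinuousLinearMap.snd ℝ Z ℝ).comp (ContinuousLinearMap.snd ℝ C (Z × ℝ))).hasFDerivAt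
    have h2 : HasFDerivAt (fun q : C × (Z × ℝ) => cst q.2.1) (cst.comp
        ((ContinuousLinearMap.fst ℝ Z ℝ).comp (ContinuousLinearMap.snd ℝ C (Z × ℝ)))) a :=
      (cst.comp
        ((ContinuousLinearMap.fst ℝ Z ℝ).comp (ContinuousLinearMap.snd ℝ C (Z × ℝ)))).hasFDerivAt
    have h3 := ((hasFDerivAt_fst (p := a) (𝕜 := ℝ)).sub h2).sub (h1.smul h0)
    refine (h3.prodMk hasFDerivAt_snd).congr_fderiv ?_
    refine ContinuousLinearMap.ext fun q => ?_
    refine Prod.ext ?_ ?_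
    · change q.1 - cst q.2.1 - (a.2.2 • _ + q.2.2 • b) = q.1 - (cst q.2.1 + q.2.2 • b)
      rw [show a.2.2 = (0 : ℝ) from rfl, zero_smul, zero_add, sub_sub]
    · change q.2 = q.2 - 0
      rw [sub_zero]
  obtain ⟨V, hVo, haV, g, hg, hgV⟩ := exists_contDiffOn_local_rightInverse hS hΦ ha hL
  have hΦa : Φ a = (0, z₀, 0) := by
    refine Prod.ext ?_ rfl
    change cst z₀ - cst z₀ - (0 : ℝ) • _ = 0
    simp
  rw [hΦa] at haV
  -- One positive `ε` is frozen here; the initial values are then those of the slice of `V` at this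
  -- `ε`.
  have hev : ∀ᶠ ε : ℝ in 𝓝[>] 0, ((0 : C), z₀, ε) ∈ V :=
    ((by fun_prop : Continuous fun ε : ℝ => ((0 : C), z₀, ε)).continuousAt.eventually_mem
      (hVo.mem_nhds haV)).filter_mono nhdsWithin_le_nhds
  obtain ⟨ε, hεV, hε⟩ := (hev.and self_mem_nhdsWithin).exists
  have hj : ContDiff ℝ ∞ fun z : Z => ((0 : C), z, ε) :=
    contDiff_const.prodMk (contDiff_id.prodMk contDiff_const)
  let D : Set Z := (fun z => ((0 : C), z, ε)) ⁻¹' V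
  let γ : Z → C := fun z => (g (0, z, ε)).1
  have hfix : ∀ z ∈ D, (∀ t, γ z t ∈ U) ∧
      γ z = cst z + ε • primitive Z (superposition f (γ z)) := by
    intro z hz
    obtain ⟨h1, h2⟩ := hgV _ hz
    refine ⟨h1.1, ?_⟩
    have h3 : (g (0, z, ε)).2 = (z, ε) := congrArg Prod.snd h2
    have h4 : (g (0, z, ε)).1 - cst (g (0, z, ε)).2.1 -
      (g (0, z, ε)).2.2 • primitive Z (superposition f (g (0, z, ε)).1) = 0 := congrArg Prod.fst h2
    rw [h3] at h4
    rw [sub_sub, sub_eq_zero] at h4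
    exact h4
  refine ⟨ε, hε, D, hVo.preimage hj.continuous, hεV,
    fun z => IccExtend zero_le_one (γ z), ?_, ?_⟩
  · intro z hz
    obtain ⟨h1, h2⟩ := hfix z hz
    have hval : ∀ t ∈ Icc (0 : ℝ) 1, IccExtend zero_le_one (γ z) t =
        z + ε • ∫ s in (0 : ℝ)..t, IccExtend zero_le_one (superposition f (γ z)) s := by
      intro t ht
      rw [IccExtend_of_mem _ _ ht, h2]
      change cst z _ + ε • primitive Z (superposition f (γ z)) _ = _
      rw [← h2]
      rfl
    refine ⟨?_, fun t ht => ⟨?_, ?_⟩⟩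
    · exact (hval 0 (by simp)).trans (by simp)
    · beta_reduce
      rw [IccExtend_of_mem _ _ ht]; exact h1 _
    · have h5 := ((hasDerivWithinAt_integral_IccExtend (superposition f (γ z)) (t := t)
        (Icc (0 : ℝ) 1)).const_smul ε).const_add z
      rw [IccExtend_of_mem _ _ ht, superposition_apply hf.continuousOn h1] at h5
      beta_reduce
      rw [IccExtend_of_mem _ _ ht]
      exact h5.congr (fun s hs => hval s hs) (hval t ht)
  · have h6 : ContDiffOn ℝ ∞ γ D :=
      contDiff_fst.comp_contDiffOn (hg.comp hj.contDiffOn fun z hz => hz)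
    have h7 := (ContinuousMap.evalCLM ℝ (⟨1, by simp⟩ : Icc (0 : ℝ) 1)).contDiff
      (n := ∞) (E := C) |>.comp_contDiffOn h6
    refine h7.congr fun z _ => ?_
    exact IccExtend_of_mem _ _ (by simp : (1 : ℝ) ∈ Icc (0 : ℝ) 1)

/-! ### Local uniqueness for autonomous equations -/

/-- A `C^1` field is locally Lipschitz, so Grönwall's inequality applies on a short interval. Only
right neighbourhoods occur, as needed to propagate agreement from left to right along `[0, 1]`. -/
lemma eventuallyEq_of_hasDerivWithinAt {Z : Type*} [NormedAddCommGroup Z] [NormedSpace ℝ Z]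
    {g : Z → Z} {z₀ z₁ : ℝ → Z} {t : ℝ} (hg : ContDiffAt ℝ 1 g (z₀ t))
    (h₀ : ∀ᶠ s in 𝓝[≥] t, HasDerivWithinAt z₀ (g (z₀ s)) (Ici s) s)
    (h₁ : ∀ᶠ s in 𝓝[≥] t, HasDerivWithinAt z₁ (g (z₁ s)) (Ici s) s)
    (hc₀ : ∀ᶠ s in 𝓝[≥] t, ContinuousWithinAt z₀ (Ici t) s)
    (hc₁ : ∀ᶠ s in 𝓝[≥] t, ContinuousWithinAt z₁ (Ici t) s)
    (heq : z₀ t = z₁ t) : ∀ᶠ s in 𝓝[≥] t, z₀ s = z₁ s := by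
  obtain ⟨K, V, hV, hlip⟩ := hg.exists_lipschitzOnWith
  have ht : t ∈ Ici t := mem_Ici.2 le_rfl
  have hV₀ : ∀ᶠ s in 𝓝[≥] t, z₀ s ∈ V := (hc₀.self_of_nhdsWithin ht).eventually_mem hV
  have hV₁ : ∀ᶠ s in 𝓝[≥] t, z₁ s ∈ V :=
    (hc₁.self_of_nhdsWithin ht).eventually_mem (heq ▸ hV)
  obtain ⟨b, hb, hsub⟩ := mem_nhdsGE_iff_exists_Icc_subset.1
    ((h₀.and h₁).and ((hc₀.and hc₁).and (hV₀.and hV₁)))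
  have key : EqOn z₀ z₁ (Icc t b) :=
    ODE_solution_unique_of_mem_Icc_right (v := fun _ => g) (s := fun _ => V) (K := K)
      (fun s _ => hlip)
      (fun s hs => (hsub hs).2.1.1.mono Icc_subset_Ici_self)
      (fun s hs => (hsub (Ico_subset_Icc_self hs)).1.1)
      (fun s hs => (hsub (Ico_subset_Icc_self hs)).2.2.1)
      (fun s hs => (hsub hs).2.1.2.mono Icc_subset_Ici_self)
      (fun s hs => (hsub (Ico_subset_Icc_self hs)).1.2)
      (fun s hs => (hsub (Ico_subset_Icc_self hs)).2.2.2) heq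
  filter_upwards [Icc_mem_nhdsGE hb] with s hs using key hs

/-! ### Velocities of curves -/

section Velocity

variable {Z : Type*} [NormedAddCommGroup Z] [NormedSpace ℝ Z]
  {E₁ H₁ : Type*} [NormedAddCommGroup E₁] [NormedSpace ℝ E₁] [TopologicalSpace H₁]
  {I₁ : ModelWithCorners ℝ E₁ H₁} {X : Type*} [TopologicalSpace X] [ChartedSpace H₁ X]
  {E₂ H₂ : Type*} [NormedAddCommGroup E₂] [NormedSpace ℝ E₂] [TopologicalSpace H₂]
  {I₂ : ModelWithCorners ℝ E₂ H₂} {Y : Type*} [TopologicalSpace Y] [ChartedSpace H₂ Y]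

lemma hasMFDerivWithinAt_smulRight_iff {z : ℝ → Z} {z' : Z} {s : Set ℝ} {t : ℝ} :
    HasMFDerivWithinAt 𝓘(ℝ, ℝ) 𝓘(ℝ, Z) z s t ((1 : ℝ →L[ℝ] ℝ).smulRight z') ↔
      HasDerivWithinAt z z' s t := by
  have h : (1 : ℝ →L[ℝ] ℝ).smulRight z' = ContinuousLinearMap.toSpanSingleton ℝ z' :=
    ContinuousLinearMap.ext fun a => by simp
  exact hasMFDerivWithinAt_iff_hasFDerivWithinAt.trans
    ((iff_of_eq (congrArg (fun L : ℝ →L[ℝ] Z => HasFDerivWithinAt z L s t) h)).trans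
      hasDerivWithinAt_iff_hasFDerivWithinAt.symm)

lemma hasMFDerivWithinAt_comp_velocity {γ : ℝ → X} {s : Set ℝ} {t : ℝ}
    {v : TangentSpace I₁ (γ t)}
    (hγ : HasMFDerivWithinAt 𝓘(ℝ, ℝ) I₁ γ s t ((1 : ℝ →L[ℝ] ℝ).smulRight v)) {f : X → Y}
    {f' : TangentSpace I₁ (γ t) →L[ℝ] TangentSpace I₂ (f (γ t))}
    (hf : HasMFDerivAt I₁ I₂ f (γ t) f') :
    HasMFDerivWithinAt 𝓘(ℝ, ℝ) I₂ (f ∘ γ) s t ((1 : ℝ →L[ℝ] ℝ).smulRight (f' v)) := by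
  refine (hf.comp_hasMFDerivWithinAt t hγ).congr_mfderiv ?_
  exact ContinuousLinearMap.ext fun (a : ℝ) => map_smul f' a v

end Velocity

/-! ### Charts of split submanifolds -/

section SubmanifoldChart

variable {E₁ H₁ : Type*} [NormedAddCommGroup E₁] [NormedSpace ℝ E₁] [TopologicalSpace H₁]
  {X : Type*} [TopologicalSpace X] [ChartedSpace H₁ X]
  {Z : Type*} [NormedAddCommGroup Z] [NormedSpace ℝ Z]

/-- A smooth local parametrisation `invFun` of the subset `W` of the manifold `X` by an open subset
of `Z`, together with a smooth extension `toFun` of its inverse to an open subset of `X`. -/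
structure SubmanifoldChart (I₁ : ModelWithCorners ℝ E₁ H₁) {X : Type*} [TopologicalSpace X]
    [ChartedSpace H₁ X] (W : Set X) (Z : Type*) [NormedAddCommGroup Z] [NormedSpace ℝ Z] where
  toFun : X → Z
  invFun : Z → X
  source : Set X
  target : Set Z
  isOpen_source : IsOpen source
  isOpen_target : IsOpen target
  contMDiffOn_toFun : ContMDiffOn I₁ 𝓘(ℝ, Z) ∞ toFun source
  contMDiffOn_invFun : ContMDiffOn 𝓘(ℝ, Z) I₁ ∞ invFun target
  map_source : ∀ w ∈ W, w ∈ source → toFun w ∈ target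
  map_target : ∀ z ∈ target, invFun z ∈ W ∧ invFun z ∈ source
  left_inv : ∀ w ∈ W, w ∈ source → invFun (toFun w) = w
  right_inv : ∀ z ∈ target, toFun (invFun z) = z

namespace SubmanifoldChart

variable {I₁ : ModelWithCorners ℝ E₁ H₁} {W : Set X} (χ : SubmanifoldChart I₁ W Z)

lemma mdifferentiableAt_toFun {w : X} (hw : w ∈ χ.source) :
    MDifferentiableAt I₁ 𝓘(ℝ, Z) χ.toFun w :=
  (χ.contMDiffOn_toFun.contMDiffAt (χ.isOpen_source.mem_nhds hw)).mdifferentiableAt (by simp)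

lemma mdifferentiableAt_invFun {z : Z} (hz : z ∈ χ.target) :
    MDifferentiableAt 𝓘(ℝ, Z) I₁ χ.invFun z :=
  (χ.contMDiffOn_invFun.contMDiffAt (χ.isOpen_target.mem_nhds hz)).mdifferentiableAt (by simp)

/-- The chart of the full manifold given by an extended chart. -/
def ofExtChartAt (I₁ : ModelWithCorners ℝ E₁ H₁) [I₁.Boundaryless] [IsManifold I₁ ∞ X] (x : X)
    (W : Set X) (hW : W = univ) : SubmanifoldChart I₁ W E₁ where
  toFun := extChartAt I₁ x
  invFun := (extChartAt I₁ x).symm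
  source := (extChartAt I₁ x).source
  target := (extChartAt I₁ x).target
  isOpen_source := isOpen_extChartAt_source x
  isOpen_target := isOpen_extChartAt_target x
  contMDiffOn_toFun := by
    rw [extChartAt_source]; exact contMDiffOn_extChartAt
  contMDiffOn_invFun := contMDiffOn_extChartAt_symm x
  map_source := fun w _ hw => (extChartAt I₁ x).map_source hw
  map_target := fun z hz => ⟨hW ▸ mem_univ _, (extChartAt I₁ x).map_target hz⟩
  left_inv := fun w _ hw => (extChartAt I₁ x).left_inv hw
  right_inv := fun z hz => (extChartAt I₁ x).right_inv hz

/-- The local representative of a vector field. -/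
def localField (S : ∀ x : X, TangentSpace I₁ x) (z : Z) : Z :=
  mfderiv I₁ 𝓘(ℝ, Z) χ.toFun (χ.invFun z) (S (χ.invFun z))

lemma localField_toFun (S : ∀ x : X, TangentSpace I₁ x) {w : X} (hw : w ∈ W)
    (hws : w ∈ χ.source) :
    χ.localField S (χ.toFun w) = mfderiv I₁ 𝓘(ℝ, Z) χ.toFun w (S w) :=
  congrArg (fun x => (mfderiv I₁ 𝓘(ℝ, Z) χ.toFun x (S x) : Z)) (χ.left_inv w hw hws)

/-- `S` is smooth only along `W`, but `toFun` is smooth on an open subset of `X` and has an honest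
tangent map there. Composing that map with `S ∘ invFun` gives the local field. -/
lemma contDiffOn_localField [IsManifold I₁ ∞ X] {S : ∀ x : X, TangentSpace I₁ x}
    (hS : ContMDiffOn I₁ I₁.tangent ∞ (fun v => (⟨v, S v⟩ : TangentBundle I₁ X)) W) :
    ContDiffOn ℝ ∞ (χ.localField S) χ.target := by
  have : IsManifold I₁ 1 X := .of_le (n := ∞) (by norm_cast)
  have h1 := χ.contMDiffOn_toFun.contMDiffOn_tangentMapWithin (m := ∞) (by simp)
    χ.isOpen_source.uniqueMDiffOn
  have h2 : ContMDiffOn 𝓘(ℝ, Z) I₁.tangent ∞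
      (fun z => (⟨χ.invFun z, S (χ.invFun z)⟩ : TangentBundle I₁ X)) χ.target :=
    hS.comp χ.contMDiffOn_invFun fun z hz => (χ.map_target z hz).1
  have h3 := h1.comp h2 fun z hz => (χ.map_target z hz).2
  have h4 := (contMDiff_snd_tangentBundle_modelSpace (I := 𝓘(ℝ, Z)) (n := ∞)).comp_contMDiffOn h3
  rw [← contMDiffOn_iff_contDiffOn]
  refine h4.congr fun z hz => ?_
  simp only [Function.comp, tangentMapWithin, localField]
  rw [mfderivWithin_of_isOpen χ.isOpen_source (χ.map_target z hz).2]

/-- A vector tangent to `W` is the velocity of a curve in `W`, and along that curve `invFun ∘ toFun`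
is the identity. For vectors transverse to `W` the identity would fail, since `toFun` is a mere
extension off `W`. -/
lemma mfderiv_invFun_mfderiv_toFun [IsManifold I₁ 1 X] {w : X} (s : TangentSpace I₁ w)
    (hs : (⟨w, s⟩ : TangentBundle I₁ X) ∈ tangentSet I₁ W) (hw : w ∈ χ.source) {z : Z}
    (hz : z ∈ χ.target) (hwz : χ.toFun w = z) :
    mfderiv 𝓘(ℝ, Z) I₁ χ.invFun z (mfderiv I₁ 𝓘(ℝ, Z) χ.toFun w s) = s := by
  obtain ⟨γ, hγW, hγd, hγ⟩ := hs
  cases hγ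
  subst hwz
  have h1 := χ.mdifferentiableAt_toFun hw
  have h2 := χ.mdifferentiableAt_invFun hz
  have hev : (χ.invFun ∘ (χ.toFun ∘ γ)) =ᶠ[𝓝 0] γ := by
    filter_upwards [hγW, hγd.continuousAt.eventually_mem (χ.isOpen_source.mem_nhds hw)]
      with t ht ht'
    exact χ.left_inv _ ht ht'
  have h3 := hev.mfderiv_eq (I := 𝓘(ℝ, ℝ)) (I' := I₁)
  have h4 := mfderiv_comp (I := 𝓘(ℝ, ℝ)) (I' := 𝓘(ℝ, Z)) (I'' := I₁) (g := χ.invFun)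
    (f := χ.toFun ∘ γ) (0 : ℝ) h2 (h1.comp (0 : ℝ) hγd)
  have h5 := mfderiv_comp (I := 𝓘(ℝ, ℝ)) (I' := I₁) (I'' := 𝓘(ℝ, Z)) (g := χ.toFun)
    (f := γ) (0 : ℝ) h1 hγd
  rw [h5] at h4
  have h6 := congrArg (fun L : ℝ →L[ℝ] E₁ => L 1) (h4.symm.trans h3)
  exact h6

lemma mfderiv_invFun_localField [IsManifold I₁ 1 X] {S : ∀ x : X, TangentSpace I₁ x}
    (hS : ∀ w ∈ W, (⟨w, S w⟩ : TangentBundle I₁ X) ∈ tangentSet I₁ W) {z : Z}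
    (hz : z ∈ χ.target) :
    mfderiv 𝓘(ℝ, Z) I₁ χ.invFun z (χ.localField S z) = S (χ.invFun z) :=
  χ.mfderiv_invFun_mfderiv_toFun _ (hS _ (χ.map_target z hz).1) (χ.map_target z hz).2 hz
    (χ.right_inv z hz)

lemma hasDerivWithinAt_toFun_comp {S : ∀ x : X, TangentSpace I₁ x} {γ : ℝ → X} {s : Set ℝ}
    {t : ℝ} (hγ : HasMFDerivWithinAt 𝓘(ℝ, ℝ) I₁ γ s t
      ((1 : ℝ →L[ℝ] ℝ).smulRight (S (γ t)))) (hW : γ t ∈ W) (ht : γ t ∈ χ.source) :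
    HasDerivWithinAt (χ.toFun ∘ γ) (χ.localField S (χ.toFun (γ t))) s t := by
  rw [χ.localField_toFun S hW ht]
  exact hasMFDerivWithinAt_smulRight_iff.1 (hasMFDerivWithinAt_comp_velocity hγ
    (χ.mdifferentiableAt_toFun ht).hasMFDerivAt)

lemma hasMFDerivWithinAt_invFun_comp [IsManifold I₁ 1 X] {S : ∀ x : X, TangentSpace I₁ x}
    (hS : ∀ w ∈ W, (⟨w, S w⟩ : TangentBundle I₁ X) ∈ tangentSet I₁ W) {z : ℝ → Z} {s : Set ℝ}
    {t c : ℝ} (hz : HasDerivWithinAt z (c • χ.localField S (z t)) s t) (ht : z t ∈ χ.target) :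
    HasMFDerivWithinAt 𝓘(ℝ, ℝ) I₁ (χ.invFun ∘ z) s t
      ((1 : ℝ →L[ℝ] ℝ).smulRight (c • S (χ.invFun (z t)))) := by
  have h := hasMFDerivWithinAt_comp_velocity (hasMFDerivWithinAt_smulRight_iff.2 hz)
    (χ.mdifferentiableAt_invFun ht).hasMFDerivAt
  refine h.congr_mfderiv ?_
  rw [← χ.mfderiv_invFun_localField hS ht]
  exact congrArg (ContinuousLinearMap.smulRight (1 : ℝ →L[ℝ] ℝ)) (map_smul _ _ _)

end SubmanifoldChart

/-- Integral curves of a smooth vector field on a split submanifold are unique. -/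
lemma eqOn_of_isMIntegralCurveOn [T2Space X] {I₁ : ModelWithCorners ℝ E₁ H₁} [IsManifold I₁ ∞ X]
    {W : Set X}
    (hW : ∀ w ∈ W, ∃ (Z : Type u) (_ : NormedAddCommGroup Z) (_ : NormedSpace ℝ Z)
      (χ : SubmanifoldChart I₁ W Z), w ∈ χ.source)
    {S : ∀ x : X, TangentSpace I₁ x}
    (hS : ContMDiffOn I₁ I₁.tangent ∞ (fun v => (⟨v, S v⟩ : TangentBundle I₁ X)) W)
    {γ₀ γ₁ : ℝ → X} (h₀ : IsMIntegralCurveOn γ₀ S (Icc (0 : ℝ) 1))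
    (h₁ : IsMIntegralCurveOn γ₁ S (Icc (0 : ℝ) 1))
    (hW₀ : ∀ t ∈ Icc (0 : ℝ) 1, γ₀ t ∈ W) (hW₁ : ∀ t ∈ Icc (0 : ℝ) 1, γ₁ t ∈ W)
    (heq : γ₀ 0 = γ₁ 0) : EqOn γ₀ γ₁ (Icc (0 : ℝ) 1) := by
  have hcl : IsClosed ({t | γ₀ t = γ₁ t} ∩ Icc (0 : ℝ) 1) := by
    rw [inter_comm]
    exact (h₀.continuousOn.prodMk h₁.continuousOn).preimage_isClosed_of_isClosed isClosed_Icc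
      isClosed_diagonal
  -- Continuous induction: the set of agreement is closed because `X` is Hausdorff, so it remains to
  -- extend agreement a little to the right of each of its points, which local uniqueness in a
  -- submanifold chart provides.
  refine hcl.Icc_subset_of_forall_mem_nhdsWithin heq ?_
  rintro t ⟨ht, ht01⟩
  replace ht : γ₀ t = γ₁ t := ht
  have htI : t ∈ Icc (0 : ℝ) 1 := Ico_subset_Icc_self ht01
  obtain ⟨Z, _, _, χ, hχ⟩ := hW _ (hW₀ t htI)
  have hIco : Icc (0 : ℝ) 1 ∈ 𝓝[≥] t := Icc_mem_nhdsGE_of_mem ht01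
  have hle : 𝓝[≥] t ≤ 𝓝[Icc (0 : ℝ) 1] t := nhdsWithin_le_of_mem hIco
  have hIco' : Ico (0 : ℝ) 1 ∈ 𝓝[≥] t := Ico_mem_nhdsGE_of_mem ht01
  have hsrc : ∀ γ : ℝ → X, IsMIntegralCurveOn γ S (Icc (0 : ℝ) 1) → γ t ∈ χ.source →
      ∀ᶠ s in 𝓝[≥] t, γ s ∈ χ.source := fun γ hγ hγt =>
    ((hγ.continuousWithinAt htI).eventually_mem (χ.isOpen_source.mem_nhds hγt)).filter_mono hle
  have hder : ∀ γ : ℝ → X, IsMIntegralCurveOn γ S (Icc (0 : ℝ) 1) →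
      (∀ t ∈ Icc (0 : ℝ) 1, γ t ∈ W) → γ t ∈ χ.source → ∀ᶠ s in 𝓝[≥] t,
      HasDerivWithinAt (χ.toFun ∘ γ) (χ.localField S (χ.toFun (γ s))) (Icc (0 : ℝ) 1) s ∧
        s ∈ Ico (0 : ℝ) 1 ∧ t ≤ s := by
    intro γ hγ hγW hγt
    filter_upwards [hsrc γ hγ hγt, hIco', self_mem_nhdsWithin] with s hs hs1 hs2
    have hsI := Ico_subset_Icc_self hs1
    exact ⟨χ.hasDerivWithinAt_toFun_comp (hγ s hsI) (hγW s hsI) hs, hs1, hs2⟩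
  have hder' : ∀ γ : ℝ → X, IsMIntegralCurveOn γ S (Icc (0 : ℝ) 1) →
      (∀ t ∈ Icc (0 : ℝ) 1, γ t ∈ W) → γ t ∈ χ.source →
      (∀ᶠ s in 𝓝[≥] t,
        HasDerivWithinAt (χ.toFun ∘ γ) (χ.localField S ((χ.toFun ∘ γ) s)) (Ici s) s) ∧
      ∀ᶠ s in 𝓝[≥] t, ContinuousWithinAt (χ.toFun ∘ γ) (Ici t) s := by
    intro γ hγ hγW hγt
    refine ⟨?_, ?_⟩
    · filter_upwards [hder γ hγ hγW hγt] with s hs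
      exact hs.1.mono_of_mem_nhdsWithin (Icc_mem_nhdsGE_of_mem hs.2.1)
    · filter_upwards [hder γ hγ hγW hγt] with s hs
      refine hs.1.continuousWithinAt.mono_of_mem_nhdsWithin ?_
      refine mem_of_superset (inter_mem self_mem_nhdsWithin
        (mem_nhdsWithin_of_mem_nhds (Iio_mem_nhds hs.2.1.2))) ?_
      rintro r ⟨hr1, hr2⟩
      exact ⟨ht01.1.trans hr1, hr2.le⟩
  obtain ⟨a₀, b₀⟩ := hder' γ₀ h₀ hW₀ hχ
  obtain ⟨a₁, b₁⟩ := hder' γ₁ h₁ hW₁ (ht ▸ hχ)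
  have hg : ContDiffAt ℝ 1 (χ.localField S) ((χ.toFun ∘ γ₀) t) :=
    ((χ.contDiffOn_localField hS).contDiffAt (χ.isOpen_target.mem_nhds
      (χ.map_source _ (hW₀ t htI) hχ))).of_le (by norm_cast)
  have hfin := eventuallyEq_of_hasDerivWithinAt hg a₀ a₁ b₀ b₁ (congrArg χ.toFun ht)
  have : ∀ᶠ s in 𝓝[≥] t, γ₀ s = γ₁ s := by
    filter_upwards [hfin, hsrc γ₀ h₀ hχ, hsrc γ₁ h₁ (ht ▸ hχ), hIco] with s hs e₀ e₁ hsI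
    rw [← χ.left_inv _ (hW₀ s hsI) e₀, ← χ.left_inv _ (hW₁ s hsI) e₁]
    exact congrArg χ.invFun hs
  exact this.filter_mono (nhdsWithin_mono t Ioi_subset_Ici_self)

end SubmanifoldChart

/-! ### Flow lines of sprays -/

section Bundles

variable {E : Type u} [NormedAddCommGroup E] [NormedSpace ℝ E]
  {M : Type*} [TopologicalSpace M] [ChartedSpace E M] [IsManifold 𝓘(ℝ, E) ∞ M]

/-- Vectors over distinct points are separated by the base, vectors in one fibre by a
trivialisation. -/
lemma t2Space_tangentBundle [T2Space M] : T2Space (TangentBundle 𝓘(ℝ, E) M) := by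
  refine ⟨fun v w hvw => ?_⟩
  by_cases h : v.proj = w.proj
  · let e := trivializationAt E (TangentSpace 𝓘(ℝ, E) : M → Type _) v.proj
    have hv : v ∈ e.source := by
      rw [e.mem_source]; exact mem_baseSet_trivializationAt _ _ _
    have hw : w ∈ e.source := by
      rw [e.mem_source, ← h]; exact mem_baseSet_trivializationAt _ _ _
    obtain ⟨A, B, hA, hB, hvA, hwB, hAB⟩ := t2_separation fun h' => hvw (e.injOn hv hw h')
    exact ⟨_, _, e.toOpenPartialHomeomorph.isOpen_inter_preimage hA,
      e.toOpenPartialHomeomorph.isOpen_inter_preimage hB, ⟨hv, hvA⟩, ⟨hw, hwB⟩,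
      (hAB.preimage e).mono inter_subset_right inter_subset_right⟩
  · exact separated_by_continuous (FiberBundle.continuous_proj E _) h

lemma trivializationAt_fibreScale (c : ℝ) (x₀ : M) {v : TangentBundle 𝓘(ℝ, E) M}
    (hv : v.proj ∈ (chartAt E x₀).source) :
    (trivializationAt E (TangentSpace 𝓘(ℝ, E)) x₀ (fibreScale c v)).2 =
      c • (trivializationAt E (TangentSpace 𝓘(ℝ, E)) x₀ v).2 :=
  ((trivializationAt E (TangentSpace 𝓘(ℝ, E)) x₀).linear ℝ
    (b := v.proj) hv).map_smul c v.2

lemma contMDiff_fibreScale (c : ℝ) : ContMDiff 𝓘(ℝ, E).tangent 𝓘(ℝ, E).tangent ∞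
    (fibreScale c : TangentBundle 𝓘(ℝ, E) M → TangentBundle 𝓘(ℝ, E) M) := by
  intro v₀
  have hid := contMDiffAt_totalSpace.1
    (contMDiffAt_id : ContMDiffAt 𝓘(ℝ, E).tangent 𝓘(ℝ, E).tangent ∞ id v₀)
  refine contMDiffAt_totalSpace.2 ⟨hid.1, ?_⟩
  have h1 : ContMDiffAt 𝓘(ℝ, E).tangent 𝓘(ℝ, E) ∞ (fun v : TangentBundle 𝓘(ℝ, E) M =>
      c • (trivializationAt E (TangentSpace 𝓘(ℝ, E)) v₀.proj v).2) v₀ :=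
    ((c • ContinuousLinearMap.id ℝ E).contDiff.contMDiff.contMDiffAt).comp v₀ hid.2
  refine h1.congr_of_eventuallyEq ?_
  filter_upwards [(FiberBundle.continuous_proj E (TangentSpace 𝓘(ℝ, E))).continuousAt.eventually_mem
    ((chartAt E v₀.proj).open_source.mem_nhds (mem_chart_source E v₀.proj))] with v hv
  exact trivializationAt_fibreScale c v₀.proj hv

variable {W : ∀ x : M, Submodule ℝ (TangentSpace 𝓘(ℝ, E) x)}
  {S : ∀ v : TangentBundle 𝓘(ℝ, E) M, TangentSpace 𝓘(ℝ, E).tangent v}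

/-- A fibrewise multiple of an integral curve of `c • S` is an integral curve of the spray `S`. -/
lemma IsSpray.isFlowLine_fibreScale (hS : IsSpray W S) (c : ℝ)
    {γ : ℝ → TangentBundle 𝓘(ℝ, E) M} (hW : ∀ t ∈ Icc (0 : ℝ) 1, γ t ∈ totalSet W)
    (hγ : ∀ t ∈ Icc (0 : ℝ) 1, HasMFDerivWithinAt 𝓘(ℝ, ℝ) 𝓘(ℝ, E).tangent γ (Icc (0 : ℝ) 1) t
      ((1 : ℝ →L[ℝ] ℝ).smulRight (c • S (γ t)))) :
    IsFlowLine W S (fibreScale c ∘ γ) := by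
  refine ⟨fun t ht => (W _).smul_mem c (hW t ht), fun t ht => ?_⟩
  have hd := (((contMDiff_fibreScale c).contMDiffAt (x := γ t)).mdifferentiableAt
    (by simp)).hasMFDerivAt
  have h := hasMFDerivWithinAt_comp_velocity (hγ t ht) hd
  rwa [← hS.homogeneous c (γ t) (hW t ht)] at h

/-- Slowing time by `c` turns an integral curve of `S` into one of `c • S`, and fibrewise scaling by
`c` turns that back into one of `S`. The bound on `c` keeps the time inside `[0, 1]`. -/
lemma IsFlowLine.fibreScale_comp_mul (hS : IsSpray W S) {γ : ℝ → TangentBundle 𝓘(ℝ, E) M}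
    (hγ : IsFlowLine W S γ) {c : ℝ} (hc : c ∈ Icc (0 : ℝ) 1) :
    IsFlowLine W S (fun t => fibreScale c (γ (c * t))) := by
  have hmaps : ∀ t ∈ Icc (0 : ℝ) 1, c * t ∈ Icc (0 : ℝ) 1 := fun t ht =>
    ⟨mul_nonneg hc.1 ht.1, mul_le_one₀ hc.2 ht.1 ht.2⟩
  refine hS.isFlowLine_fibreScale c (γ := fun t => γ (c * t)) (fun t ht => hγ.1 _ (hmaps t ht))
    fun t ht => ?_
  have h1 : HasMFDerivWithinAt 𝓘(ℝ, ℝ) 𝓘(ℝ, ℝ) (fun t : ℝ => c * t) (Icc (0 : ℝ) 1) t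
      ((1 : ℝ →L[ℝ] ℝ).smulRight c) := by
    refine hasMFDerivWithinAt_smulRight_iff.2 ?_
    have := (hasDerivWithinAt_id t (Icc (0 : ℝ) 1)).const_mul c
    rwa [mul_one] at this
  refine ((hγ.2 _ (hmaps t ht)).comp t h1 hmaps).congr_mfderiv ?_
  refine ContinuousLinearMap.ext fun (a : ℝ) => ?_
  exact mul_smul a c (S (γ (c * t)))

/-- `sprayExp` evaluates a flow line picked by choice, so it can be computed from a given flow line
only through uniqueness. -/
lemma IsFlowLine.sprayExp_eq {γ : ℝ → TangentBundle 𝓘(ℝ, E) M} (hγ : IsFlowLine W S γ)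
    (huniq : ∀ γ₀ γ₁ : ℝ → TangentBundle 𝓘(ℝ, E) M, IsFlowLine W S γ₀ → IsFlowLine W S γ₁ →
      γ₀ 0 = γ₁ 0 → EqOn γ₀ γ₁ (Icc (0 : ℝ) 1)) :
    sprayExp W S (γ 0) = (γ 1).proj := by
  have h : ∃ γ' : ℝ → TangentBundle 𝓘(ℝ, E) M, IsFlowLine W S γ' ∧ γ' 0 = γ 0 := ⟨γ, hγ, rfl⟩
  rw [sprayExp, dif_pos h]
  rw [huniq _ _ h.choose_spec.1 hγ h.choose_spec.2 (by simp)]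

/-- `exp_S (t v)` is the base point at time `t` of the flow line through `v`. -/
lemma IsFlowLine.sprayExp_fibreScale (hS : IsSpray W S) {γ : ℝ → TangentBundle 𝓘(ℝ, E) M}
    (hγ : IsFlowLine W S γ)
    (huniq : ∀ γ₀ γ₁ : ℝ → TangentBundle 𝓘(ℝ, E) M, IsFlowLine W S γ₀ → IsFlowLine W S γ₁ →
      γ₀ 0 = γ₁ 0 → EqOn γ₀ γ₁ (Icc (0 : ℝ) 1)) {t : ℝ} (ht : t ∈ Icc (0 : ℝ) 1) :
    fibreScale t (γ 0) ∈ expDomain W S ∧ sprayExp W S (fibreScale t (γ 0)) = (γ t).proj := by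
  have h := hγ.fibreScale_comp_mul hS ht
  have h0 : (fun s => fibreScale t (γ (t * s))) 0 = fibreScale t (γ 0) := by simp
  refine ⟨⟨_, h, h0⟩, ?_⟩
  rw [← h0, h.sprayExp_eq huniq]
  simp [fibreScale]

/-- The zero vectors are rest points of a spray. -/
lemma IsSpray.isFlowLine_zeroVec (hS : IsSpray W S) (x : M) :
    IsFlowLine W S (fun _ => zeroVec x) := by
  have hz : ∀ _ : ℝ, (zeroVec x : TangentBundle 𝓘(ℝ, E) M) ∈ totalSet W := fun _ => (W x).zero_mem
  -- Homogeneity with factor `0`: a constant curve is an integral curve of `0 • S`, and scaling the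
  -- zero vector by `0` leaves it fixed.
  have h := hS.isFlowLine_fibreScale 0 (γ := fun _ => zeroVec x) (fun t _ => hz t) fun t _ => by
    refine (hasMFDerivWithinAt_const (zeroVec x) _ t).congr_mfderiv ?_
    refine ContinuousLinearMap.ext fun (a : ℝ) => ?_
    exact ((congrArg (a • ·) (zero_smul ℝ (S (zeroVec x)))).trans (smul_zero a)).symm
  have h' : (fibreScale 0 ∘ fun _ : ℝ => (zeroVec x : TangentBundle 𝓘(ℝ, E) M)) =
      fun _ => zeroVec x := by
    funext t
    simp [fibreScale, zeroVec]
  rwa [h'] at h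

lemma IsSpray.eqOn_of_isFlowLine_top [T2Space M] {S : ∀ v : TangentBundle 𝓘(ℝ, E) M,
      TangentSpace 𝓘(ℝ, E).tangent v} (hS : IsSpray (fun _ => ⊤) S)
    (γ₀ γ₁ : ℝ → TangentBundle 𝓘(ℝ, E) M) (h₀ : IsFlowLine (fun _ => ⊤) S γ₀)
    (h₁ : IsFlowLine (fun _ => ⊤) S γ₁) (h : γ₀ 0 = γ₁ 0) : EqOn γ₀ γ₁ (Icc (0 : ℝ) 1) := by
  have := t2Space_tangentBundle (E := E) (M := M)
  have hW : totalSet (fun x : M => (⊤ : Submodule ℝ (TangentSpace 𝓘(ℝ, E) x))) = univ :=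
    eq_univ_of_forall fun v =>
      (Submodule.mem_top : v.2 ∈ (⊤ : Submodule ℝ (TangentSpace 𝓘(ℝ, E) v.1)))
  refine eqOn_of_isMIntegralCurveOn (fun w _ => ⟨E × E, inferInstance, inferInstance,
    .ofExtChartAt 𝓘(ℝ, E).tangent w _ hW, mem_extChartAt_source w⟩) hS.smooth h₀.2 h₁.2 h₀.1 h₁.1 h

end Bundles

/-! ### Smooth families of operators -/

section Operators

variable {E : Type*} [NormedAddCommGroup E] [NormedSpace ℝ E]
  {M : Type*} [TopologicalSpace M] [ChartedSpace E M] [IsManifold 𝓘(ℝ, E) ∞ M]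
  {F : Type*} [NormedAddCommGroup F] [NormedSpace ℝ F]
  {E₂ : Type*} [NormedAddCommGroup E₂] [NormedSpace ℝ E₂]

/-- A family of operators which is jointly smooth is smooth in the operator norm. -/
lemma contMDiffOn_clm_of_uncurry {L : M → F →L[ℝ] E₂} {U : Set M} (hU : IsOpen U)
    (h : ContMDiffOn (𝓘(ℝ, E).prod 𝓘(ℝ, F)) 𝓘(ℝ, E₂) ∞ (fun z : M × F => L z.1 z.2)
      (U ×ˢ univ)) : ContMDiffOn 𝓘(ℝ, E) 𝓘(ℝ, F →L[ℝ] E₂) ∞ L U := by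
  intro x hx
  have h1 : ContMDiffAt (𝓘(ℝ, E).prod 𝓘(ℝ, F)) 𝓘(ℝ, E₂) ∞
      (Function.uncurry fun (x : M) (ξ : F) => L x ξ) (x, 0) :=
    h.contMDiffAt ((hU.prod isOpen_univ).mem_nhds ⟨hx, mem_univ _⟩)
  -- The operator `L x` is the derivative at `0` of `ξ ↦ L x ξ`, and a partial derivative of a
  -- jointly smooth map is smooth in the parameter for the operator norm.
  have h2 := ContMDiffAt.mfderiv (fun (x : M) (ξ : F) => L x ξ) (fun _ => (0 : F)) (m := ∞) h1
    contMDiffAt_const (by simp)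
  refine (h2.congr_of_eventuallyEq (Eventually.of_forall fun y => ?_)).contMDiffWithinAt
  refine Eq.trans ?_ (congrFun (inTangentCoordinates_model_space (I := 𝓘(ℝ, F)) (I' := 𝓘(ℝ, E₂))
    (fun _ : M => (0 : F)) (fun x => L x 0)
    (fun x => mfderiv 𝓘(ℝ, F) 𝓘(ℝ, E₂) (fun ξ => L x ξ) 0) x) y).symm
  change L y = mfderiv 𝓘(ℝ, F) 𝓘(ℝ, E₂) (L y) 0
  rw [mfderiv_eq_fderiv, (L y).fderiv]

/-- Completeness enters through the open mapping theorem: a bijective operator is an isomorphism,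
and inversion is smooth near isomorphisms. -/
lemma contDiffAt_clm_inverse [CompleteSpace F] [CompleteSpace E₂] {L : F →L[ℝ] E₂}
    (hbij : Function.Bijective L) : ContDiffAt ℝ ∞ ContinuousLinearMap.inverse L := by
  have := contDiffAt_map_inverse (n := ∞) (𝕜 := ℝ) (ContinuousLinearEquiv.ofBijective L
    (LinearMap.ker_eq_bot.2 hbij.1) (LinearMap.range_eq_top.2 hbij.2))
  rwa [ContinuousLinearEquiv.coe_ofBijective] at this

lemma contMDiffOn_clm_inverse [CompleteSpace F] [CompleteSpace E₂] {L : M → F →L[ℝ] E₂}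
    {U : Set M} (hU : IsOpen U)
    (h : ContMDiffOn (𝓘(ℝ, E).prod 𝓘(ℝ, F)) 𝓘(ℝ, E₂) ∞ (fun z : M × F => L z.1 z.2)
      (U ×ˢ univ)) (hbij : ∀ x ∈ U, Function.Bijective (L x)) :
    ContMDiffOn 𝓘(ℝ, E) 𝓘(ℝ, E₂ →L[ℝ] F) ∞ (fun x => (L x).inverse) U :=
  fun x hx => (contDiffAt_clm_inverse (hbij x hx)).contMDiffAt.comp_contMDiffWithinAt x
    (contMDiffOn_clm_of_uncurry hU h x hx)

lemma clm_inverse_apply_apply [CompleteSpace F] [CompleteSpace E₂] {L : F →L[ℝ] E₂}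
    (hbij : Function.Bijective L) (ξ : F) : L.inverse (L ξ) = ξ := by
  have h := ContinuousLinearEquiv.coe_ofBijective L (LinearMap.ker_eq_bot.2 hbij.1)
    (LinearMap.range_eq_top.2 hbij.2)
  rw [← h, ContinuousLinearMap.inverse_equiv]
  simp

lemma clm_apply_inverse_apply [CompleteSpace F] [CompleteSpace E₂] {L : F →L[ℝ] E₂}
    (hbij : Function.Bijective L) (e : E₂) : L (L.inverse e) = e := by
  obtain ⟨ξ, rfl⟩ := hbij.2 e
  rw [clm_inverse_apply_apply hbij]

end Operators

/-! ### Frames adapted to a splitting of the tangent bundle -/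

section Frames

variable {E : Type u} [NormedAddCommGroup E] [NormedSpace ℝ E]
  {M : Type*} [TopologicalSpace M] [ChartedSpace E M] [IsManifold 𝓘(ℝ, E) ∞ M]

/-- Smooth trivialisations, over `U`, of two complementary subbundles `V` and `H` of `TM`. -/
structure AdaptedFrame (V H : ∀ x : M, Submodule ℝ (TangentSpace 𝓘(ℝ, E) x)) (U : Set M)
    (F G : Type u) [NormedAddCommGroup F] [NormedSpace ℝ F] [NormedAddCommGroup G]
    [NormedSpace ℝ G] where
  frameV : ∀ x : M, F →L[ℝ] TangentSpace 𝓘(ℝ, E) x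
  frameH : ∀ x : M, G →L[ℝ] TangentSpace 𝓘(ℝ, E) x
  coordV : ∀ x : M, TangentSpace 𝓘(ℝ, E) x →L[ℝ] F
  coordH : ∀ x : M, TangentSpace 𝓘(ℝ, E) x →L[ℝ] G
  smooth_frameV : ContMDiffOn (𝓘(ℝ, E).prod 𝓘(ℝ, F)) 𝓘(ℝ, E).tangent ∞
    (fun z : M × F => (⟨z.1, frameV z.1 z.2⟩ : TangentBundle 𝓘(ℝ, E) M)) (U ×ˢ univ)
  smooth_frame : ContMDiffOn (𝓘(ℝ, E).prod 𝓘(ℝ, F × G)) 𝓘(ℝ, E).tangent ∞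
    (fun z : M × (F × G) =>
      (⟨z.1, frameV z.1 z.2.1 + frameH z.1 z.2.2⟩ : TangentBundle 𝓘(ℝ, E) M)) (U ×ˢ univ)
  smooth_coordV : ContMDiffOn 𝓘(ℝ, E).tangent 𝓘(ℝ, F) ∞
    (fun u : TangentBundle 𝓘(ℝ, E) M => coordV u.1 u.2) {u | u.proj ∈ U}
  smooth_coordH : ContMDiffOn 𝓘(ℝ, E).tangent 𝓘(ℝ, G) ∞
    (fun u : TangentBundle 𝓘(ℝ, E) M => coordH u.1 u.2) {u | u.proj ∈ U}
  frameV_mem : ∀ x ∈ U, ∀ ξ, frameV x ξ ∈ V x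
  frameH_mem : ∀ x ∈ U, ∀ a, frameH x a ∈ H x
  coordV_frame : ∀ x ∈ U, ∀ ξ a, coordV x (frameV x ξ + frameH x a) = ξ
  coordH_frame : ∀ x ∈ U, ∀ ξ a, coordH x (frameV x ξ + frameH x a) = a
  frame_coord : ∀ x ∈ U, ∀ v, frameV x (coordV x v) + frameH x (coordH x v) = v
  frameV_coordV : ∀ x ∈ U, ∀ v ∈ V x, frameV x (coordV x v) = v
  frameH_coordH : ∀ x ∈ U, ∀ v ∈ H x, frameH x (coordH x v) = v

lemma contMDiffOn_trivializationAt_snd (x₀ : M) :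
    ContMDiffOn 𝓘(ℝ, E).tangent 𝓘(ℝ, E) ∞ (fun u : TangentBundle 𝓘(ℝ, E) M =>
      (trivializationAt E (TangentSpace 𝓘(ℝ, E)) x₀ u).2)
      {u | u.proj ∈ (chartAt E x₀).source} := by
  have h := (trivializationAt E (TangentSpace 𝓘(ℝ, E) : M → Type _) x₀).contMDiffOn
    (n := ∞) (IB := 𝓘(ℝ, E))
  exact contMDiff_snd.comp_contMDiffOn h

/-- A map into the tangent bundle over a chart domain is smooth if its base point and its fibre
coordinate are. -/
lemma contMDiffOn_tangentBundle_of_trivializationAt {E₂ H₂ : Type*} [NormedAddCommGroup E₂]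
    [NormedSpace ℝ E₂] [TopologicalSpace H₂] {I₂ : ModelWithCorners ℝ E₂ H₂} {Y : Type*}
    [TopologicalSpace Y] [ChartedSpace H₂ Y] {f : Y → TangentBundle 𝓘(ℝ, E) M} {s : Set Y}
    (x₀ : M) (hs : ∀ y ∈ s, (f y).proj ∈ (chartAt E x₀).source)
    (h1 : ContMDiffOn I₂ 𝓘(ℝ, E) ∞ (fun y => (f y).proj) s)
    (h2 : ContMDiffOn I₂ 𝓘(ℝ, E) ∞
      (fun y => (trivializationAt E (TangentSpace 𝓘(ℝ, E)) x₀ (f y)).2) s) :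
    ContMDiffOn I₂ 𝓘(ℝ, E).tangent ∞ f s := by
  intro y hy
  exact ((trivializationAt E (TangentSpace 𝓘(ℝ, E) : M → Type _) x₀).contMDiffWithinAt_iff
    (n := ∞) (IB := 𝓘(ℝ, E)) (hs y hy)).2 ⟨h1 y hy, h2 y hy⟩

variable [CompleteSpace E]
  {E' : Type*} [NormedAddCommGroup E'] [NormedSpace ℝ E']
  {N : Type*} [TopologicalSpace N] [ChartedSpace E' N]

/-- The vertical frame is the one in which the connection has its Christoffel form `B`, the
horizontal one comes from the Ehresmann connection. Since the two bundles are complementary, their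
sum is a fibrewise isomorphism, and the coordinates are its inverse. -/
lemma exists_adaptedFrame {p : M → N} (A : EhresmannConnection E E' p)
    {K : ∀ v : TangentBundle 𝓘(ℝ, E) M,
      TangentSpace 𝓘(ℝ, E).tangent v → TangentSpace 𝓘(ℝ, E) v.proj}
    (hK : IsLinearConnection (vertical E E' p) K) (x₀ : M) :
    ∃ U : Set M, IsOpen U ∧ x₀ ∈ U ∧ U ⊆ (chartAt E x₀).source ∧
      ∃ (F : Type u) (_ : NormedAddCommGroup F) (_ : NormedSpace ℝ F) (_ : CompleteSpace F)
        (G : Type u) (_ : NormedAddCommGroup G) (_ : NormedSpace ℝ G) (_ : CompleteSpace G)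
        (fr : AdaptedFrame (vertical E E' p) A.horizontal U F G) (B : M → E →L[ℝ] F →L[ℝ] F),
        ContMDiffOn 𝓘(ℝ, E) 𝓘(ℝ, E →L[ℝ] F →L[ℝ] F) ∞ B U ∧
        ∀ x ∈ U, ∀ (ξ : F) (X : TangentSpace 𝓘(ℝ, E) x) (η : F),
          K ⟨x, fr.frameV x ξ⟩
            (mfderiv (𝓘(ℝ, E).prod 𝓘(ℝ, F)) 𝓘(ℝ, E).tangent
              (fun z : M × F => (⟨z.1, fr.frameV z.1 z.2⟩ : TangentBundle 𝓘(ℝ, E) M))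
              (x, ξ) (X, η)) =
          fr.frameV x (η + B x (trivializationAt E (TangentSpace 𝓘(ℝ, E)) x₀ ⟨x, X⟩).2 ξ) := by
  obtain ⟨U₁, hU₁, hx₁, hU₁s, F, _, _, _, ΘV, B, hΘV, hV, hB, hKB⟩ := hK x₀
  obtain ⟨U₂, hU₂, hx₂, G, _, _, G', _, _, Θ, hΘ, hH⟩ := A.smooth x₀
  -- The model `G` of the horizontal bundle is not assumed complete; it inherits completeness as a
  -- factor of a space isomorphic to `E`.
  have : CompleteSpace (G × G') := by
    let Θ₀ : (G × G') ≃L[ℝ] E := Θ x₀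
    exact (completeSpace_congr (e := Θ₀.toEquiv) Θ₀.isUniformEmbedding).2 inferInstance
  have : CompleteSpace G := CompleteSpace.fst_of_prod (β := G')
  let ΘH : ∀ x : M, G →L[ℝ] TangentSpace 𝓘(ℝ, E) x := fun x =>
    (Θ x : (G × G') →L[ℝ] TangentSpace 𝓘(ℝ, E) x).comp (ContinuousLinearMap.inl ℝ G G')
  have hΘH : ContMDiffOn (𝓘(ℝ, E).prod 𝓘(ℝ, G)) 𝓘(ℝ, E).tangent ∞
      (fun z : M × G => (⟨z.1, ΘH z.1 z.2⟩ : TangentBundle 𝓘(ℝ, E) M)) (U₂ ×ˢ univ) := by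
    have hi : ContMDiff (𝓘(ℝ, E).prod 𝓘(ℝ, G)) (𝓘(ℝ, E).prod 𝓘(ℝ, G × G')) ∞
        (fun z : M × G => (z.1, (ContinuousLinearMap.inl ℝ G G') z.2)) :=
      contMDiff_fst.prodMk
        ((ContinuousLinearMap.inl ℝ G G').contDiff.contMDiff.comp contMDiff_snd)
    exact hΘ.comp hi.contMDiffOn fun z hz => ⟨hz.1, mem_univ _⟩
  let U := U₁ ∩ U₂
  have hU : IsOpen U := hU₁.inter hU₂
  let e := trivializationAt E (TangentSpace 𝓘(ℝ, E) : M → Type _) x₀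
  have hUs : U ⊆ (chartAt E x₀).source := fun x hx => hU₁s hx.1
  let Θs : ∀ x : M, (F × G) →L[ℝ] TangentSpace 𝓘(ℝ, E) x := fun x =>
    (ΘV x).comp (ContinuousLinearMap.fst ℝ F G) + (ΘH x).comp (ContinuousLinearMap.snd ℝ F G)
  have hΘs : ∀ x ξ a, Θs x (ξ, a) = ΘV x ξ + ΘH x a := fun x ξ a => rfl
  -- Read through the trivialisation at `x₀`, the frame becomes a family of operators between fixed
  -- Banach spaces, to which smoothness of inversion applies.
  let T : M → (F × G) →L[ℝ] E := fun x => (e.continuousLinearMapAt ℝ x).comp (Θs x)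
  have he : ∀ x ∈ U, ∀ v : TangentSpace 𝓘(ℝ, E) x, e.continuousLinearMapAt ℝ x v =
      (e ⟨x, v⟩).2 := fun x hx v =>
    congrFun (e.coe_linearMapAt_of_mem (R := ℝ) (hUs hx)) v
  have heV : ContMDiffOn (𝓘(ℝ, E).prod 𝓘(ℝ, F)) 𝓘(ℝ, E) ∞
      (fun z : M × F => (e ⟨z.1, ΘV z.1 z.2⟩).2) (U ×ˢ univ) :=
    (contMDiffOn_trivializationAt_snd x₀).comp
      (hΘV.mono (prod_mono inter_subset_left subset_rfl)) fun z hz => hUs hz.1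
  have heH : ContMDiffOn (𝓘(ℝ, E).prod 𝓘(ℝ, G)) 𝓘(ℝ, E) ∞
      (fun z : M × G => (e ⟨z.1, ΘH z.1 z.2⟩).2) (U ×ˢ univ) :=
    (contMDiffOn_trivializationAt_snd x₀).comp
      (hΘH.mono (prod_mono inter_subset_right subset_rfl)) fun z hz => hUs hz.1
  have hT : ContMDiffOn (𝓘(ℝ, E).prod 𝓘(ℝ, F × G)) 𝓘(ℝ, E) ∞
      (fun z : M × (F × G) => T z.1 z.2) (U ×ˢ univ) := by
    have h1 : ContMDiffOn (𝓘(ℝ, E).prod 𝓘(ℝ, F × G)) (𝓘(ℝ, E).prod 𝓘(ℝ, F)) ∞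
        (fun z : M × (F × G) => (z.1, z.2.1)) (U ×ˢ univ) :=
      (contMDiff_fst.prodMk ((ContinuousLinearMap.fst ℝ F G).contDiff.contMDiff.comp
        contMDiff_snd)).contMDiffOn
    have h2 : ContMDiffOn (𝓘(ℝ, E).prod 𝓘(ℝ, F × G)) (𝓘(ℝ, E).prod 𝓘(ℝ, G)) ∞
        (fun z : M × (F × G) => (z.1, z.2.2)) (U ×ˢ univ) :=
      (contMDiff_fst.prodMk ((ContinuousLinearMap.snd ℝ F G).contDiff.contMDiff.comp
        contMDiff_snd)).contMDiffOn
    refine ((heV.comp h1 fun z hz => ⟨hz.1, mem_univ _⟩).add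
      (heH.comp h2 fun z hz => ⟨hz.1, mem_univ _⟩)).congr fun z hz => ?_
    change e.continuousLinearMapAt ℝ z.1 (ΘV z.1 z.2.1 + ΘH z.1 z.2.2) = _
    rw [map_add, he _ hz.1, he _ hz.1]
    rfl
  have hHmem : ∀ x ∈ U, ∀ a, ΘH x a ∈ A.horizontal x := fun x hx a =>
    (hH x hx.2 a 0).2 rfl
  have hVmem : ∀ x ∈ U, ∀ ξ, ΘV x ξ ∈ vertical E E' p x := fun x hx ξ => by
    rw [← (hV x hx.1).2]; exact ⟨ξ, rfl⟩
  have hHex : ∀ x ∈ U, ∀ v ∈ A.horizontal x, ∃ a, ΘH x a = v := fun x hx v hv => by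
    obtain ⟨⟨a, b⟩, rfl⟩ := (Θ x).surjective v
    obtain rfl := (hH x hx.2 a b).1 hv
    exact ⟨a, rfl⟩
  have hVex : ∀ x ∈ U, ∀ v ∈ vertical E E' p x, ∃ ξ, ΘV x ξ = v := fun x hx v hv => by
    rw [← (hV x hx.1).2] at hv
    exact hv
  have hsur : ∀ x ∈ U, Function.Surjective (Θs x) := by
    intro x hx v
    have hv : v ∈ vertical E E' p x ⊔ A.horizontal x := by
      rw [(A.isCompl x).sup_eq_top]; exact Submodule.mem_top
    obtain ⟨v₁, hv₁, v₂, hv₂, rfl⟩ := Submodule.mem_sup.1 hv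
    obtain ⟨ξ, rfl⟩ := hVex x hx v₁ hv₁
    obtain ⟨a, rfl⟩ := hHex x hx v₂ hv₂
    exact ⟨(ξ, a), rfl⟩
  have hbij : ∀ x ∈ U, Function.Bijective (T x) := by
    intro x hx
    have h1 : Function.Bijective (e.continuousLinearMapAt ℝ x) := by
      have := (e.continuousLinearEquivAt ℝ x (hUs hx)).bijective
      rwa [← ContinuousLinearEquiv.coe_coe,
        e.coe_continuousLinearEquivAt_eq' (hUs hx)] at this
    refine h1.comp ⟨(injective_iff_map_eq_zero (Θs x)).2 ?_, hsur x hx⟩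
    · rintro ⟨ξ, a⟩ h
      rw [hΘs] at h
      have h2 : ΘV x ξ ∈ A.horizontal x := by
        rw [eq_neg_of_add_eq_zero_left h]; exact (A.horizontal x).neg_mem (hHmem x hx a)
      have h3 : ΘV x ξ = 0 :=
        Submodule.disjoint_def.1 (A.isCompl x).disjoint _ (hVmem x hx ξ) h2
      have h4 : Θ x (a, 0) = 0 := by
        rw [h3, zero_add] at h; exact h
      have h5 := (Θ x).map_eq_zero_iff.1 h4
      exact Prod.ext ((map_eq_zero_iff (ΘV x) (hV x hx.1).1).1 h3) (congrArg Prod.fst h5)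
  let R : ∀ x : M, TangentSpace 𝓘(ℝ, E) x →L[ℝ] F × G := fun x =>
    (T x).inverse.comp (e.continuousLinearMapAt ℝ x)
  have hRΘ : ∀ x ∈ U, ∀ q, R x (Θs x q) = q := fun x hx q =>
    clm_inverse_apply_apply (hbij x hx) q
  have hRs : ContMDiffOn 𝓘(ℝ, E).tangent 𝓘(ℝ, F × G) ∞
      (fun u : TangentBundle 𝓘(ℝ, E) M => R u.1 u.2) {u | u.proj ∈ U} := by
    have h1 := (contMDiffOn_clm_inverse hU hT hbij).comp
      (contMDiff_proj (TangentSpace 𝓘(ℝ, E))).contMDiffOn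
      (fun (u : TangentBundle 𝓘(ℝ, E) M) (hu : u.proj ∈ U) => hu)
    have h2 := (contMDiffOn_trivializationAt_snd (E := E) x₀).mono
      (fun (u : TangentBundle 𝓘(ℝ, E) M) (hu : u.proj ∈ U) => hUs hu)
    refine (h1.clm_apply h2).congr fun u hu => ?_
    change (T u.1).inverse (e.continuousLinearMapAt ℝ u.1 u.2) = (T u.1).inverse (e u).2
    rw [he _ hu]
  have hΘR : ∀ x ∈ U, ∀ v, Θs x (R x v) = v := fun x hx v => by
    obtain ⟨q, rfl⟩ := hsur x hx v
    rw [hRΘ x hx]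
  have hfrs : ContMDiffOn (𝓘(ℝ, E).prod 𝓘(ℝ, F × G)) 𝓘(ℝ, E).tangent ∞
      (fun z : M × (F × G) => (⟨z.1, Θs z.1 z.2⟩ : TangentBundle 𝓘(ℝ, E) M)) (U ×ˢ univ) := by
    refine contMDiffOn_tangentBundle_of_trivializationAt x₀ (fun z hz => hUs hz.1)
      contMDiff_fst.contMDiffOn (hT.congr fun z hz => ?_)
    exact (he z.1 hz.1 _).symm
  let fr : AdaptedFrame (vertical E E' p) A.horizontal U F G :=
    { frameV := ΘV
      frameH := ΘH
      coordV := fun x => (ContinuousLinearMap.fst ℝ F G).comp (R x)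
      coordH := fun x => (ContinuousLinearMap.snd ℝ F G).comp (R x)
      smooth_frameV := hΘV.mono (prod_mono inter_subset_left subset_rfl)
      smooth_frame := hfrs
      smooth_coordV :=
        (ContinuousLinearMap.fst ℝ F G).contDiff.contMDiff.comp_contMDiffOn hRs
      smooth_coordH :=
        (ContinuousLinearMap.snd ℝ F G).contDiff.contMDiff.comp_contMDiffOn hRs
      frameV_mem := hVmem
      frameH_mem := hHmem
      coordV_frame := fun x hx ξ a => congrArg Prod.fst (hRΘ x hx (ξ, a))
      coordH_frame := fun x hx ξ a => congrArg Prod.snd (hRΘ x hx (ξ, a))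
      frame_coord := fun x hx v => hΘR x hx v
      frameV_coordV := fun x hx v hv => by
        obtain ⟨ξ, rfl⟩ := hVex x hx v hv
        have h := congrArg Prod.fst (hRΘ x hx (ξ, 0))
        rw [hΘs, map_zero, add_zero] at h
        exact congrArg (ΘV x) h
      frameH_coordH := fun x hx v hv => by
        obtain ⟨a, rfl⟩ := hHex x hx v hv
        have h := congrArg Prod.snd (hRΘ x hx (0, a))
        rw [hΘs, map_zero, zero_add] at h
        exact congrArg (ΘH x) h }
  exact ⟨U, hU, ⟨hx₁, hx₂⟩, hUs, F, inferInstance, inferInstance, inferInstance, G, inferInstance,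
    inferInstance, inferInstance, fr, B, hB.mono inter_subset_left, fun x hx => hKB x hx.1⟩

end Frames

/-! ### Horizontal flow lines and parallel transport in a frame -/

section LocalTransport

variable {E : Type u} [NormedAddCommGroup E] [NormedSpace ℝ E]
  {M : Type*} [TopologicalSpace M] [ChartedSpace E M] [IsManifold 𝓘(ℝ, E) ∞ M]
  {F G : Type u} [NormedAddCommGroup F] [NormedSpace ℝ F]
  [NormedAddCommGroup G] [NormedSpace ℝ G]
  {V H : ∀ x : M, Submodule ℝ (TangentSpace 𝓘(ℝ, E) x)} {U : Set M}

lemma AdaptedFrame.contMDiffOn_frameH (fr : AdaptedFrame V H U F G) :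
    ContMDiffOn (𝓘(ℝ, E).prod 𝓘(ℝ, G)) 𝓘(ℝ, E).tangent ∞
      (fun z : M × G => (⟨z.1, fr.frameH z.1 z.2⟩ : TangentBundle 𝓘(ℝ, E) M)) (U ×ˢ univ) := by
  have hi : ContMDiff (𝓘(ℝ, E).prod 𝓘(ℝ, G)) (𝓘(ℝ, E).prod 𝓘(ℝ, F × G)) ∞
      (fun z : M × G => (z.1, (ContinuousLinearMap.inr ℝ F G) z.2)) :=
    contMDiff_fst.prodMk ((ContinuousLinearMap.inr ℝ F G).contDiff.contMDiff.comp contMDiff_snd)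
  refine (fr.smooth_frame.comp hi.contMDiffOn
    fun z hz => ⟨hz.1, mem_univ _⟩).congr fun z hz => ?_
  simp

lemma AdaptedFrame.coordV_frameV (fr : AdaptedFrame V H U F G) {x : M} (hx : x ∈ U) (ξ : F) :
    fr.coordV x (fr.frameV x ξ) = ξ := by
  simpa using fr.coordV_frame x hx ξ 0

lemma AdaptedFrame.coordH_frameH (fr : AdaptedFrame V H U F G) {x : M} (hx : x ∈ U) (a : G) :
    fr.coordH x (fr.frameH x a) = a := by
  simpa using fr.coordH_frame x hx 0 a

/-- The part of the domain of the inverse chart at `x₀` which lies over `U`. -/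
def chartPreimage (E : Type u) [NormedAddCommGroup E] [NormedSpace ℝ E]
    {M : Type*} [TopologicalSpace M] [ChartedSpace E M] (x₀ : M) (U : Set M) : Set E :=
  (extChartAt 𝓘(ℝ, E) x₀).target ∩ (extChartAt 𝓘(ℝ, E) x₀).symm ⁻¹' U

lemma isOpen_chartPreimage (x₀ : M) (hU : IsOpen U) : IsOpen (chartPreimage E x₀ U) :=
  (continuousOn_extChartAt_symm x₀).isOpen_inter_preimage (isOpen_extChartAt_target x₀) hU

lemma mem_chartPreimage {x₀ x : M} (hUs : U ⊆ (chartAt E x₀).source) (hx : x ∈ U) :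
    extChartAt 𝓘(ℝ, E) x₀ x ∈ chartPreimage E x₀ U := by
  have hxs : x ∈ (extChartAt 𝓘(ℝ, E) x₀).source := by rw [extChartAt_source]; exact hUs hx
  refine ⟨(extChartAt 𝓘(ℝ, E) x₀).map_source hxs, ?_⟩
  rwa [mem_preimage, (extChartAt 𝓘(ℝ, E) x₀).left_inv hxs]

/-- The chart of the total space of `H` given by a chart of `M` and a frame. -/
def AdaptedFrame.chartH (fr : AdaptedFrame V H U F G) (x₀ : M) (hU : IsOpen U)
    (hUs : U ⊆ (chartAt E x₀).source) :
    SubmanifoldChart 𝓘(ℝ, E).tangent (totalSet H) (E × G) where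
  toFun u := (extChartAt 𝓘(ℝ, E) x₀ u.proj, fr.coordH u.1 u.2)
  invFun q := ⟨(extChartAt 𝓘(ℝ, E) x₀).symm q.1,
    fr.frameH ((extChartAt 𝓘(ℝ, E) x₀).symm q.1) q.2⟩
  source := {u | u.proj ∈ U}
  target := chartPreimage E x₀ U ×ˢ univ
  isOpen_source := hU.preimage (FiberBundle.continuous_proj E _)
  isOpen_target := (isOpen_chartPreimage x₀ hU).prod isOpen_univ
  contMDiffOn_toFun := by
    refine ContMDiffOn.prodMk_space ?_ fr.smooth_coordH
    exact (contMDiffOn_extChartAt (n := ∞)).comp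
      (contMDiff_proj (TangentSpace 𝓘(ℝ, E))).contMDiffOn fun u hu => hUs hu
  contMDiffOn_invFun := by
    have h1 : ContMDiffOn 𝓘(ℝ, E × G) 𝓘(ℝ, E) ∞
        (fun q : E × G => (extChartAt 𝓘(ℝ, E) x₀).symm q.1) (chartPreimage E x₀ U ×ˢ univ) :=
      (contMDiffOn_extChartAt_symm x₀).comp
        (contDiff_fst (𝕜 := ℝ) (E := E) (F := G)).contMDiff.contMDiffOn fun q hq => hq.1.1
    exact fr.contMDiffOn_frameH.comp (h1.prodMk
      (contDiff_snd (𝕜 := ℝ) (E := E) (F := G)).contMDiff.contMDiffOn)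
      fun q hq => ⟨hq.1.2, mem_univ _⟩
  map_source u _ hu := ⟨mem_chartPreimage hUs hu, mem_univ _⟩
  map_target q hq := ⟨fr.frameH_mem _ hq.1.2 _, hq.1.2⟩
  left_inv u hu hus := by
    have hxs : u.proj ∈ (extChartAt 𝓘(ℝ, E) x₀).source := by rw [extChartAt_source]; exact hUs hus
    rw [(extChartAt 𝓘(ℝ, E) x₀).left_inv hxs, fr.frameH_coordH _ hus _ hu]
  right_inv q hq := by
    refine Prod.ext ((extChartAt 𝓘(ℝ, E) x₀).right_inv hq.1.1) ?_
    exact fr.coordH_frameH hq.1.2 q.2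

/-- The coordinates `y` of a curve over `U` with velocity `y'`, and the matrix `A` of the parallel
transport along it for the connection with Christoffel form `B`. -/
structure IsLocalTransport (x₀ : M) (U : Set M) (B : M → E →L[ℝ] F →L[ℝ] F) (y y' : ℝ → E)
    (A : ℝ → F →L[ℝ] F) : Prop where
  mem : ∀ t ∈ Icc (0 : ℝ) 1, y t ∈ chartPreimage E x₀ U
  hasDerivWithinAt : ∀ t ∈ Icc (0 : ℝ) 1, HasDerivWithinAt y (y' t) (Icc (0 : ℝ) 1) t
  continuousOn : ContinuousOn y' (Icc (0 : ℝ) 1)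
  zero : A 0 = 1
  hasDerivWithinAt_transport : ∀ t ∈ Icc (0 : ℝ) 1, HasDerivWithinAt A
    (-(B ((extChartAt 𝓘(ℝ, E) x₀).symm (y t)) (y' t)).comp (A t)) (Icc (0 : ℝ) 1) t
  isUnit : IsUnit (A 1)

/-- Near a rest point, the horizontal flow lines exist up to time one, and their end points and
the parallel transport along them depend smoothly on the initial value. -/
lemma AdaptedFrame.exists_localTransport [CompleteSpace E] [CompleteSpace F] [CompleteSpace G]
    (fr : AdaptedFrame V H U F G) {x₀ : M}
    (hU : IsOpen U) (hx₀ : x₀ ∈ U) (hUs : U ⊆ (chartAt E x₀).source)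
    {B : M → E →L[ℝ] F →L[ℝ] F}
    (hB : ContMDiffOn 𝓘(ℝ, E) 𝓘(ℝ, E →L[ℝ] F →L[ℝ] F) ∞ B U)
    {S : ∀ v : TangentBundle 𝓘(ℝ, E) M, TangentSpace 𝓘(ℝ, E).tangent v} (hS : IsSpray H S) :
    ∃ D : Set (E × G), IsOpen D ∧ (extChartAt 𝓘(ℝ, E) x₀ x₀, 0) ∈ D ∧
      ∃ (Y : E × G → E) (P : E × G → F →L[ℝ] F), ContDiffOn ℝ ∞ Y D ∧ ContDiffOn ℝ ∞ P D ∧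
      ∀ q ∈ D, ∃ (γ : ℝ → TangentBundle 𝓘(ℝ, E) M) (y y' : ℝ → E) (A : ℝ → F →L[ℝ] F),
        IsFlowLine H S γ ∧ γ 0 = (fr.chartH x₀ hU hUs).invFun q ∧
        (∀ t, (γ t).proj = (extChartAt 𝓘(ℝ, E) x₀).symm (y t)) ∧
        IsLocalTransport x₀ U B y y' A ∧ y 0 = q.1 ∧ y 1 = Y q ∧ A 1 = P q := by
  let χ := fr.chartH x₀ hU hUs
  let φ := extChartAt 𝓘(ℝ, E) x₀
  let g : E × G → E × G := χ.localField S
  have hg : ContDiffOn ℝ ∞ g (chartPreimage E x₀ U ×ˢ univ) := χ.contDiffOn_localField hS.smooth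
  have hBφ : ContDiffOn ℝ ∞ (fun y => B (φ.symm y)) (chartPreimage E x₀ U) := by
    rw [← contMDiffOn_iff_contDiffOn]
    exact hB.comp ((contMDiffOn_extChartAt_symm x₀).mono inter_subset_left) fun y hy => hy.2
  -- One autonomous system for the base point, the horizontal coordinate and the transport matrix.
  -- Its domain `Q` asks the matrix to be a unit, so the solution provides invertibility of the
  -- transport at no extra cost.
  let f : (E × G) × (F →L[ℝ] F) → (E × G) × (F →L[ℝ] F) := fun z =>
    (g z.1, -(B (φ.symm z.1.1) (g z.1).1).comp z.2)
  let Q : Set ((E × G) × (F →L[ℝ] F)) := (chartPreimage E x₀ U ×ˢ univ) ×ˢ {A | IsUnit A}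
  have hQ : IsOpen Q := ((isOpen_chartPreimage x₀ hU).prod isOpen_univ).prod Units.isOpen
  have hg1 : ContDiffOn ℝ ∞ (fun z : (E × G) × (F →L[ℝ] F) => g z.1) Q :=
    hg.comp contDiff_fst.contDiffOn fun z hz => hz.1
  have hB1 : ContDiffOn ℝ ∞ (fun z : (E × G) × (F →L[ℝ] F) => B (φ.symm z.1.1)) Q :=
    hBφ.comp (contDiff_fst.comp contDiff_fst).contDiffOn fun z hz => hz.1.1
  have hf : ContDiffOn ℝ ∞ f Q :=
    hg1.prodMk (((hB1.clm_apply (contDiff_fst.comp_contDiffOn hg1)).clm_comp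
      contDiff_snd.contDiffOn).neg)
  have hz₀ : ((φ x₀, (0 : G)), (1 : F →L[ℝ] F)) ∈ Q :=
    ⟨⟨mem_chartPreimage hUs hx₀, mem_univ _⟩, isUnit_one⟩
  obtain ⟨ε, hε, D, hD, hDz, Γ, hΓ, hΓs⟩ := exists_contDiffOn_flow hQ hf hz₀
  -- The available curves follow `ε • f` for unit time. Starting at `ε⁻¹ • a` and scaling the fibre
  -- by `ε` afterwards gives a flow line of the spray itself that starts at `a`. The matrix starts
  -- at the identity.
  let j : E × G → (E × G) × (F →L[ℝ] F) := fun q => ((q.1, ε⁻¹ • q.2), 1)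
  have hj : ContDiff ℝ ∞ j :=
    (contDiff_fst.prodMk (contDiff_snd.const_smul ε⁻¹)).prodMk contDiff_const
  have hend : ContDiffOn ℝ ∞ (fun q => Γ (j q) 1) (j ⁻¹' D) :=
    hΓs.comp hj.contDiffOn fun q hq => hq
  have hDz' : j (φ x₀, 0) ∈ D := by
    simp only [j, smul_zero]
    exact hDz
  refine ⟨j ⁻¹' D, hD.preimage hj.continuous, hDz',
    fun q => (Γ (j q) 1).1.1, fun q => (Γ (j q) 1).2,
    contDiff_fst.comp_contDiffOn (contDiff_fst.comp_contDiffOn hend),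
    contDiff_snd.comp_contDiffOn hend, fun q hq => ?_⟩
  obtain ⟨hΓ0, hΓt⟩ := hΓ (j q) hq
  have hder1 : ∀ t ∈ Icc (0 : ℝ) 1, HasDerivWithinAt (fun t => (Γ (j q) t).1)
      (ε • g (Γ (j q) t).1) (Icc (0 : ℝ) 1) t := fun t ht => (hΓt t ht).2.fst
  have hcont : ContinuousOn (fun t => (Γ (j q) t).1) (Icc (0 : ℝ) 1) := fun t ht =>
    (hder1 t ht).continuousWithinAt
  refine ⟨fibreScale ε ∘ (χ.invFun ∘ fun t => (Γ (j q) t).1), fun t => (Γ (j q) t).1.1,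
    fun t => ε • (g (Γ (j q) t).1).1, fun t => (Γ (j q) t).2, ?_, ?_, fun t => rfl, ?_, ?_, rfl, rfl⟩
  · refine hS.isFlowLine_fibreScale ε (fun t ht => (χ.map_target _ (hΓt t ht).1.1).1)
      fun t ht => ?_
    exact χ.hasMFDerivWithinAt_invFun_comp hS.mem_tangentSet (hder1 t ht) (hΓt t ht).1.1
  · simp only [Function.comp, hΓ0]
    change fibreScale ε (⟨φ.symm q.1, fr.frameH (φ.symm q.1) (ε⁻¹ • q.2)⟩ :
      TangentBundle 𝓘(ℝ, E) M) = ⟨φ.symm q.1, fr.frameH (φ.symm q.1) q.2⟩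
    rw [fibreScale, map_smul, smul_smul, mul_inv_cancel₀ hε.ne', one_smul]
  · refine ⟨fun t ht => (hΓt t ht).1.1.1, fun t ht => (hder1 t ht).fst, ?_, by simp [hΓ0, j],
      fun t ht => ?_, (hΓt 1 (by simp)).1.2⟩
    · exact (continuous_fst.comp_continuousOn
        (hg.continuousOn.comp hcont fun t ht => (hΓt t ht).1.1)).const_smul ε
    -- The transport equation is linear in the velocity, so the factor `ε` is absorbed by `y' = ε •
    -- g`.
    · have h2 : HasDerivWithinAt (fun t => (Γ (j q) t).2) (ε • f (Γ (j q) t)).2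
          (Icc (0 : ℝ) 1) t := (hΓt t ht).2.snd
      refine h2.congr_deriv ?_
      change ε • -(B (φ.symm (Γ (j q) t).1.1) (g (Γ (j q) t).1).1).comp (Γ (j q) t).2 =
        -(B (φ.symm (Γ (j q) t).1.1) (ε • (g (Γ (j q) t).1).1)).comp (Γ (j q) t).2
      rw [map_smul, ContinuousLinearMap.smul_comp, smul_neg]
  · simp [hΓ0, j]

/-- Over the chart domain the trivialisation at `x₀` is the derivative of the chart. Both sides are
thus the derivative of the chart expression of `c` within `[0, 1]`, which is unique even at the end
points. -/
lemma trivializationAt_velocity {x₀ : M} {c : ℝ → M} {y : ℝ → E} {y' : E} {t : ℝ}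
    (ht : t ∈ Icc (0 : ℝ) 1) (hct : c t ∈ (chartAt E x₀).source) {X : TangentSpace 𝓘(ℝ, E) (c t)}
    (hc : HasMFDerivWithinAt 𝓘(ℝ, ℝ) 𝓘(ℝ, E) c (Icc (0 : ℝ) 1) t
      ((1 : ℝ →L[ℝ] ℝ).smulRight X))
    (hy : HasDerivWithinAt y y' (Icc (0 : ℝ) 1) t)
    (hcy : ∀ s ∈ Icc (0 : ℝ) 1, extChartAt 𝓘(ℝ, E) x₀ (c s) = y s) :
    (trivializationAt E (TangentSpace 𝓘(ℝ, E)) x₀ ⟨c t, X⟩).2 = y' := by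
  have h1 := hasMFDerivWithinAt_smulRight_iff.1 (hasMFDerivWithinAt_comp_velocity hc
    (mdifferentiableAt_extChartAt hct).hasMFDerivAt)
  have h2 := (uniqueDiffOn_Icc (zero_lt_one' ℝ) t ht).eq_deriv _
    (h1.congr (fun s hs => (hcy s hs).symm) (hcy t ht).symm) hy
  rw [← h2, ← TangentBundle.continuousLinearMapAt_trivializationAt hct]
  exact (congrFun ((trivializationAt E (TangentSpace 𝓘(ℝ, E) : M → Type _)
    x₀).coe_linearMapAt_of_mem (R := ℝ) hct) X).symm

/-- The type of `K v w` depends on `v`. Vectors `w`, `w'` at equal points have different types and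
are compared in the model space `E × E`. -/
lemma connector_eq_zero_congr {K : ∀ v : TangentBundle 𝓘(ℝ, E) M,
      TangentSpace 𝓘(ℝ, E).tangent v → TangentSpace 𝓘(ℝ, E) v.proj}
    {v v' : TangentBundle 𝓘(ℝ, E) M} (h : v = v') {w : TangentSpace 𝓘(ℝ, E).tangent v}
    {w' : TangentSpace 𝓘(ℝ, E).tangent v'} (hw : (w : E × E) = w') (h0 : K v w = 0) :
    K v' w' = 0 := by
  subst h
  cases hw
  exact h0

/-! ### Parallel sections in a frame as solutions of a linear differential equation. -/

section Parallel

variable {x₀ : M} {B : M → E →L[ℝ] F →L[ℝ] F} {y y' : ℝ → E} {A : ℝ → F →L[ℝ] F}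
  {K : ∀ v : TangentBundle 𝓘(ℝ, E) M,
    TangentSpace 𝓘(ℝ, E).tangent v → TangentSpace 𝓘(ℝ, E) v.proj} {c : ℝ → M}

/-- In the frame `fr` over a chart at `x₀`, the connector `K` has Christoffel form `B`. -/
def AdaptedFrame.IsChristoffelForm (fr : AdaptedFrame V H U F G) (x₀ : M)
    (K : ∀ v : TangentBundle 𝓘(ℝ, E) M,
      TangentSpace 𝓘(ℝ, E).tangent v → TangentSpace 𝓘(ℝ, E) v.proj)
    (B : M → E →L[ℝ] F →L[ℝ] F) : Prop :=
  ∀ x ∈ U, ∀ (ξ : F) (X : TangentSpace 𝓘(ℝ, E) x) (η : F),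
    K ⟨x, fr.frameV x ξ⟩
      (mfderiv (𝓘(ℝ, E).prod 𝓘(ℝ, F)) 𝓘(ℝ, E).tangent
        (fun z : M × F => (⟨z.1, fr.frameV z.1 z.2⟩ : TangentBundle 𝓘(ℝ, E) M))
        (x, ξ) (X, η)) =
    fr.frameV x (η + B x (trivializationAt E (TangentSpace 𝓘(ℝ, E)) x₀ ⟨x, X⟩).2 ξ)

namespace IsLocalTransport

lemma exists_velocity (hT : IsLocalTransport x₀ U B y y' A)
    (hc : ∀ t ∈ Icc (0 : ℝ) 1, c t = (extChartAt 𝓘(ℝ, E) x₀).symm (y t))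
    {t : ℝ} (ht : t ∈ Icc (0 : ℝ) 1) :
    ∃ X : TangentSpace 𝓘(ℝ, E) (c t), HasMFDerivWithinAt 𝓘(ℝ, ℝ) 𝓘(ℝ, E) c (Icc (0 : ℝ) 1) t
      ((1 : ℝ →L[ℝ] ℝ).smulRight X) := by
  have h1 : MDifferentiableAt 𝓘(ℝ, E) 𝓘(ℝ, E) (extChartAt 𝓘(ℝ, E) x₀).symm (y t) :=
    ((contMDiffOn_extChartAt_symm (n := ∞) x₀).contMDiffAt
      ((isOpen_extChartAt_target x₀).mem_nhds (hT.mem t ht).1)).mdifferentiableAt (by simp)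
  have h2 := hasMFDerivWithinAt_comp_velocity
    (hasMFDerivWithinAt_smulRight_iff.2 (hT.hasDerivWithinAt t ht)) h1.hasMFDerivAt
  exact ⟨_, h2.congr_of_eventuallyEq (eventually_of_mem self_mem_nhdsWithin hc) (hc t ht)⟩

lemma mem_of_eq (hT : IsLocalTransport x₀ U B y y' A)
    (hc : ∀ t ∈ Icc (0 : ℝ) 1, c t = (extChartAt 𝓘(ℝ, E) x₀).symm (y t))
    {t : ℝ} (ht : t ∈ Icc (0 : ℝ) 1) : c t ∈ U := by
  rw [hc t ht]; exact (hT.mem t ht).2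

/-- The covariant derivative, in a frame, of a section along a curve. -/
lemma exists_hasMFDerivWithinAt_frameV (hT : IsLocalTransport x₀ U B y y' A)
    (hU : IsOpen U) (hUs : U ⊆ (chartAt E x₀).source) (fr : AdaptedFrame V H U F G)
    (hK : fr.IsChristoffelForm x₀ K B)
    (hc : ∀ t ∈ Icc (0 : ℝ) 1, c t = (extChartAt 𝓘(ℝ, E) x₀).symm (y t))
    {t : ℝ} (ht : t ∈ Icc (0 : ℝ) 1) {ξ : ℝ → F} {ξ' : F}
    (hξ : HasDerivWithinAt ξ ξ' (Icc (0 : ℝ) 1) t) :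
    ∃ w : TangentSpace 𝓘(ℝ, E).tangent
        (⟨c t, fr.frameV (c t) (ξ t)⟩ : TangentBundle 𝓘(ℝ, E) M),
      HasMFDerivWithinAt 𝓘(ℝ, ℝ) 𝓘(ℝ, E).tangent
        (fun s => (⟨c s, fr.frameV (c s) (ξ s)⟩ : TangentBundle 𝓘(ℝ, E) M)) (Icc (0 : ℝ) 1) t
        ((1 : ℝ →L[ℝ] ℝ).smulRight w) ∧
      K ⟨c t, fr.frameV (c t) (ξ t)⟩ w =
        fr.frameV (c t) (ξ' + B (c t) (y' t) (ξ t)) := by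
  obtain ⟨X, hX⟩ := hT.exists_velocity hc ht
  have hcU : c t ∈ U := hT.mem_of_eq hc ht
  have h1 : HasMFDerivWithinAt 𝓘(ℝ, ℝ) (𝓘(ℝ, E).prod 𝓘(ℝ, F)) (fun s => (c s, ξ s))
      (Icc (0 : ℝ) 1) t ((1 : ℝ →L[ℝ] ℝ).smulRight
        ((X, ξ') : TangentSpace (𝓘(ℝ, E).prod 𝓘(ℝ, F)) (c t, ξ t))) :=
    hX.prodMk (hasMFDerivWithinAt_smulRight_iff.2 hξ)
  have h2 := (fr.smooth_frameV.contMDiffAt (x := (c t, ξ t)) ((hU.prod isOpen_univ).mem_nhds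
    ⟨hcU, mem_univ _⟩)).mdifferentiableAt (by simp)
  refine ⟨_, hasMFDerivWithinAt_comp_velocity h1 h2.hasMFDerivAt, ?_⟩
  refine (hK (c t) hcU (ξ t) X ξ').trans ?_
  rw [trivializationAt_velocity ht (hUs hcU) hX (hT.hasDerivWithinAt t ht) fun s hs => ?_]
  rw [hc s hs, (extChartAt 𝓘(ℝ, E) x₀).right_inv (hT.mem s hs).1]

lemma isParallelAlong (hT : IsLocalTransport x₀ U B y y' A)
    (hU : IsOpen U) (hUs : U ⊆ (chartAt E x₀).source) (fr : AdaptedFrame V H U F G)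
    (hK : fr.IsChristoffelForm x₀ K B)
    (hc : ∀ t ∈ Icc (0 : ℝ) 1, c t = (extChartAt 𝓘(ℝ, E) x₀).symm (y t)) (ξ : F) :
    IsParallelAlong V K c (fun t => ⟨c t, fr.frameV (c t) (A t ξ)⟩) := by
  intro t ht
  refine ⟨rfl, fr.frameV_mem _ (hT.mem_of_eq hc ht) _, ?_⟩
  have hξ : HasDerivWithinAt (fun t => A t ξ) (-(B (c t) (y' t) (A t ξ))) (Icc (0 : ℝ) 1) t := by
    have := (hT.hasDerivWithinAt_transport t ht).clm_apply (hasDerivWithinAt_const t _ ξ)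
    rw [hc t ht]
    simpa using this
  obtain ⟨w, hw, hKw⟩ := hT.exists_hasMFDerivWithinAt_frameV hU hUs fr hK hc ht hξ
  exact ⟨w, hw, by rw [hKw, neg_add_cancel, map_zero]⟩

/-- The frame coordinate of a parallel section solves `ξ' = -B(c', ξ)`, as does `A t (ξ 0)`. The
coefficients are continuous on the compact interval, hence bounded, and a linear equation with
bounded coefficients has unique solutions. -/
lemma eq_of_isParallelAlong (hT : IsLocalTransport x₀ U B y y' A)
    (hU : IsOpen U) (hUs : U ⊆ (chartAt E x₀).source)
    (hB : ContMDiffOn 𝓘(ℝ, E) 𝓘(ℝ, E →L[ℝ] F →L[ℝ] F) ∞ B U) (fr : AdaptedFrame V H U F G)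
    (hK : fr.IsChristoffelForm x₀ K B)
    (hc : ∀ t ∈ Icc (0 : ℝ) 1, c t = (extChartAt 𝓘(ℝ, E) x₀).symm (y t))
    {η : ℝ → TangentBundle 𝓘(ℝ, E) M} (hη : IsParallelAlong V K c η) :
    η 1 = ⟨c 1, fr.frameV (c 1) (A 1 (fr.coordV (η 0).1 (η 0).2))⟩ := by
  let ξ : ℝ → F := fun t => fr.coordV (η t).1 (η t).2
  have hηU : ∀ t ∈ Icc (0 : ℝ) 1, (η t).proj ∈ U := fun t ht => by
    rw [(hη t ht).1]; exact hT.mem_of_eq hc ht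
  have hηξ : ∀ t ∈ Icc (0 : ℝ) 1,
      η t = (⟨c t, fr.frameV (c t) (ξ t)⟩ : TangentBundle 𝓘(ℝ, E) M) := fun t ht => by
    have h := fr.frameV_coordV _ (hηU t ht) _ (hη t ht).2.1
    rw [← (hη t ht).1]
    exact congrArg (TotalSpace.mk (η t).proj) h.symm
  have hder : ∀ t ∈ Icc (0 : ℝ) 1,
      HasDerivWithinAt ξ (-(B (c t) (y' t) (ξ t))) (Icc (0 : ℝ) 1) t := by
    intro t ht
    obtain ⟨-, -, w, hw, hKw⟩ := hη t ht
    have h1 := (fr.smooth_coordV.contMDiffAt (x := η t)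
      ((hU.preimage (FiberBundle.continuous_proj E _)).mem_nhds (hηU t ht))).mdifferentiableAt
      (by simp)
    have h2 : HasDerivWithinAt ξ _ (Icc (0 : ℝ) 1) t :=
      hasMFDerivWithinAt_smulRight_iff.1 (hasMFDerivWithinAt_comp_velocity hw h1.hasMFDerivAt)
    obtain ⟨w', hw', hKw'⟩ := hT.exists_hasMFDerivWithinAt_frameV hU hUs fr hK hc ht h2
    -- The frame formula evaluates `K` at its own velocity `w'` of the curve `η`. Uniqueness of
    -- derivatives within `[0, 1]` identifies `w'` with the given `w`, at which `K` vanishes.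
    have h3 := hw'.congr_of_eventuallyEq (eventually_of_mem self_mem_nhdsWithin hηξ) (hηξ t ht)
    have hu : UniqueMDiffWithinAt 𝓘(ℝ, ℝ) (Icc (0 : ℝ) 1) t :=
      (uniqueDiffOn_Icc (zero_lt_one' ℝ) t ht).uniqueMDiffWithinAt
    have h4 := congrArg (fun L : ℝ →L[ℝ] E × E => L 1) (hu.eq hw h3)
    have h5 : (w : E × E) = w' := by
      have e1 : ∀ v : E × E, ((1 : ℝ →L[ℝ] ℝ).smulRight v) (1 : ℝ) = v := fun v => by simp
      exact ((e1 w).symm.trans h4).trans (e1 w')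
    rw [connector_eq_zero_congr (hηξ t ht) h5 hKw] at hKw'
    have h6 := congrArg (fr.coordV (c t)) hKw'
    rw [map_zero, fr.coordV_frameV (hT.mem_of_eq hc ht)] at h6
    rwa [eq_neg_of_add_eq_zero_left h6.symm] at h2
  have hycont : ContinuousOn y (Icc (0 : ℝ) 1) := fun t ht =>
    (hT.hasDerivWithinAt t ht).continuousWithinAt
  have hcc : ContinuousOn c (Icc (0 : ℝ) 1) :=
    ((continuousOn_extChartAt_symm x₀).comp hycont fun t ht => (hT.mem t ht).1).congr hc
  have hBc : ContinuousOn (fun t => B (c t) (y' t)) (Icc (0 : ℝ) 1) :=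
    (hB.continuousOn.comp hcc fun t ht => hT.mem_of_eq hc ht).clm_apply hT.continuousOn
  obtain ⟨C, hC⟩ := isCompact_Icc.exists_bound_of_continuousOn hBc
  have hA : ∀ t ∈ Icc (0 : ℝ) 1, HasDerivWithinAt (fun t => A t (ξ 0))
      (-(B (c t) (y' t) (A t (ξ 0)))) (Icc (0 : ℝ) 1) t := fun t ht => by
    have := (hT.hasDerivWithinAt_transport t ht).clm_apply (hasDerivWithinAt_const t _ (ξ 0))
    rw [hc t ht]
    simpa using this
  have hIci : ∀ {z : ℝ → F} {z' : F} {t : ℝ}, t ∈ Ico (0 : ℝ) 1 →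
      HasDerivWithinAt z z' (Icc (0 : ℝ) 1) t → HasDerivWithinAt z z' (Ici t) t :=
    fun ht h => h.mono_of_mem_nhdsWithin (Icc_mem_nhdsGE_of_mem ht)
  have hLip : ∀ t ∈ Ico (0 : ℝ) 1, LipschitzOnWith C.toNNReal
      (fun ζ : F => -(B (c t) (y' t) ζ)) univ := fun t ht => by
    have h1 : ‖-(B (c t) (y' t))‖ ≤ C.toNNReal := by
      rw [norm_neg]
      exact (hC t (Ico_subset_Icc_self ht)).trans (Real.le_coe_toNNReal C)
    exact ((-(B (c t) (y' t))).lipschitz.weaken h1).lipschitzOnWith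
  have hfin := ODE_solution_unique_of_mem_Icc_right (s := fun _ => univ) hLip
    (fun t ht => (hder t ht).continuousWithinAt)
    (fun t ht => hIci ht (hder t (Ico_subset_Icc_self ht))) (fun _ _ => mem_univ _)
    (fun t ht => (hA t ht).continuousWithinAt)
    (fun t ht => hIci ht (hA t (Ico_subset_Icc_self ht))) (fun _ _ => mem_univ _)
    (by simp [hT.zero]) (show (1 : ℝ) ∈ Icc (0 : ℝ) 1 by simp)
  rw [hηξ 1 (by simp), hfin]

/-- Parallel transport in a frame. -/
lemma parallelTransport_eq (hT : IsLocalTransport x₀ U B y y' A)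
    (hU : IsOpen U) (hUs : U ⊆ (chartAt E x₀).source)
    (hB : ContMDiffOn 𝓘(ℝ, E) 𝓘(ℝ, E →L[ℝ] F →L[ℝ] F) ∞ B U) (fr : AdaptedFrame V H U F G)
    (hK : fr.IsChristoffelForm x₀ K B)
    (hc : ∀ t ∈ Icc (0 : ℝ) 1, c t = (extChartAt 𝓘(ℝ, E) x₀).symm (y t)) (ξ : F) :
    (∃ η, IsParallelAlong V K c η ∧ η 0 = ⟨c 0, fr.frameV (c 0) ξ⟩) ∧
      parallelTransport V K c ⟨c 0, fr.frameV (c 0) ξ⟩ = ⟨c 1, fr.frameV (c 1) (A 1 ξ)⟩ := by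
  have hex : ∃ η, IsParallelAlong V K c η ∧ η 0 = ⟨c 0, fr.frameV (c 0) ξ⟩ :=
    ⟨_, hT.isParallelAlong hU hUs fr hK hc ξ, by simp [hT.zero]⟩
  refine ⟨hex, ?_⟩
  rw [parallelTransport, dif_pos hex,
    hT.eq_of_isParallelAlong hU hUs hB fr hK hc hex.choose_spec.1, hex.choose_spec.2,
    fr.coordV_frameV (hT.mem_of_eq hc (by simp))]

end IsLocalTransport

end Parallel

end LocalTransport

/-! ### Submersions and horizontal lifts -/

section Submersions

variable {E : Type u} [NormedAddCommGroup E] [NormedSpace ℝ E]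
  {M : Type*} [TopologicalSpace M] [ChartedSpace E M] [IsManifold 𝓘(ℝ, E) ∞ M]
  {E' : Type*} [NormedAddCommGroup E'] [NormedSpace ℝ E']
  {N : Type*} [TopologicalSpace N] [ChartedSpace E' N] [IsManifold 𝓘(ℝ, E') ∞ N]
  {p : M → N}

/-- In submersion charts `p` is the linear projection `pr`, which is onto, and the derivatives of
the charts are isomorphisms. -/
lemma surjective_mfderiv_of_isSubmersionAt {x : M}
    (h : IsSubmersionAt 𝓘(ℝ, E) 𝓘(ℝ, E') ∞ p x) :
    Function.Surjective (mfderiv 𝓘(ℝ, E) 𝓘(ℝ, E') p x) := by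
  have hdom : h.domChart.MDifferentiable 𝓘(ℝ, E) 𝓘(ℝ, E) :=
    ⟨(contMDiffOn_of_mem_maximalAtlas h.domChart_mem_maximalAtlas).mdifferentiableOn (by simp),
      (contMDiffOn_symm_of_mem_maximalAtlas h.domChart_mem_maximalAtlas).mdifferentiableOn
        (by simp)⟩
  have hcod : h.codChart.MDifferentiable 𝓘(ℝ, E') 𝓘(ℝ, E') :=
    ⟨(contMDiffOn_of_mem_maximalAtlas h.codChart_mem_maximalAtlas).mdifferentiableOn (by simp),
      (contMDiffOn_symm_of_mem_maximalAtlas h.codChart_mem_maximalAtlas).mdifferentiableOn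
        (by simp)⟩
  let pr : E →L[ℝ] E' := (ContinuousLinearMap.fst ℝ E' h.complement).comp
    (h.equiv : E →L[ℝ] E' × h.complement)
  have hxs := h.mem_domChart_source
  have hys := h.mem_codChart_source
  have heq : (h.codChart ∘ p) =ᶠ[𝓝 x] (pr ∘ h.domChart) := by
    filter_upwards [h.domChart.open_source.mem_nhds hxs] with z hz
    have hz' : h.domChart z ∈ (h.domChart.extend 𝓘(ℝ, E)).target := by
      simpa using h.domChart.map_source hz
    have := h.writtenInCharts hz'
    have hw : h.codChart (p z) = (h.equiv (h.domChart z)).1 := by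
      simpa [h.domChart.left_inv hz] using this
    exact hw
  have hp : MDifferentiableAt 𝓘(ℝ, E) 𝓘(ℝ, E') p x := h.contMDiffAt.mdifferentiableAt (by simp)
  have h1 := mfderiv_comp x (hcod.mdifferentiableAt hys) hp
  have h2 := mfderiv_comp x (pr.mdifferentiableAt (x := h.domChart x))
    (hdom.mdifferentiableAt hxs)
  have h3 := heq.mfderiv_eq (I := 𝓘(ℝ, E)) (I' := 𝓘(ℝ, E'))
  rw [h1, h2] at h3
  have hpr : Function.Surjective pr := Prod.fst_surjective.comp h.equiv.surjective
  intro v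
  obtain ⟨e, he⟩ := hpr (mfderiv 𝓘(ℝ, E') 𝓘(ℝ, E') h.codChart (p x) v)
  obtain ⟨u, hu⟩ := hdom.mfderiv_surjective hxs e
  refine ⟨u, hcod.mfderiv_injective hys ?_⟩
  have h4 := congrArg (fun L : E →L[ℝ] E' => L u) h3
  refine h4.trans (Eq.trans ?_ he)
  refine Eq.trans ?_ (congrArg pr hu)
  exact congrArg (fun L : E →L[ℝ] E' => L (mfderiv 𝓘(ℝ, E) 𝓘(ℝ, E) h.domChart x u))
    pr.mfderiv_eq

lemma EhresmannConnection.eq_of_tangentMap_eq (A : EhresmannConnection E E' p) {x : M}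
    {h h' : TangentSpace 𝓘(ℝ, E) x} (hh : h ∈ A.horizontal x) (hh' : h' ∈ A.horizontal x)
    (heq : mfderiv 𝓘(ℝ, E) 𝓘(ℝ, E') p x h = mfderiv 𝓘(ℝ, E) 𝓘(ℝ, E') p x h') : h = h' := by
  have h1 : h - h' ∈ vertical E E' p x := by
    change mfderiv 𝓘(ℝ, E) 𝓘(ℝ, E') p x (h - h') = 0
    rw [map_sub, heq, sub_self]
  exact sub_eq_zero.1 (Submodule.disjoint_def.1 (A.isCompl x).disjoint _ h1
    ((A.horizontal x).sub_mem hh hh'))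

variable {F G : Type u} [NormedAddCommGroup F] [NormedSpace ℝ F]
  [NormedAddCommGroup G] [NormedSpace ℝ G] {U : Set M}

lemma EhresmannConnection.verPart_eq (A : EhresmannConnection E E' p)
    (fr : AdaptedFrame (vertical E E' p) A.horizontal U F G) {u : TangentBundle 𝓘(ℝ, E) M}
    (hu : u.proj ∈ U) : A.verPart u = ⟨u.proj, fr.frameV u.proj (fr.coordV u.1 u.2)⟩ := by
  have h := fr.frame_coord _ hu u.2
  refine congrArg (TotalSpace.mk u.proj) ?_
  conv_lhs => rw [← h]
  rw [map_add, Submodule.projection_apply_of_mem_left _ (fr.frameV_mem _ hu _),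
    (Submodule.projection_apply_eq_zero_iff _).2 (fr.frameH_mem _ hu _), add_zero]

lemma EhresmannConnection.horPart_eq (A : EhresmannConnection E E' p)
    (fr : AdaptedFrame (vertical E E' p) A.horizontal U F G) {u : TangentBundle 𝓘(ℝ, E) M}
    (hu : u.proj ∈ U) : A.horPart u = ⟨u.proj, fr.frameH u.proj (fr.coordH u.1 u.2)⟩ := by
  have h := fr.frame_coord _ hu u.2
  refine congrArg (TotalSpace.mk u.proj) ?_
  conv_lhs => rw [← h]
  rw [map_add, Submodule.projection_apply_of_mem_left _ (fr.frameH_mem _ hu _),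
    (Submodule.projection_apply_eq_zero_iff _).2 (fr.frameV_mem _ hu _), zero_add]

/-- Horizontal lifting of tangent vectors is smooth. -/
lemma AdaptedFrame.exists_horizontalLift [CompleteSpace E'] [CompleteSpace G]
    (hp : ∀ x, IsSubmersionAt 𝓘(ℝ, E) 𝓘(ℝ, E') ∞ p x)
    (A : EhresmannConnection E E' p)
    (fr : AdaptedFrame (vertical E E' p) A.horizontal U F G) (hU : IsOpen U) (y₀ : N) :
    ∃ lift : M → TangentBundle 𝓘(ℝ, E') N → G,
      ContMDiffOn (𝓘(ℝ, E).prod 𝓘(ℝ, E').tangent) 𝓘(ℝ, G) ∞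
        (fun z : M × TangentBundle 𝓘(ℝ, E') N => lift z.1 z.2)
        ((U ∩ p ⁻¹' (chartAt E' y₀).source) ×ˢ {n | n.proj ∈ (chartAt E' y₀).source}) ∧
      ∀ x ∈ U ∩ p ⁻¹' (chartAt E' y₀).source, ∀ n : TangentBundle 𝓘(ℝ, E') N, n.proj = p x →
        tangentMap 𝓘(ℝ, E) 𝓘(ℝ, E') p ⟨x, fr.frameH x (lift x n)⟩ = n := by
  have hps : ContMDiff 𝓘(ℝ, E) 𝓘(ℝ, E') ∞ p := fun x => (hp x).contMDiffAt
  let e := trivializationAt E' (TangentSpace 𝓘(ℝ, E') : N → Type _) y₀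
  let U' := U ∩ p ⁻¹' (chartAt E' y₀).source
  have hU' : IsOpen U' := hU.inter ((chartAt E' y₀).open_source.preimage hps.continuous)
  -- `Tp` on the horizontal bundle, read in the frame and in a trivialisation of `TN`. It is
  -- injective because `ker Tp` is a complement of the horizontal space and surjective because `p`
  -- is a submersion.
  let L : M → G →L[ℝ] E' := fun x => (e.continuousLinearMapAt ℝ (p x)).comp
    ((mfderiv 𝓘(ℝ, E) 𝓘(ℝ, E') p x).comp (fr.frameH x))
  have he : ∀ y ∈ (chartAt E' y₀).source, ∀ v : TangentSpace 𝓘(ℝ, E') y,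
      e.continuousLinearMapAt ℝ y v = (e ⟨y, v⟩).2 := fun y hy v =>
    congrFun (e.coe_linearMapAt_of_mem (R := ℝ) hy) v
  have hL : ContMDiffOn (𝓘(ℝ, E).prod 𝓘(ℝ, G)) 𝓘(ℝ, E') ∞ (fun z : M × G => L z.1 z.2)
      (U' ×ˢ univ) := by
    have h1 := (hps.contMDiff_tangentMap (m := ∞) (by simp)).comp_contMDiffOn
      (fr.contMDiffOn_frameH.mono (prod_mono inter_subset_left subset_rfl) :
        ContMDiffOn _ _ _ _ (U' ×ˢ univ))
    refine ((contMDiffOn_trivializationAt_snd y₀).comp h1 fun z hz => hz.1.2).congr fun z hz => ?_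
    exact he _ hz.1.2 _
  have hbij : ∀ x ∈ U', Function.Bijective (L x) := by
    intro x hx
    have h1 : Function.Bijective (e.continuousLinearMapAt ℝ (p x)) := by
      have := (e.continuousLinearEquivAt ℝ (p x) hx.2).bijective
      rwa [← ContinuousLinearEquiv.coe_coe, e.coe_continuousLinearEquivAt_eq' hx.2] at this
    refine h1.comp ⟨fun a b hab => ?_, fun v => ?_⟩
    · have h2 := A.eq_of_tangentMap_eq (fr.frameH_mem x hx.1 a) (fr.frameH_mem x hx.1 b) hab
      rw [← fr.coordH_frameH hx.1 a, h2, fr.coordH_frameH hx.1 b]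
    · obtain ⟨w, rfl⟩ := surjective_mfderiv_of_isSubmersionAt (hp x) v
      refine ⟨fr.coordH x w, ?_⟩
      have h3 : mfderiv 𝓘(ℝ, E) 𝓘(ℝ, E') p x (fr.frameV x (fr.coordV x w)) = 0 :=
        fr.frameV_mem x hx.1 _
      conv_rhs => rw [← fr.frame_coord x hx.1 w, map_add, h3, zero_add]
      rfl
  -- The formula makes sense for `n` not based at `p x`. It is therefore smooth on an open set of
  -- pairs and not merely on those with `n.proj = p x`, where it is a lift.
  refine ⟨fun x n => (L x).inverse (e n).2, ?_, ?_⟩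
  · have h1 := (contMDiffOn_clm_inverse hU' hL hbij).comp
      (contMDiffOn_fst (I := 𝓘(ℝ, E)) (J := 𝓘(ℝ, E').tangent) (n := ∞)
        (s := U' ×ˢ {n : TangentBundle 𝓘(ℝ, E') N | n.proj ∈ (chartAt E' y₀).source}))
      fun z hz => hz.1
    have h2 := (contMDiffOn_trivializationAt_snd (E := E') y₀).comp
      (contMDiffOn_snd (I := 𝓘(ℝ, E)) (J := 𝓘(ℝ, E').tangent) (n := ∞)
        (s := U' ×ˢ {n : TangentBundle 𝓘(ℝ, E') N | n.proj ∈ (chartAt E' y₀).source}))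
      fun z hz => hz.2
    exact h1.clm_apply h2
  · intro x hx n hn
    have h1 := clm_apply_inverse_apply (hbij x hx) (e n).2
    have h2 : (e (tangentMap 𝓘(ℝ, E) 𝓘(ℝ, E') p
        ⟨x, fr.frameH x ((L x).inverse (e n).2)⟩)).2 = (e n).2 := by
      exact (he _ hx.2 _).symm.trans h1
    have hs1 : tangentMap 𝓘(ℝ, E) 𝓘(ℝ, E') p
        ⟨x, fr.frameH x ((L x).inverse (e n).2)⟩ ∈ e.source := by
      rw [e.mem_source]; exact hx.2
    have hs2 : n ∈ e.source := by
      rw [e.mem_source, hn]; exact hx.2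
    refine e.injOn hs1 hs2 (Prod.ext ?_ h2)
    exact (e.coe_fst hs1).trans (Eq.trans hn.symm (e.coe_fst hs2).symm)

variable [T2Space M] [T2Space N] [CompleteSpace E]
  {K : ∀ v : TangentBundle 𝓘(ℝ, E) M,
    TangentSpace 𝓘(ℝ, E).tangent v → TangentSpace 𝓘(ℝ, E) v.proj}

/-- The connection serves only to provide adapted frames; these give submanifold charts of the
horizontal bundle, to which the uniqueness theorem applies. -/
lemma EhresmannConnection.eqOn_of_isFlowLine (A : EhresmannConnection E E' p)
    (hK : IsLinearConnection (vertical E E' p) K)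
    {S : ∀ v : TangentBundle 𝓘(ℝ, E) M, TangentSpace 𝓘(ℝ, E).tangent v}
    (hS : IsSpray A.horizontal S) (γ₀ γ₁ : ℝ → TangentBundle 𝓘(ℝ, E) M)
    (h₀ : IsFlowLine A.horizontal S γ₀) (h₁ : IsFlowLine A.horizontal S γ₁)
    (h : γ₀ 0 = γ₁ 0) : EqOn γ₀ γ₁ (Icc (0 : ℝ) 1) := by
  have := t2Space_tangentBundle (E := E) (M := M)
  refine eqOn_of_isMIntegralCurveOn (W := totalSet A.horizontal) (fun w _ => ?_) hS.smooth
    h₀.2 h₁.2 h₀.1 h₁.1 h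
  obtain ⟨U, hU, hx, hUs, F, _, _, _, G, _, _, _, fr, -⟩ := exists_adaptedFrame A hK w.proj
  exact ⟨E × G, inferInstance, inferInstance, fr.chartH w.proj hU hUs, hx⟩

/-- `Tp` maps horizontal flow lines to flow lines of the spray on the base. -/
lemma IsSprayLift.isFlowLine_tangentMap {A : EhresmannConnection E E' p}
    (hps : ContMDiff 𝓘(ℝ, E) 𝓘(ℝ, E') ∞ p)
    {S_N : ∀ v : TangentBundle 𝓘(ℝ, E') N, TangentSpace 𝓘(ℝ, E').tangent v}
    {S_H : ∀ v : TangentBundle 𝓘(ℝ, E) M, TangentSpace 𝓘(ℝ, E).tangent v}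
    (hS_H : IsSprayLift A S_N S_H) {γ : ℝ → TangentBundle 𝓘(ℝ, E) M}
    (hγ : IsFlowLine A.horizontal S_H γ) :
    IsFlowLine (fun _ => ⊤) S_N (tangentMap 𝓘(ℝ, E) 𝓘(ℝ, E') p ∘ γ) := by
  refine ⟨fun t _ => (Submodule.mem_top : (tangentMap 𝓘(ℝ, E) 𝓘(ℝ, E') p (γ t)).2 ∈
    (⊤ : Submodule ℝ (TangentSpace 𝓘(ℝ, E') (tangentMap 𝓘(ℝ, E) 𝓘(ℝ, E') p (γ t)).1))), fun t ht => ?_⟩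
  have h1 := ((hps.contMDiff_tangentMap (m := ∞) (by simp)).mdifferentiable (by simp)
    (γ t)).hasMFDerivAt
  have h2 := hasMFDerivWithinAt_comp_velocity (hγ.2 t ht) h1
  rwa [hS_H.related _ (hγ.1 t ht)] at h2

lemma IsSprayLift.map_sprayExp {A : EhresmannConnection E E' p}
    (hps : ContMDiff 𝓘(ℝ, E) 𝓘(ℝ, E') ∞ p)
    {S_N : ∀ v : TangentBundle 𝓘(ℝ, E') N, TangentSpace 𝓘(ℝ, E').tangent v}
    (hS_N : IsSpray (fun _ => ⊤) S_N)
    {S_H : ∀ v : TangentBundle 𝓘(ℝ, E) M, TangentSpace 𝓘(ℝ, E).tangent v}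
    (hS_H : IsSprayLift A S_N S_H) (hK : IsLinearConnection (vertical E E' p) K)
    {γ : ℝ → TangentBundle 𝓘(ℝ, E) M} (hγ : IsFlowLine A.horizontal S_H γ) :
    p (sprayExp A.horizontal S_H (γ 0)) =
      sprayExp (fun _ => ⊤) S_N (tangentMap 𝓘(ℝ, E) 𝓘(ℝ, E') p (γ 0)) := by
  rw [hγ.sprayExp_eq (A.eqOn_of_isFlowLine hK hS_H.isSpray)]
  exact ((hS_H.isFlowLine_tangentMap hps hγ).sprayExp_eq hS_N.eqOn_of_isFlowLine_top).symm

end Submersions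

/-! ### Local form of the transport map -/

section LocalForm

variable {E : Type u} [NormedAddCommGroup E] [NormedSpace ℝ E]
  {M : Type*} [TopologicalSpace M] [ChartedSpace E M] [IsManifold 𝓘(ℝ, E) ∞ M]
  {E' : Type*} [NormedAddCommGroup E'] [NormedSpace ℝ E']
  {N : Type*} [TopologicalSpace N] [ChartedSpace E' N]
  {p : M → N}

/-- A description near `x₀`, in a frame `U × (F × G) ≅ TM|_U`, of the horizontal exponential map
and of the parallel transport of vertical vectors along its radial curves. -/
structure TransportChart (A : EhresmannConnection E E' p)
    (S_H : ∀ v : TangentBundle 𝓘(ℝ, E) M, TangentSpace 𝓘(ℝ, E).tangent v)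
    (K : ∀ v : TangentBundle 𝓘(ℝ, E) M,
      TangentSpace 𝓘(ℝ, E).tangent v → TangentSpace 𝓘(ℝ, E) v.proj) (x₀ : M)
    (F G : Type u) [NormedAddCommGroup F] [NormedSpace ℝ F]
    [NormedAddCommGroup G] [NormedSpace ℝ G] where
  base : Set M
  isOpen_base : IsOpen base
  mem_base : x₀ ∈ base
  frame : AdaptedFrame (vertical E E' p) A.horizontal base F G
  dom : Set (M × G)
  isOpen_dom : IsOpen dom
  zero_mem_dom : (x₀, 0) ∈ dom
  endpoint : M × G → M
  matrix : M × G → F →L[ℝ] F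
  smooth_endpoint : ContMDiffOn (𝓘(ℝ, E).prod 𝓘(ℝ, G)) 𝓘(ℝ, E) ∞ endpoint dom
  smooth_matrix : ContMDiffOn (𝓘(ℝ, E).prod 𝓘(ℝ, G)) 𝓘(ℝ, F →L[ℝ] F) ∞ matrix dom
  endpoint_mem : ∀ z ∈ dom, endpoint z ∈ base
  bijective_matrix : ∀ z ∈ dom, Function.Bijective (matrix z)
  exists_flowLine : ∀ z ∈ dom, ∃ γ : ℝ → TangentBundle 𝓘(ℝ, E) M,
    IsFlowLine A.horizontal S_H γ ∧ γ 0 = ⟨z.1, frame.frameH z.1 z.2⟩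
  sprayExp_eq : ∀ z ∈ dom,
    sprayExp A.horizontal S_H ⟨z.1, frame.frameH z.1 z.2⟩ = endpoint z
  exists_parallel : ∀ z ∈ dom, ∀ ξ : F, ∃ η : ℝ → TangentBundle 𝓘(ℝ, E) M,
    IsParallelAlong (vertical E E' p) K
      (horCurve A S_H ⟨z.1, frame.frameH z.1 z.2⟩) η ∧ η 0 = ⟨z.1, frame.frameV z.1 ξ⟩
  parallelTransport_eq : ∀ z ∈ dom, ∀ ξ : F,
    parallelTransport (vertical E E' p) K (horCurve A S_H ⟨z.1, frame.frameH z.1 z.2⟩)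
      ⟨z.1, frame.frameV z.1 ξ⟩ = ⟨endpoint z, frame.frameV (endpoint z) (matrix z ξ)⟩

variable {A : EhresmannConnection E E' p}
  {S_H : ∀ v : TangentBundle 𝓘(ℝ, E) M, TangentSpace 𝓘(ℝ, E).tangent v}
  {K : ∀ v : TangentBundle 𝓘(ℝ, E) M,
    TangentSpace 𝓘(ℝ, E).tangent v → TangentSpace 𝓘(ℝ, E) v.proj}

/-- Here the choice-based `sprayExp` and `parallelTransport` become smooth maps: uniqueness
identifies their values with those of the solutions built in coordinates. The radial curve `c_h` is
the base curve of the flow line through `h`, by homogeneity. -/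
lemma exists_transportChart [CompleteSpace E] [T2Space M] [T2Space N] [IsManifold 𝓘(ℝ, E') ∞ N]
    (hS : IsSpray A.horizontal S_H)
    (hK : IsLinearConnection (vertical E E' p) K) (x₀ : M) :
    ∃ (F : Type u) (_ : NormedAddCommGroup F) (_ : NormedSpace ℝ F) (_ : CompleteSpace F)
      (G : Type u) (_ : NormedAddCommGroup G) (_ : NormedSpace ℝ G) (_ : CompleteSpace G),
      Nonempty (TransportChart A S_H K x₀ F G) := by
  obtain ⟨U, hU, hx₀, hUs, F, _, _, hF, G, _, _, hG, fr, B, hB, hKB⟩ := exists_adaptedFrame A hK x₀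
  obtain ⟨D, hD, hDx, Y, P, hY, hP, hT⟩ := fr.exists_localTransport hU hx₀ hUs hB hS
  have huniq := A.eqOn_of_isFlowLine hK hS
  let φ := extChartAt 𝓘(ℝ, E) x₀
  let q : M × G → E × G := fun z => (φ z.1, z.2)
  have hφ : ContMDiffOn 𝓘(ℝ, E) 𝓘(ℝ, E) ∞ φ U := (contMDiffOn_extChartAt (n := ∞)).mono hUs
  have hq : ContMDiffOn (𝓘(ℝ, E).prod 𝓘(ℝ, G)) 𝓘(ℝ, E × G) ∞ q (U ×ˢ univ) :=
    (hφ.comp contMDiffOn_fst fun z hz => hz.1).prodMk_space contMDiffOn_snd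
  let dom : Set (M × G) := (U ×ˢ univ) ∩ q ⁻¹' D
  have hqdom := hq.mono (inter_subset_left : dom ⊆ _)
  have hleft : ∀ x ∈ U, φ.symm (φ x) = x := fun x hx =>
    φ.left_inv (by rw [extChartAt_source]; exact hUs hx)
  have key : ∀ z ∈ dom, ∃ (γ : ℝ → TangentBundle 𝓘(ℝ, E) M) (y y' : ℝ → E) (A' : ℝ → F →L[ℝ] F),
      IsFlowLine A.horizontal S_H γ ∧ γ 0 = ⟨z.1, fr.frameH z.1 z.2⟩ ∧
      (∀ t ∈ Icc (0 : ℝ) 1, horCurve A S_H ⟨z.1, fr.frameH z.1 z.2⟩ t = φ.symm (y t)) ∧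
      horCurve A S_H ⟨z.1, fr.frameH z.1 z.2⟩ 0 = z.1 ∧
      sprayExp A.horizontal S_H ⟨z.1, fr.frameH z.1 z.2⟩ = φ.symm (Y (q z)) ∧
      IsLocalTransport x₀ U B y y' A' ∧ y 1 = Y (q z) ∧ A' 1 = P (q z) := by
    intro z hz
    obtain ⟨γ, y, y', A', hγ, hγ0, hγy, hL, hy0, hy1, hA1⟩ := hT (q z) hz.2
    have h0 : γ 0 = ⟨z.1, fr.frameH z.1 z.2⟩ := by
      rw [hγ0]
      change (⟨φ.symm (φ z.1), fr.frameH (φ.symm (φ z.1)) z.2⟩ : TangentBundle 𝓘(ℝ, E) M) = _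
      rw [hleft _ hz.1.1]
    have hc : ∀ t ∈ Icc (0 : ℝ) 1,
        horCurve A S_H ⟨z.1, fr.frameH z.1 z.2⟩ t = φ.symm (y t) := fun t ht => by
      rw [← h0, ← hγy t]
      exact (hγ.sprayExp_fibreScale hS huniq ht).2
    refine ⟨γ, y, y', A', hγ, h0, hc, ?_, ?_, hL, hy1, hA1⟩
    · rw [hc 0 (by simp), hy0]
      exact hleft _ hz.1.1
    · rw [← h0, hγ.sprayExp_eq huniq, hγy, hy1]
  have hYmem : ∀ z ∈ dom, Y (q z) ∈ chartPreimage E x₀ U := fun z hz => by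
    obtain ⟨γ, y, y', A', -, -, -, -, -, hL, hy1, -⟩ := key z hz
    rw [← hy1]; exact hL.mem 1 (by simp)
  have hYq : ContMDiffOn (𝓘(ℝ, E).prod 𝓘(ℝ, G)) 𝓘(ℝ, E) ∞ (fun z => Y (q z)) dom :=
    hY.contMDiffOn.comp hqdom fun z hz => hz.2
  refine ⟨F, _, _, hF, G, _, _, hG, ⟨{
    base := U
    isOpen_base := hU
    mem_base := hx₀
    frame := fr
    dom := dom
    isOpen_dom := hq.continuousOn.isOpen_inter_preimage (hU.prod isOpen_univ) hD
    zero_mem_dom := ⟨⟨hx₀, mem_univ _⟩, hDx⟩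
    endpoint := fun z => φ.symm (Y (q z))
    matrix := fun z => P (q z)
    smooth_endpoint := (contMDiffOn_extChartAt_symm x₀).comp hYq fun z hz => (hYmem z hz).1
    smooth_matrix := hP.contMDiffOn.comp hqdom fun z hz => hz.2
    endpoint_mem := fun z hz => (hYmem z hz).2
    bijective_matrix := fun z hz => by
      obtain ⟨γ, y, y', A', -, -, -, -, -, hL, -, hA1⟩ := key z hz
      rw [← hA1]
      exact ContinuousLinearMap.isUnit_iff_bijective.1 hL.isUnit
    exists_flowLine := fun z hz => by
      obtain ⟨γ, -, -, -, hγ, h0, -⟩ := key z hz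
      exact ⟨γ, hγ, h0⟩
    sprayExp_eq := fun z hz => by
      obtain ⟨-, -, -, -, -, -, -, -, h, -⟩ := key z hz
      exact h
    exists_parallel := fun z hz ξ => by
      obtain ⟨γ, y, y', A', -, -, hc, hc0, -, hL, -, -⟩ := key z hz
      have := (hL.parallelTransport_eq hU hUs hB fr hKB hc ξ).1
      rwa [hc0] at this
    parallelTransport_eq := fun z hz ξ => by
      obtain ⟨γ, y, y', A', -, -, hc, hc0, -, hL, hy1, hA1⟩ := key z hz
      have := (hL.parallelTransport_eq hU hUs hB fr hKB hc ξ).2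
      rwa [hc0, hc 1 (by simp), hy1, hA1] at this }⟩⟩

end LocalForm

/-! ### The local addition near a zero vector -/

section LocalInverse

variable {E : Type u} [NormedAddCommGroup E] [NormedSpace ℝ E] [CompleteSpace E]
  {M : Type*} [TopologicalSpace M] [ChartedSpace E M] [IsManifold 𝓘(ℝ, E) ∞ M] [T2Space M]
  {E' : Type*} [NormedAddCommGroup E'] [NormedSpace ℝ E'] [CompleteSpace E']
  {N : Type*} [TopologicalSpace N] [ChartedSpace E' N] [IsManifold 𝓘(ℝ, E') ∞ N] [T2Space N]
  {p : M → N} {A : EhresmannConnection E E' p}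
  {S_N : ∀ v : TangentBundle 𝓘(ℝ, E') N, TangentSpace 𝓘(ℝ, E').tangent v}
  {S_H S_V : ∀ v : TangentBundle 𝓘(ℝ, E) M, TangentSpace 𝓘(ℝ, E).tangent v}
  {K : ∀ v : TangentBundle 𝓘(ℝ, E) M,
    TangentSpace 𝓘(ℝ, E).tangent v → TangentSpace 𝓘(ℝ, E) v.proj}
  {Ω_N : Set (TangentBundle 𝓘(ℝ, E') N)} {O : Set (TangentBundle 𝓘(ℝ, E) M)}

lemma EhresmannConnection.horPart_mem (A : EhresmannConnection E E' p)
    (u : TangentBundle 𝓘(ℝ, E) M) : (A.horPart u).2 ∈ A.horizontal u.1 :=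
  Submodule.projection_apply_mem _ _

lemma EhresmannConnection.horPart_eq_of_tangentMap_eq (A : EhresmannConnection E E' p)
    {u u' : TangentBundle 𝓘(ℝ, E) M} (h : u.proj = u'.proj)
    (hT : tangentMap 𝓘(ℝ, E) 𝓘(ℝ, E') p (A.horPart u) =
      tangentMap 𝓘(ℝ, E) 𝓘(ℝ, E') p (A.horPart u')) : A.horPart u = A.horPart u' := by
  obtain ⟨x, v⟩ := u
  obtain ⟨x', v'⟩ := u'
  obtain rfl : x = x' := h
  refine congrArg (TotalSpace.mk x) (A.eq_of_tangentMap_eq (A.horPart_mem ⟨x, v⟩)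
    (A.horPart_mem ⟨x, v'⟩) ?_)
  exact TotalSpace.mk_injective (F := E') (E := (TangentSpace 𝓘(ℝ, E') : N → Type _)) (p x) hT

lemma EhresmannConnection.horPart_zeroVec (A : EhresmannConnection E E' p) (x : M) :
    A.horPart (zeroVec x) = zeroVec x :=
  congrArg (TotalSpace.mk x) (map_zero _)

lemma tangentMap_zeroVec (x : M) :
    tangentMap 𝓘(ℝ, E) 𝓘(ℝ, E') p (zeroVec x) = zeroVec (p x) :=
  congrArg (TotalSpace.mk (p x)) (map_zero _)

/-- The properties of a tangent vector which make `Σ_M` well defined, compatible with `p` and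
injective at it. -/
structure IsAdmissible (A : EhresmannConnection E E' p)
    (S_N : ∀ v : TangentBundle 𝓘(ℝ, E') N, TangentSpace 𝓘(ℝ, E').tangent v)
    (S_H S_V : ∀ v : TangentBundle 𝓘(ℝ, E) M, TangentSpace 𝓘(ℝ, E).tangent v)
    (K : ∀ v : TangentBundle 𝓘(ℝ, E) M,
      TangentSpace 𝓘(ℝ, E).tangent v → TangentSpace 𝓘(ℝ, E) v.proj)
    (Ω_N : Set (TangentBundle 𝓘(ℝ, E') N)) (O : Set (TangentBundle 𝓘(ℝ, E) M))
    (u : TangentBundle 𝓘(ℝ, E) M) : Prop where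
  mem_expDomain : ∀ t ∈ Icc (0 : ℝ) 1, fibreScale t (A.horPart u) ∈ expDomain A.horizontal S_H
  exists_parallel : ∃ η : ℝ → TangentBundle 𝓘(ℝ, E) M,
    IsParallelAlong (vertical E E' p) K (horCurve A S_H (A.horPart u)) η ∧ η 0 = A.verPart u
  transported_mem : transported A S_H K u ∈ O
  transported_proj : (transported A S_H K u).proj = sprayExp A.horizontal S_H (A.horPart u)
  tangentMap_mem : tangentMap 𝓘(ℝ, E) 𝓘(ℝ, E') p (A.horPart u) ∈ Ω_N
  map_sigmaMap : p (sigmaMap A S_H S_V K u) =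
    sprayExp (fun _ => ⊤) S_N (tangentMap 𝓘(ℝ, E) 𝓘(ℝ, E') p (A.horPart u))
  eq_of_transported_eq : ∀ u', A.horPart u' = A.horPart u →
    transported A S_H K u' = transported A S_H K u → u' = u

variable {x₀ : M} {F G : Type u} [NormedAddCommGroup F] [NormedSpace ℝ F]
  [NormedAddCommGroup G] [NormedSpace ℝ G]

namespace TransportChart

variable (C : TransportChart A S_H K x₀ F G)

/-- The coordinates of the horizontal part of a tangent vector. -/
def coord (u : TangentBundle 𝓘(ℝ, E) M) : M × G := (u.proj, C.frame.coordH u.1 u.2)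

/-- The tangent vectors whose horizontal part lies in the chart. -/
def source : Set (TangentBundle 𝓘(ℝ, E) M) := {u | u.proj ∈ C.base} ∩ C.coord ⁻¹' C.dom

/-- The vertical vectors transported along the radial curves, in the frame. -/
def transport (u : TangentBundle 𝓘(ℝ, E) M) : TangentBundle 𝓘(ℝ, E) M :=
  ⟨C.endpoint (C.coord u), C.frame.frameV (C.endpoint (C.coord u))
    (C.matrix (C.coord u) (C.frame.coordV u.1 u.2))⟩

lemma contMDiffOn_coord : ContMDiffOn 𝓘(ℝ, E).tangent (𝓘(ℝ, E).prod 𝓘(ℝ, G)) ∞ C.coord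
    {u | u.proj ∈ C.base} :=
  (contMDiff_proj (TangentSpace 𝓘(ℝ, E))).contMDiffOn.prodMk C.frame.smooth_coordH

lemma isOpen_source : IsOpen C.source :=
  C.contMDiffOn_coord.continuousOn.isOpen_inter_preimage
    (C.isOpen_base.preimage (FiberBundle.continuous_proj E _)) C.isOpen_dom

lemma contMDiffOn_horPart : ContMDiffOn 𝓘(ℝ, E).tangent 𝓘(ℝ, E).tangent ∞ A.horPart C.source := by
  refine (C.frame.contMDiffOn_frameH.comp (C.contMDiffOn_coord.mono inter_subset_left)
    fun u hu => ⟨hu.1, mem_univ _⟩).congr fun u hu => ?_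
  exact A.horPart_eq C.frame hu.1

lemma contMDiffOn_transport :
    ContMDiffOn 𝓘(ℝ, E).tangent 𝓘(ℝ, E).tangent ∞ C.transport C.source := by
  have hq : ContMDiffOn _ _ ∞ C.coord C.source := C.contMDiffOn_coord.mono inter_subset_left
  have h1 := C.smooth_endpoint.comp hq fun u hu => hu.2
  have h2 := C.smooth_matrix.comp hq fun u hu => hu.2
  have h3 := h2.clm_apply (C.frame.smooth_coordV.mono (inter_subset_left : C.source ⊆ _))
  exact C.frame.smooth_frameV.comp (h1.prodMk h3)
    fun u hu => ⟨C.endpoint_mem _ hu.2, mem_univ _⟩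

lemma transported_eq {u : TangentBundle 𝓘(ℝ, E) M} (hu : u ∈ C.source) :
    transported A S_H K u = C.transport u := by
  rw [transported, A.horPart_eq C.frame hu.1, A.verPart_eq C.frame hu.1]
  exact C.parallelTransport_eq (C.coord u) hu.2 _

/-- The transport matrix is injective. Only `u` has to lie in the chart: equality of the horizontal
parts forces `u'` into it, so vectors taken from different charts can be compared. -/
lemma eq_of_transported_eq {u u' : TangentBundle 𝓘(ℝ, E) M} (hu : u ∈ C.source)
    (hh : A.horPart u' = A.horPart u)
    (ht : transported A S_H K u' = transported A S_H K u) : u' = u := by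
  have hb : (A.horPart u').proj = (A.horPart u).proj := congrArg TotalSpace.proj hh
  obtain ⟨x, v⟩ := u
  obtain ⟨x', v'⟩ := u'
  obtain rfl : x' = x := hb
  have hx : x' ∈ C.base := hu.1
  have h1 : C.frame.coordH x' v' = C.frame.coordH x' v := by
    rw [A.horPart_eq C.frame (u := ⟨x', v'⟩) hx, A.horPart_eq C.frame (u := ⟨x', v⟩) hx] at hh
    have := congrArg (C.frame.coordH x') (TotalSpace.mk_injective x' hh)
    rwa [C.frame.coordH_frameH hx, C.frame.coordH_frameH hx] at this
  have hc : C.coord ⟨x', v'⟩ = C.coord ⟨x', v⟩ := Prod.ext rfl h1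
  have hu' : (⟨x', v'⟩ : TangentBundle 𝓘(ℝ, E) M) ∈ C.source := ⟨hx, by
    rw [mem_preimage, hc]; exact hu.2⟩
  rw [C.transported_eq hu, C.transported_eq hu', transport, transport, hc] at ht
  have h2 := congrArg (C.frame.coordV _) (TotalSpace.mk_injective _ ht)
  rw [C.frame.coordV_frameV (C.endpoint_mem _ hu.2),
    C.frame.coordV_frameV (C.endpoint_mem _ hu.2)] at h2
  have h3 := (C.bijective_matrix _ hu.2).injective h2
  refine congrArg (TotalSpace.mk x') ?_
  rw [← C.frame.frame_coord x' hx v, ← C.frame.frame_coord x' hx v', h1]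
  exact congrArg (fun ξ => C.frame.frameV x' ξ + _) h3

lemma isAdmissible (hps : ContMDiff 𝓘(ℝ, E) 𝓘(ℝ, E') ∞ p) (hS_N : IsSpray (fun _ => ⊤) S_N)
    (hS_H : IsSprayLift A S_N S_H) (hK : IsLinearConnection (vertical E E' p) K)
    (hlocp : IsLocalAdditionOn E' p O (sprayExp (vertical E E' p) S_V))
    {u : TangentBundle 𝓘(ℝ, E) M} (hu : u ∈ C.source) (hO : C.transport u ∈ O)
    (hΩ : tangentMap 𝓘(ℝ, E) 𝓘(ℝ, E') p (A.horPart u) ∈ Ω_N) :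
    IsAdmissible A S_N S_H S_V K Ω_N O u := by
  obtain ⟨γ, hγ, hγ0⟩ := C.exists_flowLine _ hu.2
  have hh : A.horPart u = γ 0 := (A.horPart_eq C.frame hu.1).trans hγ0.symm
  have hproj : (transported A S_H K u).proj = sprayExp A.horizontal S_H (A.horPart u) := by
    rw [C.transported_eq hu, A.horPart_eq C.frame hu.1]
    exact (C.sprayExp_eq _ hu.2).symm
  have hmem : transported A S_H K u ∈ O := by rwa [C.transported_eq hu]
  refine ⟨fun t ht => ?_, ?_, hmem, hproj, hΩ, ?_, fun u' => C.eq_of_transported_eq hu⟩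
  · rw [hh]
    exact (hγ.sprayExp_fibreScale hS_H.isSpray (A.eqOn_of_isFlowLine hK hS_H.isSpray) ht).1
  · rw [A.horPart_eq C.frame hu.1, A.verPart_eq C.frame hu.1]
    exact C.exists_parallel _ hu.2 _
  -- The vertical exponential does not leave the fibre, since the image of `O` under `(π, exp_V)`
  -- lies in `M ×_p M`. So `p` takes the same value at `Σ_M u` as at the horizontal end point.
  · obtain ⟨O', -, hO'⟩ := hlocp.isRelOpen_image
    have h1 : ((transported A S_H K u).proj, sigmaMap A S_H S_V K u) ∈ fibreProduct p :=
      (hO'.subset (mem_image_of_mem _ hmem)).1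
    rw [hh, ← hS_H.map_sprayExp hps hS_N hK hγ, ← hh, ← hproj]
    exact h1.symm

end TransportChart

/-- Near a zero vector, `(π, Σ_M)` is smooth and has a smooth right inverse. -/
lemma exists_local_rightInverse (hp : ∀ x, IsSubmersionAt 𝓘(ℝ, E) 𝓘(ℝ, E') ∞ p x)
    (hS_N : IsSpray (fun _ => ⊤) S_N)
    (hlocN : IsLocalAddition Ω_N (sprayExp (fun _ => ⊤) S_N))
    (hS_H : IsSprayLift A S_N S_H)
    (hlocp : IsLocalAdditionOn E' p O (sprayExp (vertical E E' p) S_V))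
    (hK : IsLinearConnection (vertical E E' p) K) (x₀ : M) :
    ∃ D : Set (TangentBundle 𝓘(ℝ, E) M), IsOpen D ∧ zeroVec x₀ ∈ D ∧
      (∀ u ∈ D, IsAdmissible A S_N S_H S_V K Ω_N O u) ∧
      ContMDiffOn 𝓘(ℝ, E).tangent (𝓘(ℝ, E).prod 𝓘(ℝ, E)) ∞
        (fun u : TangentBundle 𝓘(ℝ, E) M => (u.proj, sigmaMap A S_H S_V K u)) D ∧
      sigmaMap A S_H S_V K (zeroVec x₀) = x₀ ∧
      ∃ (W : Set (M × M)) (g : M × M → TangentBundle 𝓘(ℝ, E) M), IsOpen W ∧ (x₀, x₀) ∈ W ∧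
        ContMDiffOn (𝓘(ℝ, E).prod 𝓘(ℝ, E)) 𝓘(ℝ, E).tangent ∞ g W ∧
        ∀ z ∈ W, g z ∈ D ∧ ((g z).proj, sigmaMap A S_H S_V K (g z)) = z := by
  obtain ⟨F, _, _, _, G, _, _, _, ⟨C⟩⟩ := exists_transportChart hS_H.isSpray hK x₀
  have hps : ContMDiff 𝓘(ℝ, E) 𝓘(ℝ, E') ∞ p := fun x => (hp x).contMDiffAt
  obtain ⟨Õ, hÕ, hOÕ⟩ := hlocp.isRelOpen
  -- the domain
  have hTp : ContMDiffOn 𝓘(ℝ, E).tangent 𝓘(ℝ, E').tangent ∞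
      (fun u => tangentMap 𝓘(ℝ, E) 𝓘(ℝ, E') p (A.horPart u)) C.source :=
    (hps.contMDiff_tangentMap (m := ∞) (by simp)).comp_contMDiffOn C.contMDiffOn_horPart
  -- `O` is open only relative to the vertical bundle, so the open set `Õ` of `TM` that cuts it out
  -- is pulled back; transported vectors are vertical anyway.
  let D := (C.source ∩ C.transport ⁻¹' Õ) ∩
    (C.source ∩ (fun u => tangentMap 𝓘(ℝ, E) 𝓘(ℝ, E') p (A.horPart u)) ⁻¹' Ω_N)
  have hD : IsOpen D :=
    (C.contMDiffOn_transport.continuousOn.isOpen_inter_preimage C.isOpen_source hÕ).inter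
      (hTp.continuousOn.isOpen_inter_preimage C.isOpen_source hlocN.isOpen)
  have hDO : ∀ u ∈ D, C.transport u ∈ O := fun u hu => by
    rw [hOÕ]
    exact ⟨C.frame.frameV_mem _ (C.endpoint_mem _ hu.1.1.2) _, hu.1.2⟩
  have hadm : ∀ u ∈ D, IsAdmissible A S_N S_H S_V K Ω_N O u := fun u hu =>
    C.isAdmissible hps hS_N hS_H hK hlocp hu.1.1 (hDO u hu) hu.2.2
  have hσV : ContMDiffOn 𝓘(ℝ, E).tangent 𝓘(ℝ, E) ∞ (sprayExp (vertical E E' p) S_V) O :=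
    contMDiff_snd.comp_contMDiffOn hlocp.diffeo.1
  have hσ : ContMDiffOn 𝓘(ℝ, E).tangent 𝓘(ℝ, E) ∞ (sigmaMap A S_H S_V K) D := by
    refine (hσV.comp (C.contMDiffOn_transport.mono fun u hu => hu.1.1) hDO).congr fun u hu => ?_
    rw [sigmaMap, C.transported_eq hu.1.1]
    rfl
  -- zero vectors
  have hexp0 : sprayExp A.horizontal S_H (zeroVec x₀) = x₀ :=
    (hS_H.isSpray.isFlowLine_zeroVec x₀).sprayExp_eq (A.eqOn_of_isFlowLine hK hS_H.isSpray)
  have hend0 : C.endpoint (x₀, 0) = x₀ := by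
    rw [← C.sprayExp_eq _ C.zero_mem_dom]
    refine Eq.trans ?_ hexp0
    exact congrArg (fun v => sprayExp A.horizontal S_H (TotalSpace.mk x₀ v))
      (map_zero (C.frame.frameH x₀))
  have hcoord0 : C.coord (zeroVec x₀) = (x₀, 0) := Prod.ext rfl (map_zero (C.frame.coordH x₀))
  have hsrc0 : zeroVec x₀ ∈ C.source := ⟨C.mem_base, by
    rw [mem_preimage, hcoord0]; exact C.zero_mem_dom⟩
  have htr0 : C.transport (zeroVec x₀) = zeroVec x₀ := by
    have h1 : C.frame.coordV x₀ (0 : TangentSpace 𝓘(ℝ, E) x₀) = 0 := map_zero _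
    have h2 : C.transport (zeroVec x₀) = zeroVec (C.endpoint (C.coord (zeroVec x₀))) := by
      refine congrArg (TotalSpace.mk _) ?_
      refine (congrArg (fun ξ => C.frame.frameV _ (C.matrix _ ξ)) h1).trans ?_
      rw [map_zero, map_zero]
    rw [h2, hcoord0, hend0]
  have h0D : zeroVec x₀ ∈ D := by
    refine ⟨⟨hsrc0, ?_⟩, hsrc0, ?_⟩
    · rw [mem_preimage, htr0]
      exact (hOÕ.subset (hlocp.zero_mem x₀)).2
    · change tangentMap 𝓘(ℝ, E) 𝓘(ℝ, E') p (A.horPart (zeroVec x₀)) ∈ Ω_N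
      rw [A.horPart_zeroVec, tangentMap_zeroVec]
      exact hlocN.zero_mem _
  have hσ0 : sigmaMap A S_H S_V K (zeroVec x₀) = x₀ := by
    rw [sigmaMap, C.transported_eq hsrc0, htr0]
    exact hlocp.map_zero x₀
  refine ⟨D, hD, h0D, hadm, (contMDiff_proj (TangentSpace 𝓘(ℝ, E))).contMDiffOn.prodMk hσ, hσ0, ?_⟩
  -- the inverse
  obtain ⟨lift, hlift, hTlift⟩ := C.frame.exists_horizontalLift hp A C.isOpen_base (p x₀)
  obtain ⟨-, gN, hgN, hgNl⟩ := hlocN.diffeo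
  obtain ⟨-, gV, hgV, hgVl⟩ := hlocp.diffeo
  obtain ⟨O', hO', himg⟩ := hlocp.isRelOpen_image
  let U' := C.base ∩ p ⁻¹' (chartAt E' (p x₀)).source
  have hU' : IsOpen U' :=
    C.isOpen_base.inter ((chartAt E' (p x₀)).open_source.preimage hps.continuous)
  let pp : M × M → N × N := fun z => (p z.1, p z.2)
  have hpp : ContMDiff (𝓘(ℝ, E).prod 𝓘(ℝ, E)) (𝓘(ℝ, E').prod 𝓘(ℝ, E')) ∞ pp :=
    (hps.comp contMDiff_fst).prodMk (hps.comp contMDiff_snd)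
  let W₁ : Set (M × M) := (U' ×ˢ univ) ∩
    pp ⁻¹' ((fun v => (v.proj, sprayExp (fun _ => ⊤) S_N v)) '' Ω_N)
  have hW₁ : IsOpen W₁ := (hU'.prod isOpen_univ).inter
    (hlocN.isOpen_image.preimage hpp.continuous)
  -- For `z = (x, y)`, this is the vector at `p x` which `Σ_N` sends to `p y`: the forced value of
  -- `Tp h`.
  let n : M × M → TangentBundle 𝓘(ℝ, E') N := fun z => gN (pp z)
  have hn : ContMDiffOn (𝓘(ℝ, E).prod 𝓘(ℝ, E)) 𝓘(ℝ, E').tangent ∞ n W₁ :=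
    hgN.comp hpp.contMDiffOn fun z hz => hz.2
  have hn' : ∀ z ∈ W₁, n z ∈ Ω_N ∧ (n z).proj = p z.1 ∧
      sprayExp (fun _ => ⊤) S_N (n z) = p z.2 := by
    intro z hz
    obtain ⟨v, hv, hvz⟩ := hz.2
    have h1 : n z = v := by
      change gN (pp z) = v
      rw [← hvz]; exact hgNl hv
    rw [h1]
    exact ⟨hv, congrArg Prod.fst hvz, congrArg Prod.snd hvz⟩
  let q : M × M → M × G := fun z => (z.1, lift z.1 (n z))
  have hq : ContMDiffOn (𝓘(ℝ, E).prod 𝓘(ℝ, E)) (𝓘(ℝ, E).prod 𝓘(ℝ, G)) ∞ q W₁ := by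
    refine contMDiffOn_fst.prodMk (hlift.comp (contMDiffOn_fst.prodMk hn) fun z hz => ?_)
    refine ⟨hz.1.1, ?_⟩
    change (n z).proj ∈ (chartAt E' (p x₀)).source
    rw [(hn' z hz).2.1]; exact hz.1.1.2
  have hTq : ∀ z ∈ W₁,
      tangentMap 𝓘(ℝ, E) 𝓘(ℝ, E') p ⟨z.1, C.frame.frameH z.1 (q z).2⟩ = n z := fun z hz =>
    hTlift z.1 hz.1.1 (n z) (hn' z hz).2.1
  let W₂ : Set (M × M) := W₁ ∩ q ⁻¹' C.dom
  have hW₂ : IsOpen W₂ := hq.continuousOn.isOpen_inter_preimage hW₁ C.isOpen_dom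
  let e : M × M → M × M := fun z => (C.endpoint (q z), z.2)
  have he : ContMDiffOn (𝓘(ℝ, E).prod 𝓘(ℝ, E)) (𝓘(ℝ, E).prod 𝓘(ℝ, E)) ∞ e W₂ :=
    (C.smooth_endpoint.comp (hq.mono inter_subset_left) fun z hz => hz.2).prodMk contMDiffOn_snd
  -- The end point of the lifted vector lies over `Σ_N (n z) = p y`, hence in the fibre of `y`. Only
  -- for this reason can the inverse of the local addition on `p` be applied to `e z`.
  have hpe : ∀ z ∈ W₂, e z ∈ fibreProduct p := by
    intro z hz
    obtain ⟨γ, hγ, hγ0⟩ := C.exists_flowLine _ hz.2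
    have h1 := hS_H.map_sprayExp hps hS_N hK hγ
    rw [hγ0, C.sprayExp_eq _ hz.2] at h1
    refine h1.trans ?_
    rw [hTq z hz.1]
    exact (hn' z hz.1).2.2
  let W₃ : Set (M × M) := W₂ ∩ e ⁻¹' O'
  have hW₃ : IsOpen W₃ := he.continuousOn.isOpen_inter_preimage hW₂ hO'
  have heimg : ∀ z ∈ W₃, e z ∈ (fun v => (v.proj, sprayExp (vertical E E' p) S_V v)) '' O :=
    fun z hz => by rw [himg]; exact ⟨hpe z hz.1, hz.2⟩
  let w : M × M → TangentBundle 𝓘(ℝ, E) M := fun z => gV (e z)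
  have hw : ContMDiffOn (𝓘(ℝ, E).prod 𝓘(ℝ, E)) 𝓘(ℝ, E).tangent ∞ w W₃ :=
    hgV.comp (he.mono inter_subset_left) heimg
  have hw' : ∀ z ∈ W₃, w z ∈ O ∧ (w z).proj = C.endpoint (q z) ∧
      sprayExp (vertical E E' p) S_V (w z) = z.2 := by
    intro z hz
    obtain ⟨v, hv, hvz⟩ := heimg z hz
    have h1 : w z = v := by
      change gV (e z) = v
      rw [← hvz]; exact hgVl hv
    rw [h1]
    exact ⟨hv, congrArg Prod.fst hvz, congrArg Prod.snd hvz⟩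
  have hwb : ∀ z ∈ W₃, (w z).proj ∈ C.base := fun z hz => by
    rw [(hw' z hz).2.1]; exact C.endpoint_mem _ hz.1.2
  -- The vertical coordinate at `x` is recovered by undoing the transport of `w z` from the end
  -- point.
  let ξ : M × M → F := fun z => (C.matrix (q z)).inverse (C.frame.coordV (w z).1 (w z).2)
  have hq₃ : ContMDiffOn (𝓘(ℝ, E).prod 𝓘(ℝ, E)) (𝓘(ℝ, E).prod 𝓘(ℝ, G)) ∞ q W₃ :=
    hq.mono fun z hz => hz.1.1
  have hξ : ContMDiffOn (𝓘(ℝ, E).prod 𝓘(ℝ, E)) 𝓘(ℝ, F) ∞ ξ W₃ := by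
    have h1 : ContMDiffOn (𝓘(ℝ, E).prod 𝓘(ℝ, E)) 𝓘(ℝ, F →L[ℝ] F) ∞
        (fun z => (C.matrix (q z)).inverse) W₃ := fun z hz =>
      (contDiffAt_clm_inverse (C.bijective_matrix _ hz.1.2)).contMDiffAt.comp_contMDiffWithinAt z
        ((C.smooth_matrix.comp hq₃ fun z hz => hz.1.2) z hz)
    exact h1.clm_apply (C.frame.smooth_coordV.comp hw hwb)
  let g : M × M → TangentBundle 𝓘(ℝ, E) M := fun z =>
    ⟨z.1, C.frame.frameV z.1 (ξ z) + C.frame.frameH z.1 (q z).2⟩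
  have hg : ContMDiffOn (𝓘(ℝ, E).prod 𝓘(ℝ, E)) 𝓘(ℝ, E).tangent ∞ g W₃ :=
    C.frame.smooth_frame.comp (contMDiffOn_fst.prodMk (hξ.prodMk_space
      (contMDiff_snd.comp_contMDiffOn hq₃))) fun z hz => ⟨hz.1.1.1.1.1, mem_univ _⟩
  refine ⟨W₃, g, hW₃, ?_, hg, ?_⟩
  · -- the diagonal point
    have hpp0 : pp (x₀, x₀) =
        (fun v => (v.proj, sprayExp (fun _ => ⊤) S_N v)) (zeroVec (p x₀)) :=
      Prod.ext rfl (hlocN.map_zero (p x₀)).symm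
    have h1 : (x₀, x₀) ∈ W₁ := by
      refine ⟨⟨⟨C.mem_base, mem_chart_source E' (p x₀)⟩, mem_univ _⟩, ?_⟩
      rw [mem_preimage, hpp0]
      exact mem_image_of_mem _ (hlocN.zero_mem _)
    have h2 : n (x₀, x₀) = zeroVec (p x₀) := by
      change gN (pp (x₀, x₀)) = _
      rw [hpp0]; exact hgNl (hlocN.zero_mem _)
    have h3 : q (x₀, x₀) = (x₀, 0) := by
      refine Prod.ext rfl ?_
      have h4 := hTq _ h1
      replace h4 := h4.trans (h2.trans (tangentMap_zeroVec (E := E) (p := p) x₀).symm)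
      have h5 := A.eq_of_tangentMap_eq (C.frame.frameH_mem x₀ C.mem_base _)
        (A.horizontal x₀).zero_mem (TotalSpace.mk_injective (F := E')
          (E := (TangentSpace 𝓘(ℝ, E') : N → Type _)) (p x₀) h4)
      have h6 := congrArg (C.frame.coordH x₀) h5
      rwa [C.frame.coordH_frameH C.mem_base, map_zero] at h6
    have h4 : e (x₀, x₀) = (x₀, x₀) := by
      refine Prod.ext ?_ rfl
      change C.endpoint (q (x₀, x₀)) = x₀
      rw [h3, hend0]
    refine ⟨⟨h1, ?_⟩, ?_⟩
    · rw [mem_preimage, h3]; exact C.zero_mem_dom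
    · rw [mem_preimage, h4]
      have := (himg.subset (mem_image_of_mem _ (hlocp.zero_mem x₀))).2
      simp only [hlocp.map_zero] at this
      exact this
  · intro z hz
    have hzb : z.1 ∈ C.base := hz.1.1.1.1.1
    have hcH : C.frame.coordH z.1 (g z).2 = (q z).2 := C.frame.coordH_frame _ hzb _ _
    have hcV : C.frame.coordV z.1 (g z).2 = ξ z := C.frame.coordV_frame _ hzb _ _
    have hcoord : C.coord (g z) = q z := Prod.ext rfl hcH
    have hsrc : g z ∈ C.source := ⟨hzb, by rw [mem_preimage, hcoord]; exact hz.1.2⟩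
    -- Transporting `ξ z` forward gives back the coordinate of `w z`, and a vertical vector is
    -- determined by that coordinate.
    have htr : C.transport (g z) = w z := by
      have h1 : C.matrix (q z) (ξ z) = C.frame.coordV (w z).1 (w z).2 :=
        clm_apply_inverse_apply (C.bijective_matrix _ hz.1.2) _
      have h2 : C.transport (g z) = ⟨C.endpoint (q z), C.frame.frameV (C.endpoint (q z))
          (C.frame.coordV (w z).1 (w z).2)⟩ := by
        rw [TransportChart.transport, hcoord, ← h1]
        exact congrArg (fun ζ => (⟨_, C.frame.frameV _ (C.matrix (q z) ζ)⟩ :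
          TangentBundle 𝓘(ℝ, E) M)) hcV
      rw [h2, ← (hw' z hz).2.1]
      refine congrArg (TotalSpace.mk (w z).proj) (C.frame.frameV_coordV _ (hwb z hz) _ ?_)
      exact (hOÕ.subset (hw' z hz).1).1
    have hhor : tangentMap 𝓘(ℝ, E) 𝓘(ℝ, E') p (A.horPart (g z)) = n z := by
      rw [A.horPart_eq C.frame hsrc.1]
      refine Eq.trans ?_ (hTq z hz.1.1)
      exact congrArg (fun a => tangentMap 𝓘(ℝ, E) 𝓘(ℝ, E') p ⟨z.1, C.frame.frameH z.1 a⟩) hcH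
    refine ⟨⟨⟨hsrc, ?_⟩, hsrc, ?_⟩, Prod.ext rfl ?_⟩
    · rw [mem_preimage, htr]
      exact (hOÕ.subset (hw' z hz).1).2
    · rw [mem_preimage, hhor]
      exact (hn' z hz.1.1).1
    · change sigmaMap A S_H S_V K (g z) = z.2
      rw [sigmaMap, C.transported_eq hsrc, htr]
      exact (hw' z hz).2.2

/-- Applying `p` to the equal values makes the two `Σ_N`-values agree, so the vectors `Tp h` agree
and with them the horizontal parts. The transported vectors then have the same foot point and the
same vertical exponential, hence coincide, and transport is injective. -/
lemma IsAdmissible.eq_of_sigmaMap_eq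
    (hlocN : IsLocalAddition Ω_N (sprayExp (fun _ => ⊤) S_N))
    (hlocp : IsLocalAdditionOn E' p O (sprayExp (vertical E E' p) S_V))
    {u u' : TangentBundle 𝓘(ℝ, E) M} (hu : IsAdmissible A S_N S_H S_V K Ω_N O u)
    (hu' : IsAdmissible A S_N S_H S_V K Ω_N O u') (hx : u.proj = u'.proj)
    (hσ : sigmaMap A S_H S_V K u = sigmaMap A S_H S_V K u') : u = u' := by
  obtain ⟨-, gN, -, hgN⟩ := hlocN.diffeo
  obtain ⟨-, gV, -, hgV⟩ := hlocp.diffeo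
  have h1 : tangentMap 𝓘(ℝ, E) 𝓘(ℝ, E') p (A.horPart u) =
      tangentMap 𝓘(ℝ, E) 𝓘(ℝ, E') p (A.horPart u') := by
    refine hgN.injOn hu.tangentMap_mem hu'.tangentMap_mem (Prod.ext (congrArg p hx) ?_)
    change sprayExp _ S_N _ = sprayExp _ S_N _
    rw [← hu.map_sigmaMap, ← hu'.map_sigmaMap, hσ]
  have h2 := A.horPart_eq_of_tangentMap_eq hx h1
  refine hu'.eq_of_transported_eq u h2
    (hgV.injOn hu.transported_mem hu'.transported_mem (Prod.ext ?_ hσ))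
  change (transported A S_H K u).proj = (transported A S_H K u').proj
  rw [hu.transported_proj, hu'.transported_proj, h2]

/-- A map which near every point of the diagonal has a smooth right inverse, and which is
injective, restricts to a local addition. -/
lemma exists_isLocalAddition {σ : TangentBundle 𝓘(ℝ, E) M → M}
    {Q : TangentBundle 𝓘(ℝ, E) M → Prop}
    (hinj : ∀ u u', Q u → Q u' → u.proj = u'.proj → σ u = σ u' → u = u')
    (hloc : ∀ x₀ : M, ∃ D : Set (TangentBundle 𝓘(ℝ, E) M), IsOpen D ∧ zeroVec x₀ ∈ D ∧
      (∀ u ∈ D, Q u) ∧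
      ContMDiffOn 𝓘(ℝ, E).tangent (𝓘(ℝ, E).prod 𝓘(ℝ, E)) ∞
        (fun u : TangentBundle 𝓘(ℝ, E) M => (u.proj, σ u)) D ∧ σ (zeroVec x₀) = x₀ ∧
      ∃ (W : Set (M × M)) (g : M × M → TangentBundle 𝓘(ℝ, E) M), IsOpen W ∧ (x₀, x₀) ∈ W ∧
        ContMDiffOn (𝓘(ℝ, E).prod 𝓘(ℝ, E)) 𝓘(ℝ, E).tangent ∞ g W ∧
        ∀ z ∈ W, g z ∈ D ∧ ((g z).proj, σ (g z)) = z) :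
    ∃ Ω : Set (TangentBundle 𝓘(ℝ, E) M), (∀ u ∈ Ω, Q u) ∧ IsLocalAddition Ω σ := by
  choose D hD h0D hQ hΨ hσ0 W g hW h0W hg hgW using hloc
  let Ψ : TangentBundle 𝓘(ℝ, E) M → M × M := fun u => (u.proj, σ u)
  -- Cutting `D x` down to the preimage of `W x` makes the image exactly `⋃ x, W x`, which is open.
  let Ω : Set (TangentBundle 𝓘(ℝ, E) M) := ⋃ x, D x ∩ Ψ ⁻¹' W x
  have hΩx : ∀ x, IsOpen (D x ∩ Ψ ⁻¹' W x) := fun x =>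
    (hΨ x).continuousOn.isOpen_inter_preimage (hD x) (hW x)
  have hΩQ : ∀ u ∈ Ω, Q u := fun u hu => by
    obtain ⟨x, hx⟩ := mem_iUnion.1 hu
    exact hQ x u hx.1
  have hinjΨ : InjOn Ψ Ω := fun u hu u' hu' h =>
    hinj u u' (hΩQ u hu) (hΩQ u' hu') (congrArg Prod.fst h) (congrArg Prod.snd h)
  have hgΩ : ∀ x, ∀ z ∈ W x, g x z ∈ Ω ∧ Ψ (g x z) = z := fun x z hz => by
    have h1 : Ψ (g x z) = z := (hgW x z hz).2
    exact ⟨mem_iUnion.2 ⟨x, (hgW x z hz).1, by rw [mem_preimage, h1]; exact hz⟩, h1⟩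
  have himg : Ψ '' Ω = ⋃ x, W x := by
    refine Subset.antisymm ?_ ?_
    · rintro - ⟨u, hu, rfl⟩
      obtain ⟨x, hx⟩ := mem_iUnion.1 hu
      exact mem_iUnion.2 ⟨x, hx.2⟩
    · intro z hz
      obtain ⟨x, hx⟩ := mem_iUnion.1 hz
      exact ⟨g x z, hgΩ x z hx⟩
  refine ⟨Ω, hΩQ, isOpen_iUnion hΩx, fun x => ?_, hσ0, ?_, ?_, ?_⟩
  · refine mem_iUnion.2 ⟨x, h0D x, ?_⟩
    change (x, σ (zeroVec x)) ∈ W x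
    rw [hσ0]; exact h0W x
  · change IsOpen (Ψ '' Ω)
    rw [himg]; exact isOpen_iUnion hW
  · intro u hu
    obtain ⟨x, hx⟩ := mem_iUnion.1 hu
    exact ((hΨ x).contMDiffAt ((hD x).mem_nhds hx.1)).contMDiffWithinAt
  -- The global inverse is a choice function and needs an inhabited domain, so empty `M` is treated
  -- apart.
  · rcases isEmpty_or_nonempty M with hM | ⟨⟨x₁⟩⟩
    · exact ⟨fun z => zeroVec z.1, fun z => (hM.false z.1).elim, fun u => (hM.false u.proj).elim⟩
    have : Nonempty (TangentBundle 𝓘(ℝ, E) M) := ⟨zeroVec x₁⟩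
    let k := Function.invFunOn Ψ Ω
    have hk : LeftInvOn k Ψ Ω := hinjΨ.leftInvOn_invFunOn
    refine ⟨k, fun z hz => ?_, hk⟩
    have hz' : z ∈ ⋃ x, W x := by rw [← himg]; exact hz
    obtain ⟨x, hx⟩ := mem_iUnion.1 hz'
    -- By injectivity on all of `Ω` the global inverse restricts to each local one, and smoothness
    -- is inherited from these.
    have heq : ∀ z ∈ W x, k z = g x z := fun z hz => by
      have h := hk (hgΩ x z hz).1
      rwa [(hgΩ x z hz).2] at h
    refine (((hg x).congr heq).contMDiffAt ((hW x).mem_nhds hx)).contMDiffWithinAt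

end LocalInverse

end SubmersionAddition

end

/-! ### Gluing over all points of `M`. -/

open SubmersionAddition in
theorem mainTheorem2
    {E : Type*} [NormedAddCommGroup E] [NormedSpace ℝ E] [CompleteSpace E]
    {E' : Type*} [NormedAddCommGroup E'] [NormedSpace ℝ E'] [CompleteSpace E']
    {M : Type*} [TopologicalSpace M] [ChartedSpace E M] [IsManifold 𝓘(ℝ, E) ∞ M] [T2Space M]
    {N : Type*} [TopologicalSpace N] [ChartedSpace E' N] [IsManifold 𝓘(ℝ, E') ∞ N] [T2Space N]
    (hM : IsSmoothlyParacompact E M) (hN : IsSmoothlyParacompact E' N)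
    -- a surjective submersion with an Ehresmann connection
    (p : M → N) (hp : ∀ x, IsSubmersionAt 𝓘(ℝ, E) 𝓘(ℝ, E') ∞ p x)
    (hp_surj : Function.Surjective p)
    (A : EhresmannConnection E E' p)
    -- a spray on `N` whose exponential is a local addition with domain `Ω_N`
    (S_N : ∀ v : TangentBundle 𝓘(ℝ, E') N, TangentSpace 𝓘(ℝ, E').tangent v)
    (hS_N : IsSpray (fun _ => ⊤) S_N)
    (Ω_N : Set (TangentBundle 𝓘(ℝ, E') N))
    (hΩ_N : Ω_N ⊆ expDomain (fun _ => ⊤) S_N)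
    (hlocN : IsLocalAddition Ω_N (sprayExp (fun _ => ⊤) S_N))
    -- its lift to the horizontal bundle
    (S_H : ∀ v : TangentBundle 𝓘(ℝ, E) M, TangentSpace 𝓘(ℝ, E).tangent v)
    (hS_H : IsSprayLift A S_N S_H)
    -- a spray on the vertical bundle whose exponential is a local addition on `p` with domain `O`
    (S_V : ∀ v : TangentBundle 𝓘(ℝ, E) M, TangentSpace 𝓘(ℝ, E).tangent v)
    (hS_V : IsSpray (vertical E E' p) S_V)
    (O : Set (TangentBundle 𝓘(ℝ, E) M))
    (hO : O ⊆ expDomain (vertical E E' p) S_V)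
    (hlocp : IsLocalAdditionOn E' p O (sprayExp (vertical E E' p) S_V))
    -- a linear connection on the vertical bundle
    (K : ∀ v : TangentBundle 𝓘(ℝ, E) M,
      TangentSpace 𝓘(ℝ, E).tangent v → TangentSpace 𝓘(ℝ, E) v.proj)
    (hK : IsLinearConnection (vertical E E' p) K) :
    ∃ Ω_M : Set (TangentBundle 𝓘(ℝ, E) M),
      -- `Σ_M` is well defined on `Ω_M`
      (∀ u ∈ Ω_M,
        (∀ t ∈ Icc (0 : ℝ) 1, fibreScale t (A.horPart u) ∈ expDomain A.horizontal S_H) ∧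
        (∃ η : ℝ → TangentBundle 𝓘(ℝ, E) M,
          IsParallelAlong (vertical E E' p) K (horCurve A S_H (A.horPart u)) η ∧
          η 0 = A.verPart u) ∧
        transported A S_H K u ∈ O) ∧
      -- it is a local addition
      IsLocalAddition Ω_M (sigmaMap A S_H S_V K) ∧
      -- and the square over `p` commutes
      ∀ u ∈ Ω_M,
        tangentMap 𝓘(ℝ, E) 𝓘(ℝ, E') p (A.horPart u) ∈ Ω_N ∧
        p (sigmaMap A S_H S_V K u) =
          sprayExp (fun _ => ⊤) S_N (tangentMap 𝓘(ℝ, E) 𝓘(ℝ, E') p (A.horPart u)) := by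
  obtain ⟨Ω_M, hadm, hloc⟩ := exists_isLocalAddition
    (Q := IsAdmissible A S_N S_H S_V K Ω_N O)
    (fun u u' hu hu' => hu.eq_of_sigmaMap_eq hlocN hlocp hu')
    (exists_local_rightInverse hp hS_N hlocN hS_H hlocp hK)
  exact ⟨Ω_M,
    fun u hu => ⟨(hadm u hu).mem_expDomain, (hadm u hu).exists_parallel,
      (hadm u hu).transported_mem⟩, hloc,
    fun u hu => ⟨(hadm u hu).tangentMap_mem, (hadm u hu).map_sigmaMap⟩⟩
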